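/- Let $q\in\mathbb{C}$ with $0<|q|<1$. Write $(x;q)_n=\prod_{k=0}^{n-1}(1-xq^k)$, $(x;q)_\infty=\prod_{k\ge 0}(1-xq^k)$, $j(x;q)=(x;q)_\infty(q/x;q)_\infty(q;q)_\infty$, $J_m=(q^m;q^m)_\infty$, and let $\mathrm{sg}(r)=1$ for integers $r\ge 0$, $\mathrm{sg}(r)=-1$ for $r<0$. Define $$m(x,q,z)=\frac{1}{j(z;q)}\sum_{r=-\infty}^{\infty}\frac{(-1)^rq^{\binom r2}z^r}{1-q^{r-1}xz},\qquad f_{a,b,c}(x,y,q)=\sum_{\mathrm{sg}(r)=\mathrm{sg}(s)}\mathrm{sg}(r)(-1)^{r+s}x^ry^sq^{a\binom r2+brs+c\binom s2},$$ $$\overline f_{a,b,c}(x,y,q)=\sum_{\mathrm{sg}(r)=\mathrm{sg}(s)}(-1)^{r+s}x^ry^sq^{a\binom r2+brs+c\binom s2},$$ the last two sums being over $(r,s)\in\mathbb{Z}^2$, and the mock theta functions $$\psi^{(6)}(q)=\sum_{n\ge 0}\frac{(-1)^nq^{(n+1)^2}(q;q^2)_n}{(-q;q)_{2n+1}},\qquad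 \nu^{(3)}(q)=\sum_{n\ge 0}\frac{q^{n(n+1)}}{(-q;q^2)_{n+1}}.$$ Then all the series below converge, and the following hold. (1) $\displaystyle \psi^{(6)}(q)=q\,\frac{(q;q^2)_\infty}{(q^2;q^2)_\infty}\sum_{n=0}^\infty\sum_{j=-n}^n(-1)^{n+j}q^{3n^2+3n-j^2}.$ (2) For every $t\in\mathbb{C}$ with $t^2=q$ (that is, for either value $t=q^{1/2}$), $$\sum_{n=0}^\infty\frac{(-1)^nq^{n(n+1)}(q^2;q^2)_n}{(-q;q)_{2n+1}}=\sum_{n=0}^\infty\sum_{j=-n}^n(-1)^{n+j}(1-q^{2n+1})q^{3n^2+2n-j^2}$$ $$=\overline f_{1,2,1}(-q^4,-q^4,q^4)-q^5\,\overline f_{1,2,1}(-q^{10},-q^{10},q^4)=\overline f_{1,2,1}(t^3,-t^3,q).$$ (3) $$\nu^{(3)}(q)=\frac{(-q^2;q^2)_\infty}{(q^2;q^2)_\infty}\sum_{n=0}^\infty(1-q^{2n+1})q^{3n^2+2n}\sum_{j=-n}^n(-1)^jq^{-j^2}$$ $$=\frac{J_4}{J_2^2}\left(f_{1,2,1}(q^4,q^4,q^4)+q^5f_{1,2,1}(q^{10},q^{10},q^4)\right)=2q^{-1}m(q^2,q^{12},-1)-q^{-1}\frac{J_1J_3J_8^2J_{12}^2}{J_2J_4J_6J_{24}^2}.$$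 (4) The first identity in (3) is equivalent, under $q\mapsto -q$, to Mortenson's representation $$\sum_{n=0}^\infty\frac{q^{n(n+1)}}{(q;q^2)_{n+1}}=\frac{1}{(q;q)_\infty}\sum_{n=0}^\infty\sum_{j=-n}^n(-1)^nq^{2n^2+2n-j(j+1)/2}:$$ the left side here equals $\nu^{(3)}(-q)$, and the right side equals the value at $-q$ of the first right side in (3). In particular, for each $q$, the first identity in (3) holds at $-q$ if and only if Mortenson's identity holds at $q$; and both do hold. -/

import Mathlib

noncomputable section

namespace MockTheta

/-- The finite `q`-shifted factorial `(x; q)_n = ∏_{k < n} (1 - x q^k)`. -/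
def qPoch (x q : ℂ) (n : ℕ) : ℂ := ∏ k ∈ Finset.range n, (1 - x * q ^ k)

/-- The infinite `q`-shifted factorial `(x; q)_∞ = ∏_{k ≥ 0} (1 - x q^k)`, for `|q| < 1`. -/
def qPochInf (x q : ℂ) : ℂ := ∏' k : ℕ, (1 - x * q ^ k)

/-- The product that defines `(x; q)_∞` converges whenever `|q| < 1`. -/
theorem multipliable_qPochInf (x : ℂ) {q : ℂ} (hq : ‖q‖ < 1) :
    Multipliable fun k : ℕ => 1 - x * q ^ k := by
  have h : Summable fun k : ℕ => ‖-(x * q ^ k)‖ := by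
    simpa [norm_mul, norm_pow] using
      (summable_geometric_of_lt_one (norm_nonneg q) hq).mul_left ‖x‖
  simpa [sub_eq_add_neg] using multipliable_one_add_of_summable h

/-- The theta product `j(x; q) = (x; q)_∞ (q / x; q)_∞ (q; q)_∞`, for `x ≠ 0`. -/
def jTheta (x q : ℂ) : ℂ := qPochInf x q * qPochInf (q / x) q * qPochInf q q

/-- `J_m = (q^m; q^m)_∞`. -/
def bigJ (m : ℕ) (q : ℂ) : ℂ := qPochInf (q ^ m) (q ^ m)

/-- `sg(r) = 1` for `r ≥ 0` and `sg(r) = -1` for `r < 0`. -/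
def sg (r : ℤ) : ℤ := if 0 ≤ r then 1 else -1

/-- The binomial coefficient `r (r - 1) / 2` for an integer `r` (the division is exact). -/
def binom2 (r : ℤ) : ℤ := r * (r - 1) / 2

/-- The summand of the Appell-Lerch series `m(x, q, z)`. -/
def mTerm (x q z : ℂ) (r : ℤ) : ℂ :=
  (-1) ^ r * q ^ binom2 r * z ^ r / (1 - q ^ (r - 1) * x * z)

/-- The Appell-Lerch series `m(x, q, z)`, for `x, z ≠ 0` and neither `z` nor `x z` an integral
power of `q`. -/
def mLerch (x q z : ℂ) : ℂ := (∑' r : ℤ, mTerm x q z r) / jTheta z q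

/-- The summand of the Hecke-type series `f_{a,b,c}(x, y, q)`, extended by zero to the pairs
`(r, s)` with `sg(r) ≠ sg(s)`. -/
def fTerm (a b c : ℤ) (x y q : ℂ) (p : ℤ × ℤ) : ℂ :=
  if sg p.1 = sg p.2 then
    (sg p.1 : ℂ) * (-1) ^ (p.1 + p.2) * x ^ p.1 * y ^ p.2 *
      q ^ (a * binom2 p.1 + b * p.1 * p.2 + c * binom2 p.2)
  else 0

/-- The Hecke-type series `f_{a,b,c}(x, y, q)`, for `x, y ≠ 0`. -/
def fHecke (a b c : ℤ) (x y q : ℂ) : ℂ := ∑' p : ℤ × ℤ, fTerm a b c x y q p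

/-- The summand of the series `\bar f_{a,b,c}(x, y, q)`, extended by zero to the pairs
`(r, s)` with `sg(r) ≠ sg(s)`. -/
def fBarTerm (a b c : ℤ) (x y q : ℂ) (p : ℤ × ℤ) : ℂ :=
  if sg p.1 = sg p.2 then
    (-1) ^ (p.1 + p.2) * x ^ p.1 * y ^ p.2 *
      q ^ (a * binom2 p.1 + b * p.1 * p.2 + c * binom2 p.2)
  else 0

/-- The series `\bar f_{a,b,c}(x, y, q)`, for `x, y ≠ 0`. -/
def fBarHecke (a b c : ℤ) (x y q : ℂ) : ℂ := ∑' p : ℤ × ℤ, fBarTerm a b c x y q p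

/-- The summand of the sixth order mock theta function `ψ^{(6)}`. -/
def psi6Term (q : ℂ) (n : ℕ) : ℂ :=
  (-1) ^ n * q ^ ((n + 1) ^ 2) * qPoch q (q ^ 2) n / qPoch (-q) q (2 * n + 1)

/-- The sixth order mock theta function `ψ^{(6)}(q)`. -/
def psi6 (q : ℂ) : ℂ := ∑' n : ℕ, psi6Term q n

/-- The summand of the third order mock theta function `ν^{(3)}`. -/
def nu3Term (q : ℂ) (n : ℕ) : ℂ := q ^ (n * (n + 1)) / qPoch (-q) (q ^ 2) (n + 1)

/-- The third order mock theta function `ν^{(3)}(q)`. -/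
def nu3 (q : ℂ) : ℂ := ∑' n : ℕ, nu3Term q n

/-- `∑_{j=-n}^{n} (-1)^{n+j} q^{3n^2+3n-j^2}`. -/
def psi6HeckeTerm (q : ℂ) (n : ℕ) : ℂ :=
  ∑ j ∈ Finset.Icc (-(n : ℤ)) n, (-1) ^ ((n : ℤ) + j) * q ^ (3 * (n : ℤ) ^ 2 + 3 * n - j ^ 2)

/-- `(-1)^n q^{n(n+1)} (q^2; q^2)_n / (-q; q)_{2n+1}`. -/
def sigmaTerm (q : ℂ) (n : ℕ) : ℂ :=
  (-1) ^ n * q ^ (n * (n + 1)) * qPoch (q ^ 2) (q ^ 2) n / qPoch (-q) q (2 * n + 1)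

/-- `∑_{j=-n}^{n} (-1)^{n+j} (1 - q^{2n+1}) q^{3n^2+2n-j^2}`. -/
def sigmaHeckeTerm (q : ℂ) (n : ℕ) : ℂ :=
  ∑ j ∈ Finset.Icc (-(n : ℤ)) n,
    (-1) ^ ((n : ℤ) + j) * (1 - q ^ (2 * n + 1)) * q ^ (3 * (n : ℤ) ^ 2 + 2 * n - j ^ 2)

/-- `(1 - q^{2n+1}) q^{3n^2+2n} ∑_{j=-n}^{n} (-1)^j q^{-j^2}`. -/
def nu3HeckeTerm (q : ℂ) (n : ℕ) : ℂ :=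
  (1 - q ^ (2 * n + 1)) * q ^ (3 * n ^ 2 + 2 * n) *
    ∑ j ∈ Finset.Icc (-(n : ℤ)) n, (-1) ^ j * q ^ (-j ^ 2)

/-- `(-q^2; q^2)_∞ / (q^2; q^2)_∞ ∑_{n ≥ 0} (1 - q^{2n+1}) q^{3n^2+2n} ∑_{j=-n}^{n} (-1)^j q^{-j^2}`. -/
def nu3Hecke (q : ℂ) : ℂ :=
  qPochInf (-q ^ 2) (q ^ 2) / qPochInf (q ^ 2) (q ^ 2) * ∑' n : ℕ, nu3HeckeTerm q n

/-- `∑_{j=-n}^{n} (-1)^n q^{2n^2+2n-j(j+1)/2}` (the division is exact). -/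
def mortensonTerm (q : ℂ) (n : ℕ) : ℂ :=
  ∑ j ∈ Finset.Icc (-(n : ℤ)) n,
    (-1) ^ n * q ^ (2 * (n : ℤ) ^ 2 + 2 * n - j * (j + 1) / 2)

/-- Mortenson's series `1 / (q; q)_∞ ∑_{n ≥ 0} ∑_{j=-n}^{n} (-1)^n q^{2n^2+2n-j(j+1)/2}`. -/
def mortensonHecke (q : ℂ) : ℂ := 1 / qPochInf q q * ∑' n : ℕ, mortensonTerm q n

/-- `q^{n(n+1)} / (q; q^2)_{n+1}`, the summand of `ν^{(3)}(-q)`. -/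
def nu3NegTerm (q : ℂ) (n : ℕ) : ℂ := q ^ (n * (n + 1)) / qPoch q (q ^ 2) (n + 1)

end MockTheta

end

/-!
Every Hecke-type representation here comes from the Bailey lemma with one parameter left free,
`IsBaileyPair.tsum_eq`: a Bailey pair `(A, β)` relative to `a = q` turns a series in `β` into a
series in `A`. Its finite form is the `q`-Vandermonde sum applied inside a convolution. The pairs
are found by starting from `β_n = 1 / ((bq; q)_n (cq; q)_n)` and inverting the defining relation
(`isBaileyPair_baileyInv`); the inverse satisfies a first order recurrence
(`baileyInv_recurrence`). In the base `q^2` with `(b, c) = (-q, -1)` the recurrence is solved,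
up to elementary factors, by
`∑_{|j| ≤ n} (-1)^j q^{-j^2}` (`isBaileyPair_altSqSum`), and three values of the free parameter
give the representations of `ψ^{(6)}`, of its false analogue and of `ν^{(3)}`. In the base `q`
with `b = -c` a square root of `q` it is solved by `∑_{|j| ≤ n} q^{-j(j+1)/2}`
(`isBaileyPair_triSum`), which gives Mortenson's representation. As both series representing
`ν^{(3)}(-q)` are thereby evaluated unconditionally, their equivalence follows.

The passage to `f_{1,2,1}` and its false analogue is a rearrangement of absolutely convergent
double series. The integers `j` with `|j| ≤ n` split by the parity of `n + j` into the differences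
`r - s` of the pairs of naturals with `r + s = n` and of those with `r + s = n - 1`
(`hasSum_altSqSum`). For the form in `t = q^{1/2}`, the pairs with `r + s` odd cancel under the
exchange of `r` and `s`, and those with `r + s = 2n` have `r = n + j` and `s = n - j`
(`hasSum_rootTerm`).

For the Appell-Lerch form, a difference equation (`tsum_pow_div_qPoch_mul_qPoch`) expresses
`ν^{(3)}(q)` as `J_4^3 / J_2^2 - q ω(q^2)` with `ω(p) = ∑ p^n / (p; p^2)_{n+1}`. A third Bailey
pair, with `bc = q`, writes `ω(p)` as a unilateral and then a bilateral series with poles at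
`p^{6n+3} = 1` (`tsum_omega`, `tsum_omega_bilateral`). The partial fraction expansion of
`j(w; q) / (j(a; q) j(b; q))` (`jTheta_partialFraction`) is proved by Lagrange interpolation at finitely
many poles and dominated convergence; the Jacobi triple product follows from `q`-Vandermonde by
the same limit. Two instances of the expansion exchange the poles at `p^{6n+3} = 1` for those of
`m(p, p^6, -1)` at `p^{6n+1} = -1` (`tsum_omega_eq`). What remains are two identities between
infinite products (`theta_collapse`, `theta_difference`); each reduces to an instance of the
formula for the product of two theta functions, `jTheta_mul`.
-/

namespace MockTheta

open Filter Topology Finset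

/-! ### Shifted factorials -/

@[simp] theorem qPoch_zero (x q : ℂ) : qPoch x q 0 = 1 := by simp [qPoch]

theorem qPoch_succ (x q : ℂ) (n : ℕ) : qPoch x q (n + 1) = qPoch x q n * (1 - x * q ^ n) := by
  simp [qPoch, prod_range_succ]

theorem qPoch_add (x q : ℂ) (m n : ℕ) :
    qPoch x q (m + n) = qPoch x q m * qPoch (x * q ^ m) q n := by
  simp only [qPoch, prod_range_add]
  congr 1
  exact prod_congr rfl fun k _ => by ring

theorem qPoch_succ' (x q : ℂ) (n : ℕ) :
    qPoch x q (n + 1) = (1 - x) * qPoch (x * q) q n := by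
  rw [add_comm, qPoch_add]
  simp [qPoch_succ]

theorem qPoch_ne_zero {x q : ℂ} (h : ∀ k : ℕ, 1 - x * q ^ k ≠ 0) (n : ℕ) : qPoch x q n ≠ 0 :=
  prod_ne_zero_iff.2 fun k _ => h k

theorem one_sub_ne_zero_of_norm_lt_one {x : ℂ} (hx : ‖x‖ < 1) : 1 - x ≠ 0 := by
  intro h
  rw [sub_eq_zero] at h
  rw [← h] at hx
  simp at hx

theorem one_add_ne_zero_of_norm_lt_one {x : ℂ} (hx : ‖x‖ < 1) : 1 + x ≠ 0 := by
  simpa using one_sub_ne_zero_of_norm_lt_one (x := -x) (by simpa using hx)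

theorem one_sub_mul_pow_ne_zero {x q : ℂ} (hx : ‖x‖ < 1) (hq : ‖q‖ < 1) (k : ℕ) :
    1 - x * q ^ k ≠ 0 := by
  apply one_sub_ne_zero_of_norm_lt_one
  rw [norm_mul, norm_pow]
  calc ‖x‖ * ‖q‖ ^ k ≤ ‖x‖ * 1 := by gcongr; exact pow_le_one₀ (norm_nonneg _) hq.le
    _ < 1 := by simpa using hx

theorem tendsto_qPoch (x : ℂ) {q : ℂ} (hq : ‖q‖ < 1) :
    Tendsto (qPoch x q) atTop (𝓝 (qPochInf x q)) :=
  (multipliable_qPochInf x hq).hasProd.tendsto_prod_nat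

theorem qPochInf_eq_qPoch_mul (x : ℂ) {q : ℂ} (hq : ‖q‖ < 1) (n : ℕ) :
    qPochInf x q = qPoch x q n * qPochInf (x * q ^ n) q := by
  have h1 := ((tendsto_qPoch (x * q ^ n) hq).const_mul (qPoch x q n))
  have h2 := (tendsto_qPoch x hq).comp (tendsto_add_atTop_nat n)
  refine tendsto_nhds_unique h2 (h1.congr fun m => ?_)
  simp only [Function.comp]
  rw [← qPoch_add, add_comm]

theorem qPochInf_eq_one_sub_mul (x : ℂ) {q : ℂ} (hq : ‖q‖ < 1) :
    qPochInf x q = (1 - x) * qPochInf (x * q) q := by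
  simpa [qPoch_succ] using qPochInf_eq_qPoch_mul x hq 1

theorem qPochInf_ne_zero {x q : ℂ} (hq : ‖q‖ < 1) (h : ∀ k : ℕ, 1 - x * q ^ k ≠ 0) :
    qPochInf x q ≠ 0 := by
  have hs : Summable fun k : ℕ => ‖-(x * q ^ k)‖ := by
    simpa [norm_mul, norm_pow] using
      (summable_geometric_of_lt_one (norm_nonneg q) hq).mul_left ‖x‖
  have := tprod_one_add_ne_zero_of_summable (f := fun k : ℕ => -(x * q ^ k))
    (fun k => by simpa [sub_eq_add_neg] using h k) hs
  simpa [qPochInf, sub_eq_add_neg] using this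

theorem qPochInf_ne_zero_of_norm_lt_one {x q : ℂ} (hx : ‖x‖ < 1) (hq : ‖q‖ < 1) :
    qPochInf x q ≠ 0 :=
  qPochInf_ne_zero hq (one_sub_mul_pow_ne_zero hx hq)

/-- Uniform in `n`, from `1 + x ≤ exp x`. -/
theorem norm_qPoch_le (x : ℂ) {q : ℂ} (hq : ‖q‖ < 1) (n : ℕ) :
    ‖qPoch x q n‖ ≤ Real.exp (‖x‖ / (1 - ‖q‖)) := by
  have h1 : ‖qPoch x q n‖ ≤ ∏ k ∈ range n, Real.exp (‖x‖ * ‖q‖ ^ k) := by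
    rw [qPoch, norm_prod]
    refine prod_le_prod (fun _ _ => norm_nonneg _) fun k _ => ?_
    calc ‖1 - x * q ^ k‖ ≤ ‖(1 : ℂ)‖ + ‖x * q ^ k‖ := norm_sub_le _ _
      _ = ‖x‖ * ‖q‖ ^ k + 1 := by simp [add_comm]
      _ ≤ _ := Real.add_one_le_exp _
  refine h1.trans ?_
  rw [← Real.exp_sum, Real.exp_le_exp, ← mul_sum, div_eq_mul_inv]
  gcongr
  rw [← tsum_geometric_of_lt_one (norm_nonneg q) hq]
  exact (summable_geometric_of_lt_one (norm_nonneg q) hq).sum_le_tsum _ fun _ _ => by positivity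

theorem norm_qPoch_le_of_le {x q : ℂ} {R : ℝ} (hx : ‖x‖ ≤ R) (hq : ‖q‖ < 1) (n : ℕ) :
    ‖qPoch x q n‖ ≤ Real.exp (R / (1 - ‖q‖)) := by
  refine (norm_qPoch_le x hq n).trans (Real.exp_le_exp.2 ?_)
  have : 0 < 1 - ‖q‖ := by linarith
  gcongr

theorem norm_qPochInf_le_of_le {x q : ℂ} {R : ℝ} (hx : ‖x‖ ≤ R) (hq : ‖q‖ < 1) :
    ‖qPochInf x q‖ ≤ Real.exp (R / (1 - ‖q‖)) :=
  le_of_tendsto (tendsto_qPoch x hq).norm (Eventually.of_forall (norm_qPoch_le_of_le hx hq))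

theorem exists_norm_inv_qPoch_le {x q : ℂ} (hq : ‖q‖ < 1) (h : ∀ k : ℕ, 1 - x * q ^ k ≠ 0) :
    ∃ C : ℝ, 0 < C ∧ ∀ n, ‖(qPoch x q n)⁻¹‖ ≤ C := by
  have h1 := (tendsto_qPoch x hq).inv₀ (qPochInf_ne_zero hq h)
  obtain ⟨C, hC⟩ := (Metric.isBounded_range_of_tendsto _ h1).exists_norm_le
  exact ⟨max C 1, by positivity, fun n => (hC _ ⟨n, rfl⟩).trans (le_max_left _ _)⟩

theorem qPoch_mul_eq_prod (x q : ℂ) (m n : ℕ) :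
    qPoch x q (m * n) = ∏ i ∈ range m, qPoch (x * q ^ i) (q ^ m) n := by
  induction n with
  | zero => simp
  | succ n ih =>
    rw [Nat.mul_succ, qPoch_add, ih]
    simp only [qPoch_succ, prod_mul_distrib]
    congr 1
    exact prod_congr rfl fun i _ => by ring

/-- Splitting an infinite product according to the residue of the index modulo `m`. -/
theorem qPochInf_eq_prod (x : ℂ) {q : ℂ} (hq : ‖q‖ < 1) {m : ℕ} (hm : 0 < m) :
    qPochInf x q = ∏ i ∈ range m, qPochInf (x * q ^ i) (q ^ m) := by
  have hqm : ‖q ^ m‖ < 1 := by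
    rw [norm_pow]; exact pow_lt_one₀ (norm_nonneg _) hq hm.ne'
  have h1 := tendsto_finsetProd (range m) fun i _ => tendsto_qPoch (x * q ^ i) hqm
  have h2 := (tendsto_qPoch x hq).comp (tendsto_id.const_mul_atTop' hm)
  exact tendsto_nhds_unique h2 (h1.congr fun n => (qPoch_mul_eq_prod x q m n).symm)

theorem qPoch_mul_neg (x q : ℂ) (n : ℕ) :
    qPoch x q n * qPoch (-x) q n = qPoch (x ^ 2) (q ^ 2) n := by
  rw [qPoch, qPoch, qPoch, ← prod_mul_distrib]
  exact prod_congr rfl fun k _ => by ring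

theorem qPochInf_mul_neg (x : ℂ) {q : ℂ} (hq : ‖q‖ < 1) :
    qPochInf x q * qPochInf (-x) q = qPochInf (x ^ 2) (q ^ 2) := by
  have hq2 : ‖q ^ 2‖ < 1 := by
    rw [norm_pow]; exact pow_lt_one₀ (norm_nonneg _) hq two_ne_zero
  exact tendsto_nhds_unique ((tendsto_qPoch x hq).mul (tendsto_qPoch (-x) hq))
    ((tendsto_qPoch (x ^ 2) hq2).congr fun n => (qPoch_mul_neg x q n).symm)

/-! ### Rearranging and passing to the limit in convolutions -/

theorem mem_antidiagonal_nat {n : ℕ} {p : ℕ × ℕ} : p ∈ antidiagonal n ↔ p.1 + p.2 = n :=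
  HasAntidiagonal.mem_antidiagonal

theorem sum_antidiagonal_assoc {M : Type*} [AddCommMonoid M] (n : ℕ) (f : ℕ → ℕ → ℕ → M) :
    ∑ p ∈ antidiagonal n, ∑ x ∈ antidiagonal p.1, f x.1 x.2 p.2 =
      ∑ p ∈ antidiagonal n, ∑ x ∈ antidiagonal p.2, f p.1 x.1 x.2 := by
  rw [sum_sigma', sum_sigma']
  refine sum_bij' (fun a _ => ⟨(a.2.1, a.2.2 + a.1.2), (a.2.2, a.1.2)⟩)
    (fun a _ => ⟨(a.1.1 + a.2.1, a.2.2), (a.1.1, a.2.1)⟩) ?_ ?_ ?_ ?_ ?_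
  · rintro ⟨⟨a, b⟩, c, d⟩ h
    simp only [mem_sigma, mem_antidiagonal_nat] at h ⊢
    obtain ⟨rfl, rfl⟩ := h
    exact ⟨by ring, trivial⟩
  · rintro ⟨⟨a, b⟩, c, d⟩ h
    simp only [mem_sigma, mem_antidiagonal_nat] at h ⊢
    obtain ⟨rfl, rfl⟩ := h
    exact ⟨by ring, trivial⟩
  · rintro ⟨⟨a, b⟩, c, d⟩ h
    simp only [mem_sigma, mem_antidiagonal_nat] at h
    simp [h.2]
  · rintro ⟨⟨a, b⟩, c, d⟩ h
    simp only [mem_sigma, mem_antidiagonal_nat] at h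
    simp [h.2]
  · rintro ⟨⟨a, b⟩, c, d⟩ h
    rfl

/-- A convolution of a summable sequence with boundedly convergent ones passes to the limit. -/
theorem tendsto_sum_antidiagonal {f : ℕ → ℂ} (hf : Summable fun n => ‖f n‖) {g : ℕ → ℕ → ℂ}
    {G : ℕ → ℂ} {C : ℝ} (hC : ∀ r m, ‖g r m‖ ≤ C) (hg : ∀ r, Tendsto (g r) atTop (𝓝 (G r))) :
    Tendsto (fun N => ∑ p ∈ antidiagonal N, f p.1 * g p.1 p.2) atTop
      (𝓝 (∑' r, f r * G r)) := by
  have hC0 : 0 ≤ C := (norm_nonneg _).trans (hC 0 0)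
  have key := tendsto_tsum_of_dominated_convergence (𝓕 := atTop)
    (f := fun N r => if r < N + 1 then f r * g r (N - r) else 0) (g := fun r => f r * G r)
    (bound := fun r => ‖f r‖ * C) (hf.mul_right C) ?_ ?_
  · refine key.congr fun N => ?_
    rw [tsum_eq_sum (s := range (N + 1)) fun r hr => if_neg (by simpa using hr),
      Finset.Nat.sum_antidiagonal_eq_sum_range_succ (fun i j => f i * g i j)]
    exact sum_congr rfl fun r hr => if_pos (by simpa using hr)
  · intro r
    have : Tendsto (fun N => f r * g r (N - r)) atTop (𝓝 (f r * G r)) :=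
      ((hg r).comp (tendsto_sub_atTop_nat r)).const_mul _
    refine this.congr' ?_
    filter_upwards [eventually_ge_atTop r] with N hN
    rw [if_pos (by omega)]
  · refine Eventually.of_forall fun N r => ?_
    split_ifs
    · rw [norm_mul]; gcongr; exact hC _ _
    · simpa using mul_nonneg (norm_nonneg _) hC0

/-! ### The Bailey lemma -/

theorem choose_two_succ (n : ℕ) : (n + 1).choose 2 = n.choose 2 + n := by
  rw [Nat.choose_succ_succ' n 1, Nat.choose_one_right, add_comm]

/-- The `q`-Vandermonde sum. Both parameters enter polynomially, so that no genericity is needed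
and limiting cases such as `C = 0` are included. -/
theorem sum_qVandermonde {q : ℂ} (hq : ∀ k : ℕ, 1 - q * q ^ k ≠ 0) (M : ℕ) (z C : ℂ) :
    ∑ p ∈ antidiagonal M, (-1) ^ p.1 * q ^ p.1.choose 2 * (∏ i ∈ range p.1, (z - C * q ^ i)) *
      qPoch (C * q ^ p.1) q p.2 / (qPoch q q p.1 * qPoch q q p.2) =
      qPoch z q M / qPoch q q M := by
  induction M generalizing z C with
  | zero => simp
  | succ M ih =>
    have hne := qPoch_ne_zero hq
    have h1 : (1 - q * q ^ M) ≠ 0 := hq M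
    have key : (1 - q * q ^ M) * ∑ p ∈ antidiagonal (M + 1), (-1) ^ p.1 * q ^ p.1.choose 2 *
        (∏ i ∈ range p.1, (z - C * q ^ i)) *
        qPoch (C * q ^ p.1) q p.2 / (qPoch q q p.1 * qPoch q q p.2) =
        (1 - z) * (qPoch (z * q) q M / qPoch q q M) := by
      rw [← ih (z * q) (C * q), mul_sum]
      -- `1 - q^(k+l) = q^k (1 - q^l) + (1 - q^k)` lowers one of the two indices by one
      have h2 : ∀ p ∈ antidiagonal (M + 1), (1 - q * q ^ M) * ((-1) ^ p.1 * q ^ p.1.choose 2 *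
          (∏ i ∈ range p.1, (z - C * q ^ i)) *
          qPoch (C * q ^ p.1) q p.2 / (qPoch q q p.1 * qPoch q q p.2)) =
          q ^ p.1 * (1 - q ^ p.2) * ((-1) ^ p.1 * q ^ p.1.choose 2 *
          (∏ i ∈ range p.1, (z - C * q ^ i)) *
          qPoch (C * q ^ p.1) q p.2 / (qPoch q q p.1 * qPoch q q p.2)) +
          (1 - q ^ p.1) * ((-1) ^ p.1 * q ^ p.1.choose 2 *
          (∏ i ∈ range p.1, (z - C * q ^ i)) *
          qPoch (C * q ^ p.1) q p.2 / (qPoch q q p.1 * qPoch q q p.2)) := by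
        rintro ⟨k, l⟩ hp
        rw [mem_antidiagonal_nat] at hp
        dsimp only at hp ⊢
        have : q * q ^ M = q ^ k * q ^ l := by rw [← pow_succ', ← hp, pow_add]
        rw [this]
        ring
      rw [sum_congr rfl h2, sum_add_distrib, Finset.Nat.sum_antidiagonal_succ',
        Finset.Nat.sum_antidiagonal_succ]
      simp only [pow_zero, sub_self, mul_zero, zero_mul, zero_add]
      rw [← sum_add_distrib, mul_sum]
      refine sum_congr rfl ?_
      rintro ⟨k, l⟩ -
      dsimp only
      have hp1 : ∏ i ∈ range k, (z * q - C * q * q ^ i) =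
          q ^ k * ∏ i ∈ range k, (z - C * q ^ i) := by
        simp only [show ∀ i, z * q - C * q * q ^ i = q * (z - C * q ^ i) from fun i => by ring,
          prod_mul_distrib, prod_const, card_range]
      have hk := hne k
      have hl := hne l
      have hk' : 1 - q * q ^ k ≠ 0 := hq k
      have hl' : 1 - q * q ^ l ≠ 0 := hq l
      rw [hp1, prod_range_succ, choose_two_succ, qPoch_succ q q k, qPoch_succ q q l,
        qPoch_succ' (C * q ^ k),
        show C * q ^ (k + 1) = C * q ^ k * q by ring, show C * q * q ^ k = C * q ^ k * q by ring,
        pow_succ' q k, pow_succ' q l, pow_add q]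
      generalize q ^ k = x at *
      generalize q ^ l = y at *
      rw [mul_comm q] at hk' hl'
      rw [mul_comm q x, mul_comm q y]
      field_simp
      ring
    rw [qPoch_succ' z, qPoch_succ q q M]
    have hM := hne M
    field_simp at key ⊢
    linear_combination key

/-- `(α, β)` is a Bailey pair relative to `a = q`, in the normalisation `A_n = (1 - q) α_n`. -/
def IsBaileyPair (q : ℂ) (A β : ℕ → ℂ) : Prop :=
  ∀ n, β n = ∑ p ∈ antidiagonal n, A p.1 / (qPoch q q p.2 * qPoch q q (n + p.1 + 1))

/-- The weight `(-1)^n q^{n(n-1)/2} ∏_{i < n} (z - q^{i+2})`. For `z = q^2 / ρ` it is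
`(-1)^n q^{n(n-1)/2} (ρ; q)_n z^n`; the value `z = 0` corresponds to `ρ = ∞`. -/
def baileyWeight (q z : ℂ) (n : ℕ) : ℂ :=
  (-1) ^ n * q ^ n.choose 2 * ∏ i ∈ range n, (z - q ^ (i + 2))

theorem baileyWeight_add (q z : ℂ) (r k : ℕ) :
    baileyWeight q z (r + k) = baileyWeight q z r *
      ((-1) ^ k * q ^ k.choose 2 * ∏ i ∈ range k, (z * q ^ r - q ^ (2 * r + 2) * q ^ i)) := by
  have h1 : ∏ i ∈ range k, (z * q ^ r - q ^ (2 * r + 2) * q ^ i) =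
      q ^ (r * k) * ∏ i ∈ range k, (z - q ^ (r + i + 2)) := by
    simp only [show ∀ i, z * q ^ r - q ^ (2 * r + 2) * q ^ i = q ^ r * (z - q ^ (r + i + 2)) from
      fun i => by ring, prod_mul_distrib, prod_const, card_range, pow_mul]
  have h2 : (r + k).choose 2 = r.choose 2 + k.choose 2 + r * k := by
    clear h1
    induction k with
    | zero => simp
    | succ k ih =>
      rw [← add_assoc, choose_two_succ, ih, choose_two_succ]
      ring
  rw [h1, baileyWeight, baileyWeight, h2, prod_range_add, pow_add, pow_add, pow_add]
  ring

/-- The finite form of the Bailey lemma with one free parameter. After `β` is expanded, the sums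
are regrouped so that for each `r` the coefficient of `A_r` is a `q`-Vandermonde sum. -/
theorem IsBaileyPair.sum_antidiagonal {q : ℂ} (hq : ∀ k : ℕ, 1 - q * q ^ k ≠ 0) {A β : ℕ → ℂ}
    (h : IsBaileyPair q A β) (z : ℂ) (N : ℕ) :
    ∑ p ∈ antidiagonal N, baileyWeight q z p.1 * β p.1 / qPoch q q p.2 =
      ∑ p ∈ antidiagonal N, A p.1 * baileyWeight q z p.1 * qPoch (z * q ^ p.1) q p.2 /
        (qPoch q q p.2 * qPoch q q (N + p.1 + 1)) := by
  have hne := qPoch_ne_zero hq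
  have h1 : ∀ p ∈ antidiagonal N, baileyWeight q z p.1 * β p.1 / qPoch q q p.2 =
      ∑ x ∈ antidiagonal p.1, (fun r k l => baileyWeight q z (r + k) * A r /
        (qPoch q q k * qPoch q q (2 * r + k + 1) * qPoch q q l)) x.1 x.2 p.2 := by
    intro p _
    rw [h p.1, mul_sum, sum_div]
    refine sum_congr rfl fun x hx => ?_
    rw [mem_antidiagonal_nat] at hx
    dsimp only
    rw [← hx, show x.1 + x.2 + x.1 + 1 = 2 * x.1 + x.2 + 1 by ring]
    have := hne x.2; have := hne p.2; have := hne (2 * x.1 + x.2 + 1)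
    field_simp
  rw [sum_congr rfl h1, sum_antidiagonal_assoc N fun r k l => baileyWeight q z (r + k) * A r /
    (qPoch q q k * qPoch q q (2 * r + k + 1) * qPoch q q l)]
  refine sum_congr rfl ?_
  rintro ⟨r, M⟩ hp
  rw [mem_antidiagonal_nat] at hp
  dsimp only at hp ⊢
  have hC : qPoch q q (2 * r + 1 + M) = qPoch q q (2 * r + 1) * qPoch (q ^ (2 * r + 2)) q M := by
    rw [qPoch_add, show q * q ^ (2 * r + 1) = q ^ (2 * r + 2) by ring]
  have hC0 : qPoch (q ^ (2 * r + 2)) q M ≠ 0 := fun h0 =>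
    hne (2 * r + 1 + M) (by rw [hC, h0, mul_zero])
  have hr := hne (2 * r + 1)
  have h2 : ∀ x ∈ antidiagonal M, baileyWeight q z (r + x.1) * A r /
        (qPoch q q x.1 * qPoch q q (2 * r + x.1 + 1) * qPoch q q x.2) =
      A r * baileyWeight q z r / (qPoch q q (2 * r + 1) * qPoch (q ^ (2 * r + 2)) q M) *
      ((-1) ^ x.1 * q ^ x.1.choose 2 *
        (∏ i ∈ range x.1, (z * q ^ r - q ^ (2 * r + 2) * q ^ i)) *
        qPoch (q ^ (2 * r + 2) * q ^ x.1) q x.2 / (qPoch q q x.1 * qPoch q q x.2)) := by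
    rintro ⟨k, l⟩ hx
    rw [mem_antidiagonal_nat] at hx
    dsimp only at hx ⊢
    have e1 : qPoch (q ^ (2 * r + 2)) q M = qPoch (q ^ (2 * r + 2)) q k *
        qPoch (q ^ (2 * r + 2) * q ^ k) q l := by rw [← hx, qPoch_add]
    have e2 : qPoch q q (2 * r + k + 1) = qPoch q q (2 * r + 1) * qPoch (q ^ (2 * r + 2)) q k := by
      rw [show 2 * r + k + 1 = 2 * r + 1 + k by ring, qPoch_add,
        show q * q ^ (2 * r + 1) = q ^ (2 * r + 2) by ring]
    rw [e1] at hC0 ⊢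
    have hk := left_ne_zero_of_mul hC0
    have hl := right_ne_zero_of_mul hC0
    have := hne k; have := hne l
    rw [e2, baileyWeight_add]
    field_simp
  rw [sum_congr rfl h2, ← mul_sum, sum_qVandermonde hq, show N + r + 1 = 2 * r + 1 + M by omega, hC]
  have := hne M
  field_simp

theorem norm_baileyWeight_le {q : ℂ} (hq : ‖q‖ < 1) (z : ℂ) (n : ℕ) :
    ‖baileyWeight q z n‖ ≤ (‖z‖ + 1) ^ n * ‖q‖ ^ n.choose 2 := by
  rw [baileyWeight, norm_mul, norm_mul, norm_pow, norm_neg, norm_one, one_pow, one_mul, norm_pow,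
    mul_comm, norm_prod]
  gcongr
  refine (prod_le_prod (fun _ _ => norm_nonneg _) (g := fun _ => ‖z‖ + 1) fun i _ => ?_).trans_eq
    (by simp)
  calc ‖z - q ^ (i + 2)‖ ≤ ‖z‖ + ‖q ^ (i + 2)‖ := norm_sub_le _ _
    _ ≤ ‖z‖ + 1 := by
      gcongr
      rw [norm_pow]
      exact pow_le_one₀ (norm_nonneg _) hq.le

theorem summable_pow_mul_pow_choose_two {ρ : ℝ} (h0 : 0 ≤ ρ) (h1 : ρ < 1) {K : ℝ} (hK : 0 ≤ K) :
    Summable fun n : ℕ => K ^ n * ρ ^ n.choose 2 := by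
  have ht : Tendsto (fun n : ℕ => K * ρ ^ n) atTop (𝓝 0) := by
    simpa using (tendsto_pow_atTop_nhds_zero_of_lt_one h0 h1).const_mul K
  refine summable_of_ratio_norm_eventually_le (r := 1 / 2) (by norm_num) ?_
  filter_upwards [ht.eventually (gt_mem_nhds (show (0 : ℝ) < 1 / 2 by norm_num))] with n hn
  rw [choose_two_succ, Real.norm_of_nonneg (by positivity), Real.norm_of_nonneg (by positivity)]
  calc K ^ (n + 1) * ρ ^ (n.choose 2 + n) = (K * ρ ^ n) * (K ^ n * ρ ^ n.choose 2) := by ring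
    _ ≤ _ := by gcongr

theorem summable_norm_baileyWeight_mul {q : ℂ} (hq : ‖q‖ < 1) (z : ℂ) {B : ℕ → ℂ} {C K : ℝ}
    (hK : 0 ≤ K) (hB : ∀ n, ‖B n‖ ≤ C * K ^ n) :
    Summable fun n => ‖baileyWeight q z n * B n‖ := by
  have hs := (summable_pow_mul_pow_choose_two (norm_nonneg q) hq
    (show 0 ≤ (‖z‖ + 1) * K by positivity)).mul_left C
  refine hs.of_nonneg_of_le (fun _ => norm_nonneg _) fun n => ?_
  rw [norm_mul]
  calc ‖baileyWeight q z n‖ * ‖B n‖ ≤ ((‖z‖ + 1) ^ n * ‖q‖ ^ n.choose 2) * (C * K ^ n) := by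
        gcongr
        · exact norm_baileyWeight_le hq z n
        · exact hB n
    _ = _ := by rw [mul_pow]; ring

/-- The Bailey lemma with one free parameter. Geometric growth of `A` and `β` is enough, as the
weight decays like `q^{n(n-1)/2}`. -/
theorem IsBaileyPair.tsum_eq {q : ℂ} (hq : ‖q‖ < 1) {A β : ℕ → ℂ}
    (h : IsBaileyPair q A β) (z : ℂ) {C K C' K' : ℝ} (hK : 0 ≤ K) (hA : ∀ n, ‖A n‖ ≤ C * K ^ n)
    (hK' : 0 ≤ K') (hβ : ∀ n, ‖β n‖ ≤ C' * K' ^ n) :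
    ∑' n, baileyWeight q z n * β n =
      (∑' n, baileyWeight q z n * A n * qPochInf (z * q ^ n) q) / qPochInf q q := by
  have hq1 := one_sub_mul_pow_ne_zero hq hq
  have hne := qPoch_ne_zero hq1
  have hinf := qPochInf_ne_zero hq hq1
  obtain ⟨D, hD, hDle⟩ := exists_norm_inv_qPoch_le hq hq1
  have hlim := (tendsto_qPoch q hq).inv₀ hinf
  have L := tendsto_sum_antidiagonal (summable_norm_baileyWeight_mul hq z hK' hβ)
    (g := fun _ m => (qPoch q q m)⁻¹) (fun _ m => hDle m) (fun _ => hlim)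
  have R := tendsto_sum_antidiagonal (summable_norm_baileyWeight_mul hq z hK hA)
    (g := fun r m => qPoch (z * q ^ r) q m * (qPoch q q m)⁻¹ * (qPoch q q (m + (2 * r + 1)))⁻¹)
    (G := fun r => qPochInf (z * q ^ r) q * (qPochInf q q)⁻¹ * (qPochInf q q)⁻¹)
    (C := Real.exp (‖z‖ / (1 - ‖q‖)) * D * D) ?_ ?_
  · have e := tendsto_nhds_unique L (R.congr fun N => ?_)
    · rw [tsum_mul_right] at e
      have e2 : ∀ r, baileyWeight q z r * A r *
          (qPochInf (z * q ^ r) q * (qPochInf q q)⁻¹ * (qPochInf q q)⁻¹) =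
          (baileyWeight q z r * A r * qPochInf (z * q ^ r) q) *
            ((qPochInf q q)⁻¹ * (qPochInf q q)⁻¹) := fun r => by ring
      simp only [e2] at e
      rw [tsum_mul_right] at e
      field_simp at e ⊢
      linear_combination e
    · have := h.sum_antidiagonal hq1 z N
      simp only [div_eq_mul_inv] at this
      rw [this]
      refine sum_congr rfl ?_
      rintro ⟨r, m⟩ hp
      rw [mem_antidiagonal_nat] at hp
      dsimp only at hp ⊢
      rw [show N + r + 1 = m + (2 * r + 1) by omega, mul_inv]
      ring
  · intro r m
    rw [norm_mul, norm_mul]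
    gcongr
    · refine norm_qPoch_le_of_le ?_ hq m
      rw [norm_mul, norm_pow]
      exact mul_le_of_le_one_right (norm_nonneg _) (pow_le_one₀ (norm_nonneg _) hq.le)
    · exact hDle m
    · exact hDle _
  · intro r
    exact ((tendsto_qPoch _ hq).mul hlim).mul (hlim.comp (tendsto_add_atTop_nat _))

/-! ### Inversion of Bailey pairs -/

/-- The partial sums of the orthogonality relation telescope. With `M = k + l` the full sum is the
case `l = 0`, in which the right side vanishes. -/
theorem sum_range_orthogonality {q : ℂ} (hq : ∀ k : ℕ, 1 - q * q ^ k ≠ 0) (j k l : ℕ) :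
    (1 - q ^ (k + l)) * ∑ i ∈ range (k + 1), (1 - q ^ (2 * (j + i) + 1)) *
      (qPoch q q (2 * j + i) * (-1) ^ i * q ^ i.choose 2 / (qPoch q q i * qPoch q q (k + l - i) *
        qPoch q q (2 * j + i + (k + l) + 1))) =
      (1 - q ^ (2 * j + k + 1)) * (q ^ k - q ^ (k + l)) *
        (qPoch q q (2 * j + k) * (-1) ^ k * q ^ k.choose 2 / (qPoch q q k * qPoch q q l *
          qPoch q q (2 * j + 2 * k + l + 1))) := by
  have hne := qPoch_ne_zero hq
  induction k generalizing l with
  | zero => simp; ring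
  | succ k ih =>
    have h := ih (l + 1)
    rw [show k + (l + 1) = k + 1 + l by ring] at h
    rw [sum_range_succ, mul_add, h, show k + 1 + l - (k + 1) = l by omega,
      show 2 * j + 2 * k + (l + 1) + 1 = 2 * j + 2 * k + l + 2 by ring,
      show 2 * j + (k + 1) + (k + 1 + l) + 1 = 2 * j + 2 * k + l + 2 + 1 by ring,
      show 2 * j + 2 * (k + 1) + l + 1 = 2 * j + 2 * k + l + 2 + 1 by ring,
      show 2 * j + (k + 1) = 2 * j + k + 1 by ring, qPoch_succ q q (2 * j + 2 * k + l + 2),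
      qPoch_succ q q k, qPoch_succ q q l, qPoch_succ q q (2 * j + k), choose_two_succ]
    have h1 := hne k
    have h2 := hne l
    have h3 := hne (2 * j + k)
    have h4 := hne (2 * j + 2 * k + l + 2)
    have g1 := hq k
    have g2 := hq l
    have g4 := hq (2 * j + 2 * k + l + 2)
    generalize qPoch q q k = P1 at *
    generalize qPoch q q l = P2 at *
    generalize qPoch q q (2 * j + k) = P3 at *
    generalize qPoch q q (2 * j + 2 * k + l + 2) = P4 at *
    clear ih h hne
    simp only [pow_add, mul_add, pow_mul', pow_one] at *
    generalize q ^ k = x at *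
    generalize q ^ l = y at *
    generalize q ^ j = z at *
    generalize q ^ k.choose 2 = w at *
    generalize ((-1 : ℂ)) ^ k = s at *
    generalize h5 : 1 - q * x = u1 at *
    generalize h6 : 1 - q * y = u2 at *
    generalize h7 : 1 - q * (z ^ 2 * x ^ 2 * y * q ^ 2) = u3 at *
    field_simp
    subst h5 h6 h7
    ring

theorem sum_antidiagonal_orthogonality {q : ℂ} (hq : ∀ k : ℕ, 1 - q * q ^ k ≠ 0) (j M : ℕ) :
    ∑ p ∈ antidiagonal M, (1 - q ^ (2 * (j + p.1) + 1)) *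
      (qPoch q q (2 * j + p.1) * (-1) ^ p.1 * q ^ p.1.choose 2 / (qPoch q q p.1 * qPoch q q p.2 *
        qPoch q q (2 * j + p.1 + M + 1))) = if M = 0 then 1 else 0 := by
  have hne := qPoch_ne_zero hq
  split_ifs with hM
  · subst hM
    have h1 := hne (2 * j)
    have h2 := hq (2 * j)
    rw [← pow_succ'] at h2
    simp [qPoch_succ q q (2 * j), ← pow_succ']
    field_simp
  · have h := sum_range_orthogonality hq j M 0
    obtain ⟨m, rfl⟩ := Nat.exists_eq_succ_of_ne_zero hM
    have h2 := hq m
    rw [← pow_succ'] at h2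
    simp only [add_zero, sub_self, mul_zero, zero_mul] at h
    rw [Finset.Nat.sum_antidiagonal_eq_sum_range_succ (fun a b =>
      (1 - q ^ (2 * (j + a) + 1)) *
      (qPoch q q (2 * j + a) * (-1) ^ a * q ^ a.choose 2 / (qPoch q q a * qPoch q q b *
        qPoch q q (2 * j + a + m.succ + 1))))]
    exact (mul_eq_zero.1 h).resolve_left h2

/-- The sum that inverts the defining relation of a Bailey pair. -/
noncomputable def baileyInv (q : ℂ) (β : ℕ → ℂ) (n : ℕ) : ℂ :=
  ∑ p ∈ antidiagonal n,
    qPoch q q (2 * p.1 + p.2) * (-1) ^ p.2 * q ^ p.2.choose 2 / qPoch q q p.2 * β p.1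

/-- Any `β` is part of a Bailey pair: after exchange of the sums the orthogonality relation
applies. -/
theorem isBaileyPair_baileyInv {q : ℂ} (hq : ∀ k : ℕ, 1 - q * q ^ k ≠ 0) (β : ℕ → ℂ) :
    IsBaileyPair q (fun n => (1 - q ^ (2 * n + 1)) * baileyInv q β n) β := by
  intro n
  have h1 : ∀ p ∈ antidiagonal n, (1 - q ^ (2 * p.1 + 1)) * baileyInv q β p.1 /
      (qPoch q q p.2 * qPoch q q (n + p.1 + 1)) =
      ∑ x ∈ antidiagonal p.1, (fun j k m => (1 - q ^ (2 * (j + k) + 1)) *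
        (qPoch q q (2 * j + k) * (-1) ^ k * q ^ k.choose 2 / qPoch q q k * β j) /
        (qPoch q q m * qPoch q q (n + (j + k) + 1))) x.1 x.2 p.2 := by
    intro p _
    rw [baileyInv, mul_sum, sum_div]
    refine sum_congr rfl fun x hx => ?_
    rw [mem_antidiagonal_nat] at hx
    dsimp only
    rw [hx]
  rw [sum_congr rfl h1, sum_antidiagonal_assoc n fun j k m => (1 - q ^ (2 * (j + k) + 1)) *
        (qPoch q q (2 * j + k) * (-1) ^ k * q ^ k.choose 2 / qPoch q q k * β j) /
        (qPoch q q m * qPoch q q (n + (j + k) + 1))]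
  have h2 : ∀ p ∈ antidiagonal n, ∑ x ∈ antidiagonal p.2, (1 - q ^ (2 * (p.1 + x.1) + 1)) *
        (qPoch q q (2 * p.1 + x.1) * (-1) ^ x.1 * q ^ x.1.choose 2 / qPoch q q x.1 * β p.1) /
        (qPoch q q x.2 * qPoch q q (n + (p.1 + x.1) + 1)) =
        β p.1 * if p.2 = 0 then 1 else 0 := by
    intro p hp
    rw [mem_antidiagonal_nat] at hp
    rw [← sum_antidiagonal_orthogonality hq p.1 p.2, mul_sum]
    refine sum_congr rfl fun x _ => ?_
    rw [show n + (p.1 + x.1) + 1 = 2 * p.1 + x.1 + p.2 + 1 by omega]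
    simp only [div_eq_mul_inv, mul_inv]
    ring
  rw [sum_congr rfl h2]
  cases n with
  | zero => simp
  | succ n => rw [Finset.Nat.sum_antidiagonal_succ']; simp

/-- The summand of `baileyInv` for `β_j = 1 / ((bq; q)_j (cq; q)_j)`. -/
noncomputable def invTerm (q b c : ℂ) (j k : ℕ) : ℂ :=
  qPoch q q (2 * j + k) * (-1) ^ k * q ^ k.choose 2 / qPoch q q k *
    (qPoch (b * q) q j * qPoch (c * q) q j)⁻¹

/-- The creative telescoping behind `baileyInv_recurrence`, with the certificate as the first term
on the right; the second term, which depends on `j + k` alone, is the boundary value. -/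
theorem sum_range_invTerm {q b c : ℂ} (hq : ∀ k : ℕ, 1 - q * q ^ k ≠ 0)
    (hb : ∀ k : ℕ, 1 - b * q * q ^ k ≠ 0) (hc : ∀ k : ℕ, 1 - c * q * q ^ k ≠ 0) (j k : ℕ) :
    ∑ i ∈ range (j + 1), ((1 - b * q ^ (j + k + 1)) * (1 - c * q ^ (j + k + 1)) *
        invTerm q b c i (j + k + 1 - i) - q ^ (j + k) * q ^ (j + k + 1) *
        (b - q ^ (j + k + 1)) * (c - q ^ (j + k + 1)) * invTerm q b c i (j + k - i)) =
      (1 - (q ^ (j + k + 1)) ^ 2) * (1 - q ^ (k + 1)) * invTerm q b c j (k + 1) +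
        (-1) ^ (j + k + 1) * (1 + q ^ (j + k + 1)) * q ^ (j + k + 2).choose 2 *
          (1 - b) * (1 - c) := by
  have hne := qPoch_ne_zero hq
  have hbne := qPoch_ne_zero hb
  have hcne := qPoch_ne_zero hc
  induction j generalizing k with
  | zero =>
    have h1 := hne k
    have g1 := hq k
    have h2 := hne (k + 1)
    simp [invTerm, choose_two_succ]
    field_simp
    ring
  | succ j ih =>
    have h := ih (k + 1)
    rw [show j + (k + 1) = j + 1 + k by ring] at h
    rw [sum_range_succ, h, show j + 1 + k + 1 - (j + 1) = k + 1 by omega,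
      show j + 1 + k - (j + 1) = k by omega]
    have key : (1 - (q ^ (j + 1 + k + 1)) ^ 2) * (1 - q ^ (k + 1 + 1)) *
          invTerm q b c j (k + 1 + 1) +
        ((1 - b * q ^ (j + 1 + k + 1)) * (1 - c * q ^ (j + 1 + k + 1)) *
          invTerm q b c (j + 1) (k + 1) -
        q ^ (j + 1 + k) * q ^ (j + 1 + k + 1) * (b - q ^ (j + 1 + k + 1)) *
          (c - q ^ (j + 1 + k + 1)) * invTerm q b c (j + 1) k) =
        (1 - (q ^ (j + 1 + k + 1)) ^ 2) * (1 - q ^ (k + 1)) * invTerm q b c (j + 1) (k + 1) := by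
      simp only [invTerm]
      rw [show 2 * j + (k + 1 + 1) = 2 * j + k + 2 by ring,
        show 2 * (j + 1) + (k + 1) = 2 * j + k + 2 + 1 by ring,
        show 2 * (j + 1) + k = 2 * j + k + 2 by ring, qPoch_succ q q (2 * j + k + 2),
        qPoch_succ q q (k + 1), qPoch_succ q q k, qPoch_succ (b * q), qPoch_succ (c * q),
        choose_two_succ (k + 1), choose_two_succ k]
      clear ih h
      have h1 := hne k
      have h2 := hne (2 * j + k + 2)
      have h3 := hbne j
      have h4 := hcne j
      have g1 := hq k
      have g2 := hq (k + 1)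
      have g3 := hb j
      have g4 := hc j
      generalize qPoch q q k = P1 at *
      generalize qPoch q q (2 * j + k + 2) = P2 at *
      generalize qPoch (b * q) q j = P3 at *
      generalize qPoch (c * q) q j = P4 at *
      simp only [pow_add, pow_mul', pow_one] at *
      generalize q ^ k = x at *
      generalize q ^ j = y at *
      generalize q ^ k.choose 2 = w at *
      generalize ((-1 : ℂ)) ^ k = s at *
      generalize h5 : 1 - q * x = u1 at *
      generalize h6 : 1 - q * (x * q) = u2 at *
      generalize h7 : 1 - b * q * y = u3 at *
      generalize h8 : 1 - c * q * y = u4 at *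
      field_simp
      subst h5 h6 h7 h8
      ring
    linear_combination key

/-- The recurrence for the inverse of `β_j = 1 / ((bq; q)_j (cq; q)_j)`, found by creative
telescoping. -/
theorem baileyInv_recurrence {q b c : ℂ} (hq : ∀ k : ℕ, 1 - q * q ^ k ≠ 0)
    (hb : ∀ k : ℕ, 1 - b * q * q ^ k ≠ 0) (hc : ∀ k : ℕ, 1 - c * q * q ^ k ≠ 0) {β : ℕ → ℂ}
    (hβ : ∀ j, β j = (qPoch (b * q) q j * qPoch (c * q) q j)⁻¹) (n : ℕ) :
    (1 - b * q ^ (n + 1)) * (1 - c * q ^ (n + 1)) * baileyInv q β (n + 1) =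
      q ^ n * q ^ (n + 1) * (b - q ^ (n + 1)) * (c - q ^ (n + 1)) * baileyInv q β n +
        (-1) ^ (n + 1) * (1 + q ^ (n + 1)) * q ^ (n + 2).choose 2 * (1 - b) * (1 - c) := by
  have hne := qPoch_ne_zero hq
  have hbne := qPoch_ne_zero hb
  have hcne := qPoch_ne_zero hc
  have hL : ∀ m, baileyInv q β m = ∑ i ∈ range (m + 1), invTerm q b c i (m - i) := fun m => by
    rw [baileyInv, ← Finset.Nat.sum_antidiagonal_eq_sum_range_succ (invTerm q b c)]
    exact sum_congr rfl fun p _ => by rw [invTerm, hβ]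
  have h := sum_range_invTerm hq hb hc n 0
  simp only [add_zero, zero_add, pow_one] at h
  rw [sum_sub_distrib, ← mul_sum, ← mul_sum, ← hL n] at h
  rw [hL (n + 1), sum_range_succ]
  have key : (1 - b * q ^ (n + 1)) * (1 - c * q ^ (n + 1)) * invTerm q b c (n + 1) 0 =
      -((1 - (q ^ (n + 1)) ^ 2) * (1 - q) * invTerm q b c n 1) := by
    clear h
    have h1 := hne (2 * n + 1)
    have h3 := hbne n
    have h4 := hcne n
    have g1 := hq 0
    have g3 := hb n
    have g4 := hc n
    simp only [invTerm, show 2 * (n + 1) + 0 = 2 * n + 1 + 1 by ring, qPoch_succ q q (2 * n + 1),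
      qPoch_succ (b * q), qPoch_succ (c * q), qPoch_succ q q 0, qPoch_zero, pow_zero,
      pow_one, Nat.choose_zero_succ, Nat.choose_succ_self, mul_one, one_mul, div_one] at *
    rw [mul_assoc, ← pow_succ'] at g3 g4
    rw [mul_assoc b, mul_assoc c, ← pow_succ', ← pow_succ', pow_succ' q (2 * n + 1)]
    generalize h5 : 1 - b * q ^ (n + 1) = u3 at *
    generalize h6 : 1 - c * q ^ (n + 1) = u4 at *
    field_simp
    ring
  rw [Nat.sub_self]
  linear_combination h + key

/-- When `bc = q` the inverse of `1 / ((bq; q)_j (cq; q)_j)` has a single term. -/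
theorem baileyInv_of_mul_eq {q b c : ℂ} (hq : ∀ k : ℕ, 1 - q * q ^ k ≠ 0)
    (hb : ∀ k : ℕ, 1 - b * q * q ^ k ≠ 0) (hc : ∀ k : ℕ, 1 - c * q * q ^ k ≠ 0) {β : ℕ → ℂ}
    (hβ : ∀ j, β j = (qPoch (b * q) q j * qPoch (c * q) q j)⁻¹) (hbc : b * c = q) (n : ℕ) :
    (1 - b * q ^ n) * (1 - c * q ^ n) * baileyInv q β n =
      (-1) ^ n * q ^ (n + 1).choose 2 * (1 - b) * (1 - c) := by
  induction n with
  | zero => simp [baileyInv, hβ]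
  | succ n ih =>
    rw [baileyInv_recurrence hq hb hc hβ, choose_two_succ (n + 1)]
    have e : (b - q ^ (n + 1)) * (c - q ^ (n + 1)) =
        q * ((1 - b * q ^ n) * (1 - c * q ^ n)) := by
      have : q ^ (n + 1) = q * q ^ n := pow_succ' _ _
      rw [this]
      linear_combination (1 - q * (q ^ n) ^ 2) * hbc
    have e2 : q ^ n * q ^ (n + 1) * (b - q ^ (n + 1)) * (c - q ^ (n + 1)) * baileyInv q β n =
        q ^ n * q ^ (n + 1) * q * ((1 - b * q ^ n) * (1 - c * q ^ n) * baileyInv q β n) := by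
      linear_combination (q ^ n * q ^ (n + 1) * baileyInv q β n) * e
    rw [e2, ih]
    ring

/-! ### Hecke-type series from Bailey pairs -/

/-- The symmetric window grows by its two new end points. -/
theorem sum_Icc_neg_succ {M : Type*} [AddCommMonoid M] (n : ℕ) (u : ℤ → M) :
    ∑ j ∈ Icc (-((n + 1 : ℕ) : ℤ)) ((n + 1 : ℕ) : ℤ), u j =
      ∑ j ∈ Icc (-(n : ℤ)) n, u j + (u (n + 1 : ℕ) + u (-((n + 1 : ℕ) : ℤ))) := by
  have h : Icc (-((n + 1 : ℕ) : ℤ)) ((n + 1 : ℕ) : ℤ) =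
      insert ((n + 1 : ℕ) : ℤ) (insert (-((n + 1 : ℕ) : ℤ)) (Icc (-(n : ℤ)) n)) := by
    ext j
    simp only [mem_Icc, mem_insert]
    omega
  rw [h, sum_insert, sum_insert]
  · rw [← add_assoc, add_comm]
  · simp only [mem_Icc]; omega
  · simp only [mem_Icc, mem_insert]; omega

theorem norm_sum_Icc_le {n : ℕ} {u : ℤ → ℂ} {B : ℝ} (hB : 0 ≤ B)
    (h : ∀ j : ℤ, j ^ 2 ≤ (n : ℤ) ^ 2 → ‖u j‖ ≤ B) :
    ‖∑ j ∈ Icc (-(n : ℤ)) n, u j‖ ≤ 3 ^ n * B := by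
  have h1 : ‖∑ j ∈ Icc (-(n : ℤ)) n, u j‖ ≤ ∑ j ∈ Icc (-(n : ℤ)) n, B := by
    refine norm_sum_le_of_le _ fun j hj => h j ?_
    rw [mem_Icc] at hj
    exact sq_le_sq' hj.1 hj.2
  refine h1.trans ?_
  rw [sum_const, nsmul_eq_mul]
  gcongr
  -- there are `2 n + 1 ≤ 3 ^ n` summands, by Bernoulli's inequality
  rw [Int.card_Icc, show ((n : ℤ) + 1 - -(n : ℤ)).toNat = 1 + n * 2 by omega]
  have := one_add_mul_le_pow (show (-2 : ℝ) ≤ 2 by norm_num) n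
  norm_num at this ⊢
  linarith

theorem norm_sq_lt_one {q : ℂ} (hq : ‖q‖ < 1) : ‖q ^ 2‖ < 1 := by
  rw [norm_pow]; exact pow_lt_one₀ (norm_nonneg _) hq two_ne_zero

theorem norm_zpow_le {q : ℂ} (hq0 : q ≠ 0) (hq : ‖q‖ < 1) {e : ℤ} {m : ℕ} (h : (m : ℤ) ≤ e) :
    ‖q ^ e‖ ≤ ‖q‖ ^ m := by
  rw [norm_zpow, ← zpow_natCast]
  exact zpow_le_zpow_right_of_le_one₀ (norm_pos_iff.2 hq0) hq.le h

/-- The sum `∑_{j=-n}^{n} (-1)^j q^{-j^2}`. -/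
noncomputable def altSqSum (q : ℂ) (n : ℕ) : ℂ :=
  ∑ j ∈ Icc (-(n : ℤ)) n, (-1) ^ j * q ^ (-j ^ 2)

theorem altSqSum_succ (q : ℂ) (n : ℕ) :
    altSqSum q (n + 1) = altSqSum q n + 2 * (-1) ^ (n + 1) * (q ^ ((n + 1) ^ 2))⁻¹ := by
  have h : q ^ (-((n + 1 : ℕ) : ℤ) ^ 2) = (q ^ ((n + 1) ^ 2))⁻¹ := by
    rw [zpow_neg]
    norm_cast
  have h' : (-1 : ℂ) ^ (-((n + 1 : ℕ) : ℤ)) = (-1) ^ (n + 1) := by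
    rw [zpow_neg, zpow_natCast, ← inv_pow, inv_neg_one]
  rw [altSqSum, sum_Icc_neg_succ, altSqSum, neg_sq, h, h', zpow_natCast]
  ring

theorem norm_pow_mul_altSqSum_le {q : ℂ} (hq0 : q ≠ 0) (hq : ‖q‖ < 1) (n e : ℕ) :
    ‖q ^ (n ^ 2 + e) * altSqSum q n‖ ≤ 3 ^ n * ‖q‖ ^ e := by
  rw [altSqSum, mul_sum]
  refine norm_sum_Icc_le (by positivity) fun j hj => ?_
  have h : q ^ (n ^ 2 + e) * ((-1) ^ j * q ^ (-j ^ 2)) =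
      (-1) ^ j * q ^ (((n ^ 2 + e : ℕ) : ℤ) + -j ^ 2) := by
    rw [zpow_add₀ hq0, zpow_natCast]; ring
  rw [h, norm_mul, norm_zpow, norm_neg, norm_one, one_zpow, one_mul]
  refine norm_zpow_le hq0 hq ?_
  push_cast
  linarith

theorem summable_of_norm_le_pow_choose_two {q : ℂ} (hq : ‖q‖ < 1) {u : ℕ → ℂ} {C : ℝ}
    (h : ∀ n, ‖u n‖ ≤ C * (3 ^ n * ‖q‖ ^ n.choose 2)) : Summable u :=
  .of_norm_bounded ((summable_pow_mul_pow_choose_two (norm_nonneg q) hq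
    (show (0 : ℝ) ≤ 3 by norm_num)).mul_left C) h

theorem summable_pow_mul_altSqSum {q : ℂ} (hq0 : q ≠ 0) (hq : ‖q‖ < 1) {a : ℕ → ℂ} {C : ℝ}
    (ha : ∀ n, ‖a n‖ ≤ C) (k : ℕ) :
    Summable fun n => a n * (q ^ (3 * n ^ 2 + k * n) * altSqSum q n) := by
  have hC : 0 ≤ C := (norm_nonneg _).trans (ha 0)
  refine summable_of_norm_le_pow_choose_two hq (C := C) fun n => ?_
  have hn : n.choose 2 ≤ n ^ 2 := by
    rw [Nat.choose_two_right, sq]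
    exact (Nat.div_le_self _ _).trans (Nat.mul_le_mul_left _ (Nat.sub_le _ _))
  obtain ⟨e, he⟩ := Nat.exists_eq_add_of_le
    (show n ^ 2 + n.choose 2 ≤ 3 * n ^ 2 + k * n by nlinarith [Nat.zero_le (k * n)])
  rw [norm_mul, he, add_assoc]
  refine mul_le_mul (ha n) ((norm_pow_mul_altSqSum_le hq0 hq n _).trans ?_) (norm_nonneg _) hC
  gcongr 3 ^ n * ?_
  exact pow_le_pow_of_le_one (norm_nonneg _) hq.le (Nat.le_add_right _ _)

theorem qPoch_neg_two_mul_add_one (q : ℂ) (j : ℕ) :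
    qPoch (-q) q (2 * j + 1) =
      (1 + q) * (qPoch (-q * q ^ 2) (q ^ 2) j * qPoch (-1 * q ^ 2) (q ^ 2) j) := by
  rw [qPoch_succ', qPoch_mul_eq_prod, prod_range_succ, prod_range_one]
  rw [show -q * q * q ^ 0 = -1 * q ^ 2 by ring, show -q * q * q ^ 1 = -q * q ^ 2 by ring]
  ring

theorem one_sub_neg_mul_ne_zero {x q : ℂ} (hx : ‖x‖ < 1) (hq : ‖q‖ < 1) (k : ℕ) :
    1 - -x * q ^ k ≠ 0 :=
  one_sub_mul_pow_ne_zero (by simpa using hx) hq k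

/-- The Bailey pair behind the three representations with `∑ (-1)^j q^{-j^2}`, in the base `q^2`.
By `qPoch_neg_two_mul_add_one` its `β` is, up to a constant, of the form to which
`baileyInv_recurrence` applies, with `(b, c) = (-q, -1)`. -/
theorem isBaileyPair_altSqSum {q : ℂ} (hq0 : q ≠ 0) (hq : ‖q‖ < 1) :
    IsBaileyPair (q ^ 2)
      (fun n => (1 - q ^ (2 * n + 1)) * (q ^ (2 * n ^ 2 + n) * altSqSum q n))
      (fun n => (qPoch (-q) q (2 * n + 1))⁻¹) := by
  have hq2 := norm_sq_lt_one hq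
  have h1 := one_sub_mul_pow_ne_zero hq2 hq2
  have e : 1 + q ≠ 0 := one_add_ne_zero_of_norm_lt_one hq
  set β : ℕ → ℂ := fun j => (qPoch (-q * q ^ 2) (q ^ 2) j * qPoch (-1 * q ^ 2) (q ^ 2) j)⁻¹ with hβ
  have hb : ∀ k : ℕ, 1 - -q * q ^ 2 * (q ^ 2) ^ k ≠ 0 := fun k => by
    have := one_sub_neg_mul_ne_zero (x := q * q ^ 2) (by
      rw [norm_mul]; exact mul_lt_one_of_nonneg_of_lt_one_left (norm_nonneg _) hq hq2.le) hq2 k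
    rwa [← neg_mul] at this
  have hc : ∀ k : ℕ, 1 - -1 * q ^ 2 * (q ^ 2) ^ k ≠ 0 := fun k => by
    simpa using one_sub_neg_mul_ne_zero hq2 hq2 k
  have hL : ∀ n, (1 + q ^ (2 * n + 1)) * baileyInv (q ^ 2) β n =
      (1 + q) * (q ^ (2 * n ^ 2 + n) * altSqSum q n) := by
    intro n
    induction n with
    | zero => simp [baileyInv, hβ, altSqSum]
    | succ n ih =>
      have hr := baileyInv_recurrence h1 hb hc (β := β) (fun _ => rfl) n
      -- the recurrence carries the factor `1 - c q^{2n+2} = 1 + q^{2n+2}` on both sides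
      have hne : 1 + q ^ (2 * n + 2) ≠ 0 := by
        have := hc n
        rw [← pow_mul] at this
        convert this using 1
        ring
      apply mul_left_cancel₀ hne
      have h3 : q ^ ((n + 1) ^ 2) ≠ 0 := pow_ne_zero _ hq0
      have h4 : (q ^ 2) ^ (n + 2).choose 2 = q ^ ((n + 1) * (n + 2)) := by
        rw [← pow_mul, Nat.choose_two_right]
        congr 1
        rw [Nat.mul_div_cancel' (Nat.even_mul_pred_self _).two_dvd]
        simp [mul_comm]
      have h5 : q ^ (2 * (n + 1) ^ 2 + (n + 1)) * (q ^ ((n + 1) ^ 2))⁻¹ =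
          q ^ ((n + 1) * (n + 2)) := by
        rw [mul_inv_eq_iff_eq_mul₀ h3, ← pow_add]
        congr 1
        ring
      rw [altSqSum_succ]
      rw [h4] at hr
      have h6 : q ^ (2 * (n + 1) ^ 2 + (n + 1)) = q ^ (4 * n + 3) * q ^ (2 * n ^ 2 + n) := by
        rw [← pow_add]; congr 1; ring
      linear_combination hr + (1 + q ^ (2 * n + 2)) * q ^ (4 * n + 3) * ih -
        (1 + q ^ (2 * n + 2)) * (1 + q) * 2 * (-1) ^ (n + 1) * h5 -
        (1 + q ^ (2 * n + 2)) * (1 + q) * altSqSum q n * h6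
  have hp := isBaileyPair_baileyInv h1 β
  intro n
  have := hp n
  dsimp only at this ⊢
  rw [qPoch_neg_two_mul_add_one, mul_inv, show (qPoch (-q * q ^ 2) (q ^ 2) n *
    qPoch (-1 * q ^ 2) (q ^ 2) n)⁻¹ = β n from rfl, this, mul_sum]
  refine sum_congr rfl fun p _ => ?_
  rw [← mul_div_assoc]
  congr 1
  have h7 := hL p.1
  rw [show q ^ (2 * p.1 ^ 2 + p.1) * altSqSum q p.1 = (1 + q)⁻¹ * ((1 + q ^ (2 * p.1 + 1)) *
    baileyInv (q ^ 2) β p.1) by rw [h7]; field_simp]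
  ring

theorem norm_one_sub_pow_le {q : ℂ} (hq : ‖q‖ < 1) (n : ℕ) : ‖1 - q ^ n‖ ≤ 2 := by
  calc ‖1 - q ^ n‖ ≤ ‖(1 : ℂ)‖ + ‖q ^ n‖ := norm_sub_le _ _
    _ ≤ 1 + 1 := by
      rw [norm_one, norm_pow]
      gcongr
      exact pow_le_one₀ (norm_nonneg _) hq.le
    _ = 2 := by norm_num

theorem norm_altSqSum_pair_le {q : ℂ} (hq0 : q ≠ 0) (hq : ‖q‖ < 1) (n : ℕ) :
    ‖(1 - q ^ (2 * n + 1)) * (q ^ (2 * n ^ 2 + n) * altSqSum q n)‖ ≤ 2 * 3 ^ n := by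
  rw [norm_mul]
  gcongr
  · exact norm_one_sub_pow_le hq _
  · rw [show 2 * n ^ 2 + n = n ^ 2 + (n ^ 2 + n) by ring]
    refine (norm_pow_mul_altSqSum_le hq0 hq n _).trans ?_
    exact mul_le_of_le_one_right (by positivity) (pow_le_one₀ (norm_nonneg _) hq.le)

theorem exists_norm_inv_qPoch_neg_le {q : ℂ} (hq : ‖q‖ < 1) :
    ∃ C : ℝ, ∀ n : ℕ, ‖(qPoch (-q) q (2 * n + 1))⁻¹‖ ≤ C * 1 ^ n := by
  obtain ⟨C, _, hC⟩ := exists_norm_inv_qPoch_le hq (one_sub_neg_mul_ne_zero hq hq)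
  exact ⟨C, fun n => by simpa using hC (2 * n + 1)⟩

/-- The Bailey lemma for the pair `isBaileyPair_altSqSum`, with a free parameter `z`. -/
theorem tsum_baileyWeight_altSqSum {q : ℂ} (hq0 : q ≠ 0) (hq : ‖q‖ < 1) (z : ℂ) :
    (Summable fun n => baileyWeight (q ^ 2) z n * (qPoch (-q) q (2 * n + 1))⁻¹) ∧
    ∑' n, baileyWeight (q ^ 2) z n * (qPoch (-q) q (2 * n + 1))⁻¹ =
      (∑' n, baileyWeight (q ^ 2) z n *
        ((1 - q ^ (2 * n + 1)) * (q ^ (2 * n ^ 2 + n) * altSqSum q n)) *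
          qPochInf (z * (q ^ 2) ^ n) (q ^ 2)) / qPochInf (q ^ 2) (q ^ 2) := by
  obtain ⟨C, hC⟩ := exists_norm_inv_qPoch_neg_le hq
  have hq2 := norm_sq_lt_one hq
  exact ⟨(summable_norm_baileyWeight_mul hq2 z zero_le_one hC).of_norm,
    (isBaileyPair_altSqSum hq0 hq).tsum_eq hq2 z (show (0 : ℝ) ≤ 3 by norm_num)
      (norm_altSqSum_pair_le hq0 hq) zero_le_one hC⟩

/-- The weight for `z = q^2 / ρ` in factored form. -/
theorem baileyWeight_eq (q ρ z : ℂ) (h : ρ * z = q ^ 2) (n : ℕ) :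
    baileyWeight q z n = (-1) ^ n * q ^ n.choose 2 * z ^ n * qPoch ρ q n := by
  rw [baileyWeight, qPoch]
  simp only [show ∀ i, z - q ^ (i + 2) = z * (1 - ρ * q ^ i) from
    fun i => by rw [pow_add, ← h]; ring, prod_mul_distrib, prod_const, card_range]
  ring

theorem sq_pow_choose_two_mul (q : ℂ) (n : ℕ) : (q ^ 2) ^ n.choose 2 * q ^ n = q ^ (n ^ 2) := by
  rw [← pow_mul, ← pow_add, Nat.choose_two_right,
    Nat.mul_div_cancel' (Nat.even_mul_pred_self _).two_dvd]
  congr 1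
  cases n with
  | zero => rfl
  | succ n => simp; ring

theorem neg_one_pow_mul_self (n : ℕ) : (-1 : ℂ) ^ n * (-1) ^ n = 1 := by
  rw [← mul_pow]; simp

theorem psi6HeckeTerm_eq {q : ℂ} (hq0 : q ≠ 0) (n : ℕ) :
    psi6HeckeTerm q n = (-1) ^ n * (q ^ (3 * n ^ 2 + 3 * n) * altSqSum q n) := by
  rw [psi6HeckeTerm, altSqSum, mul_sum, mul_sum]
  refine sum_congr rfl fun j _ => ?_
  rw [zpow_add₀ (by norm_num), sub_eq_add_neg, zpow_add₀ hq0, zpow_natCast, ← zpow_natCast q]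
  push_cast
  ring

theorem sigmaHeckeTerm_eq {q : ℂ} (hq0 : q ≠ 0) (n : ℕ) :
    sigmaHeckeTerm q n =
      (-1) ^ n * (1 - q ^ (2 * n + 1)) * (q ^ (3 * n ^ 2 + 2 * n) * altSqSum q n) := by
  rw [sigmaHeckeTerm, altSqSum, mul_sum, mul_sum]
  refine sum_congr rfl fun j _ => ?_
  rw [zpow_add₀ (by norm_num), sub_eq_add_neg (3 * (n : ℤ) ^ 2 + 2 * n), zpow_add₀ hq0,
    zpow_natCast, ← zpow_natCast q (3 * n ^ 2 + 2 * n)]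
  push_cast
  ring

theorem nu3HeckeTerm_eq (q : ℂ) (n : ℕ) :
    nu3HeckeTerm q n = (1 - q ^ (2 * n + 1)) * (q ^ (3 * n ^ 2 + 2 * n) * altSqSum q n) := by
  rw [nu3HeckeTerm, altSqSum, mul_assoc]

theorem summable_psi6HeckeTerm {q : ℂ} (hq0 : q ≠ 0) (hq : ‖q‖ < 1) :
    Summable (psi6HeckeTerm q) := by
  simp only [funext (psi6HeckeTerm_eq hq0)]
  exact summable_pow_mul_altSqSum hq0 hq (C := 1) (fun n => by simp) 3

theorem summable_sigmaHeckeTerm {q : ℂ} (hq0 : q ≠ 0) (hq : ‖q‖ < 1) :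
    Summable (sigmaHeckeTerm q) := by
  simp only [funext (sigmaHeckeTerm_eq hq0)]
  exact summable_pow_mul_altSqSum hq0 hq (C := 2)
    (fun n => by simpa using norm_one_sub_pow_le hq _) 2

theorem summable_nu3HeckeTerm {q : ℂ} (hq0 : q ≠ 0) (hq : ‖q‖ < 1) :
    Summable (nu3HeckeTerm q) := by
  simp only [funext (nu3HeckeTerm_eq q)]
  exact summable_pow_mul_altSqSum hq0 hq (C := 2) (fun n => norm_one_sub_pow_le hq _) 2

theorem psi6Term_eq {q : ℂ} (n : ℕ) : psi6Term q n =
    q * (baileyWeight (q ^ 2) (q ^ 3) n * (qPoch (-q) q (2 * n + 1))⁻¹) := by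
  rw [psi6Term, baileyWeight_eq (q ^ 2) q (q ^ 3) (by ring), div_eq_mul_inv,
    show q ^ ((n + 1) ^ 2) = q * (q ^ (n ^ 2) * (q ^ n) ^ 2) by ring, ← sq_pow_choose_two_mul]
  ring

theorem summable_psi6Term {q : ℂ} (hq0 : q ≠ 0) (hq : ‖q‖ < 1) : Summable (psi6Term q) := by
  simp only [funext (fun n => psi6Term_eq (q := q) n)]
  exact (tsum_baileyWeight_altSqSum hq0 hq (q ^ 3)).1.mul_left q

/-- The free parameter is `z = q^3`, that is `ρ = q`. -/
theorem psi6_eq_hecke {q : ℂ} (hq0 : q ≠ 0) (hq : ‖q‖ < 1) :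
    psi6 q = q * (qPochInf q (q ^ 2) / qPochInf (q ^ 2) (q ^ 2)) *
      ∑' n : ℕ, psi6HeckeTerm q n := by
  have hq2 := norm_sq_lt_one hq
  rw [psi6]
  simp only [psi6Term_eq, psi6HeckeTerm_eq hq0]
  rw [tsum_mul_left, (tsum_baileyWeight_altSqSum hq0 hq (q ^ 3)).2]
  have h : ∀ n, baileyWeight (q ^ 2) (q ^ 3) n *
      ((1 - q ^ (2 * n + 1)) * (q ^ (2 * n ^ 2 + n) * altSqSum q n)) *
        qPochInf (q ^ 3 * (q ^ 2) ^ n) (q ^ 2) = qPochInf q (q ^ 2) *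
        ((-1) ^ n * (q ^ (3 * n ^ 2 + 3 * n) * altSqSum q n)) := fun n => by
    rw [baileyWeight_eq (q ^ 2) q (q ^ 3) (by ring), qPochInf_eq_qPoch_mul q hq2 (n + 1),
      qPoch_succ, show q * (q ^ 2) ^ (n + 1) = q ^ 3 * (q ^ 2) ^ n by ring,
      show q ^ (3 * n ^ 2 + 3 * n) = q ^ (n ^ 2) * (q ^ n) ^ 2 * q ^ (2 * n ^ 2 + n) by ring,
      ← sq_pow_choose_two_mul]
    ring
  simp only [h]
  rw [tsum_mul_left]
  ring

theorem sigmaTerm_eq {q : ℂ} (n : ℕ) : sigmaTerm q n =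
    baileyWeight (q ^ 2) (q ^ 2) n * (qPoch (-q) q (2 * n + 1))⁻¹ := by
  rw [sigmaTerm, baileyWeight_eq (q ^ 2) (q ^ 2) (q ^ 2) (by ring), div_eq_mul_inv,
    show q ^ (n * (n + 1)) = q ^ (n ^ 2) * q ^ n by ring, ← sq_pow_choose_two_mul]
  ring

theorem summable_sigmaTerm {q : ℂ} (hq0 : q ≠ 0) (hq : ‖q‖ < 1) : Summable (sigmaTerm q) := by
  simp only [funext (fun n => sigmaTerm_eq (q := q) n)]
  exact (tsum_baileyWeight_altSqSum hq0 hq (q ^ 2)).1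

/-- The free parameter is `z = q^2`, that is `ρ = q^2`; the infinite products cancel. -/
theorem tsum_sigmaTerm_eq {q : ℂ} (hq0 : q ≠ 0) (hq : ‖q‖ < 1) :
    ∑' n : ℕ, sigmaTerm q n = ∑' n : ℕ, sigmaHeckeTerm q n := by
  have hq2 := norm_sq_lt_one hq
  have hinf := qPochInf_ne_zero_of_norm_lt_one hq2 hq2
  simp only [sigmaTerm_eq, sigmaHeckeTerm_eq hq0]
  rw [(tsum_baileyWeight_altSqSum hq0 hq (q ^ 2)).2, div_eq_iff hinf, ← tsum_mul_right]
  refine tsum_congr fun n => ?_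
  rw [baileyWeight_eq (q ^ 2) (q ^ 2) (q ^ 2) (by ring), qPochInf_eq_qPoch_mul (q ^ 2) hq2 n,
    show q ^ (3 * n ^ 2 + 2 * n) = q ^ (n ^ 2) * q ^ n * q ^ (2 * n ^ 2 + n) by ring,
    ← sq_pow_choose_two_mul]
  ring

theorem nu3Term_eq {q : ℂ} (hq : ‖q‖ < 1) (n : ℕ) : nu3Term q n =
    baileyWeight (q ^ 2) (-q ^ 2) n * (qPoch (-q) q (2 * n + 1))⁻¹ := by
  have hq2 := norm_sq_lt_one hq
  have h1 : qPoch (-1 * q ^ 2) (q ^ 2) n ≠ 0 :=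
    qPoch_ne_zero (one_sub_mul_pow_ne_zero (by simpa using hq2) hq2) n
  rw [nu3Term, baileyWeight_eq (q ^ 2) (-1 * q ^ 2) (-q ^ 2) (by ring), qPoch_neg_two_mul_add_one,
    qPoch_succ', neg_pow (q ^ 2), show q ^ (n * (n + 1)) = q ^ (n ^ 2) * q ^ n by ring,
    ← sq_pow_choose_two_mul, div_eq_mul_inv, mul_inv, mul_inv, mul_inv, sub_neg_eq_add]
  have e1 : qPoch (-1 * q ^ 2) (q ^ 2) n * (qPoch (-1 * q ^ 2) (q ^ 2) n)⁻¹ = 1 :=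
    mul_inv_cancel₀ h1
  have e2 := neg_one_pow_mul_self n
  linear_combination (-(q ^ 2) ^ n.choose 2 * (q ^ n) ^ 2 * (1 + q)⁻¹ *
    (qPoch (-q * q ^ 2) (q ^ 2) n)⁻¹) * ((-1) ^ n * (-1) ^ n * e1 + e2)

theorem summable_nu3Term {q : ℂ} (hq0 : q ≠ 0) (hq : ‖q‖ < 1) : Summable (nu3Term q) := by
  simp only [funext (fun n => nu3Term_eq hq n)]
  exact (tsum_baileyWeight_altSqSum hq0 hq (-q ^ 2)).1

/-- The free parameter is `z = -q^2`, that is `ρ = -q^2`: the factor `(-q^2; q^2)_n` of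
`(-q; q)_{2n+1}` cancels. -/
theorem nu3_eq_hecke {q : ℂ} (hq0 : q ≠ 0) (hq : ‖q‖ < 1) : nu3 q = nu3Hecke q := by
  have hq2 := norm_sq_lt_one hq
  rw [nu3, nu3Hecke]
  simp only [nu3Term_eq hq, nu3HeckeTerm_eq]
  rw [(tsum_baileyWeight_altSqSum hq0 hq (-q ^ 2)).2]
  have h : ∀ n, baileyWeight (q ^ 2) (-q ^ 2) n *
      ((1 - q ^ (2 * n + 1)) * (q ^ (2 * n ^ 2 + n) * altSqSum q n)) *
        qPochInf (-q ^ 2 * (q ^ 2) ^ n) (q ^ 2) = qPochInf (-q ^ 2) (q ^ 2) *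
        ((1 - q ^ (2 * n + 1)) * (q ^ (3 * n ^ 2 + 2 * n) * altSqSum q n)) := fun n => by
    rw [baileyWeight_eq (q ^ 2) (-q ^ 2) (-q ^ 2) (by ring),
      qPochInf_eq_qPoch_mul (-q ^ 2) hq2 n, neg_pow (q ^ 2),
      show q ^ (3 * n ^ 2 + 2 * n) = q ^ (n ^ 2) * q ^ n * q ^ (2 * n ^ 2 + n) by ring,
      ← sq_pow_choose_two_mul]
    have e2 := neg_one_pow_mul_self n
    linear_combination ((q ^ 2) ^ n.choose 2 * (q ^ n) ^ 2 * qPoch (-q ^ 2) (q ^ 2) n *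
      (1 - q ^ (2 * n + 1)) * q ^ (2 * n ^ 2 + n) * altSqSum q n *
      qPochInf (-q ^ 2 * (q ^ 2) ^ n) (q ^ 2)) * e2
  simp only [h]
  rw [tsum_mul_left]
  ring

/-! ### Mortenson's representation -/

/-- The sum `∑_{j=-n}^{n} q^{-j(j+1)/2}`. -/
noncomputable def triSum (q : ℂ) (n : ℕ) : ℂ :=
  ∑ j ∈ Icc (-(n : ℤ)) n, q ^ (-(j * (j + 1) / 2))

theorem triSum_succ (q : ℂ) (n : ℕ) :
    triSum q (n + 1) = triSum q n + ((q ^ (n + 2).choose 2)⁻¹ + (q ^ (n + 1).choose 2)⁻¹) := by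
  have h1 : q ^ (-(((n + 1 : ℕ) : ℤ) * (((n + 1 : ℕ) : ℤ) + 1) / 2)) =
      (q ^ (n + 2).choose 2)⁻¹ := by
    rw [zpow_neg, Nat.choose_two_right, ← zpow_natCast]
    push_cast
    congr 3
    ring
  have h2 : q ^ (-(-((n + 1 : ℕ) : ℤ) * (-((n + 1 : ℕ) : ℤ) + 1) / 2)) =
      (q ^ (n + 1).choose 2)⁻¹ := by
    rw [zpow_neg, Nat.choose_two_right, ← zpow_natCast]
    push_cast
    congr 3
    ring
  rw [triSum, sum_Icc_neg_succ, triSum, h1, h2]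

theorem norm_pow_mul_triSum_le {q : ℂ} (hq0 : q ≠ 0) (hq : ‖q‖ < 1) (n e : ℕ) :
    ‖q ^ (n ^ 2 + n + e) * triSum q n‖ ≤ 3 ^ n * ‖q‖ ^ e := by
  rw [triSum, mul_sum]
  refine norm_sum_Icc_le (by positivity) fun j hj => ?_
  rw [← zpow_natCast q, ← zpow_add₀ hq0]
  refine norm_zpow_le hq0 hq ?_
  have h1 : |j| ≤ n := abs_le_of_sq_le_sq hj (Int.natCast_nonneg n)
  have h2 := le_abs_self j
  have h3 : j * (j + 1) / 2 ≤ (n : ℤ) ^ 2 + n := by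
    refine Int.ediv_le_of_le_mul (by norm_num) ?_
    nlinarith
  push_cast
  linarith

/-- The Bailey pair behind Mortenson's representation. With `t^2 = q` its `β` is, up to a constant,
`1 / ((tq; q)_n (-tq; q)_n)`, so that `baileyInv_recurrence` applies with `(b, c) = (t, -t)`. -/
theorem isBaileyPair_triSum {q : ℂ} (hq0 : q ≠ 0) (hq : ‖q‖ < 1) :
    IsBaileyPair q (fun n => (-1) ^ n * (q ^ (n ^ 2 + n) * triSum q n))
      (fun n => (qPoch q (q ^ 2) (n + 1))⁻¹) := by
  have hq2 := norm_sq_lt_one hq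
  have h1 := one_sub_mul_pow_ne_zero hq hq
  have e : 1 - q ≠ 0 := one_sub_ne_zero_of_norm_lt_one hq
  obtain ⟨t, ht⟩ : ∃ t : ℂ, q = t ^ 2 :=
    (IsAlgClosed.exists_pow_nat_eq q two_pos).imp fun _ => Eq.symm
  have ht1 : ‖t‖ < 1 := by
    rw [ht, norm_pow] at hq
    exact (sq_lt_one_iff₀ (norm_nonneg _)).1 hq
  have htq : ‖t * q‖ < 1 := by
    rw [norm_mul]; exact mul_lt_one_of_nonneg_of_lt_one_left (norm_nonneg _) ht1 hq.le
  have hb := one_sub_mul_pow_ne_zero htq hq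
  have hc : ∀ k : ℕ, 1 - -t * q * q ^ k ≠ 0 := fun k => by
    simpa using one_sub_neg_mul_ne_zero htq hq k
  set β : ℕ → ℂ := fun j => (qPoch (t * q) q j * qPoch (-t * q) q j)⁻¹ with hβ
  have hβe : ∀ n, (qPoch q (q ^ 2) (n + 1))⁻¹ = (1 - q)⁻¹ * β n := fun n => by
    rw [qPoch_succ', mul_inv, hβ]
    congr 2
    rw [neg_mul, qPoch_mul_neg, mul_pow, ← ht]
  have hL : ∀ n, (1 - q ^ (2 * n + 1)) * baileyInv q β n =
      (1 - q) * ((-1) ^ n * (q ^ (n ^ 2 + n) * triSum q n)) := by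
    intro n
    induction n with
    | zero => simp [baileyInv, hβ, triSum]
    | succ n ih =>
      have hr := baileyInv_recurrence h1 hb hc (β := β) (fun _ => rfl) n
      have h2 : q ^ (n + 2).choose 2 ≠ 0 := pow_ne_zero _ hq0
      have h3 : q ^ (n + 1).choose 2 ≠ 0 := pow_ne_zero _ hq0
      have h4 : q ^ ((n + 1) ^ 2 + (n + 1)) = (q ^ (n + 2).choose 2) ^ 2 := by
        rw [← pow_mul, mul_comm, Nat.choose_two_right,
          Nat.mul_div_cancel' (Nat.even_mul_pred_self _).two_dvd]
        congr 1
        simp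
        ring
      have h5 : q ^ (n + 2).choose 2 = q ^ (n + 1).choose 2 * q ^ (n + 1) := by
        rw [choose_two_succ (n + 1), pow_add]
      have h6 : q ^ ((n + 1) ^ 2 + (n + 1)) * (q ^ (n + 2).choose 2)⁻¹ = q ^ (n + 2).choose 2 := by
        rw [h4]; field_simp
      have h7 : q ^ ((n + 1) ^ 2 + (n + 1)) * (q ^ (n + 1).choose 2)⁻¹ =
          q ^ (n + 2).choose 2 * q ^ (n + 1) := by
        rw [h4]
        nth_rewrite 1 [sq, h5]
        field_simp
      rw [triSum_succ]
      linear_combination hr - q ^ (2 * n + 2) * ih + (1 - q) * (-1) ^ n * (h6 + h7) +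
        (q ^ n * q ^ (n + 1) * baileyInv q β n - q ^ (2 * n + 2) * baileyInv q β (n + 1) -
          (-1) ^ n * (1 + q ^ (n + 1)) * q ^ (n + 2).choose 2) * ht
  have hp := isBaileyPair_baileyInv h1 β
  intro n
  have := hp n
  dsimp only at this ⊢
  rw [hβe, this, mul_sum]
  refine sum_congr rfl fun p _ => ?_
  rw [← mul_div_assoc, hL, inv_mul_cancel_left₀ e]

theorem exists_norm_inv_qPoch_succ_le {q : ℂ} (hq : ‖q‖ < 1) :
    ∃ C : ℝ, ∀ n : ℕ, ‖(qPoch q (q ^ 2) (n + 1))⁻¹‖ ≤ C * 1 ^ n := by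
  have hq2 := norm_sq_lt_one hq
  obtain ⟨C, _, hC⟩ := exists_norm_inv_qPoch_le hq2 (one_sub_mul_pow_ne_zero hq hq2)
  exact ⟨C, fun n => by simpa using hC (n + 1)⟩

/-- At `ρ = ∞` the weight is a power of `q`. -/
theorem baileyWeight_zero (q : ℂ) (n : ℕ) : baileyWeight q 0 n = q ^ (n * (n + 1)) := by
  induction n with
  | zero => simp [baileyWeight]
  | succ n ih =>
    rw [baileyWeight] at ih ⊢
    rw [prod_range_succ, choose_two_succ, pow_add q, pow_succ (-1 : ℂ)]
    rw [show q ^ ((n + 1) * (n + 1 + 1)) = q ^ (n * (n + 1)) * q ^ (2 * n + 2) by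
      rw [← pow_add]; congr 1; ring, ← ih]
    ring

@[simp] theorem qPochInf_zero (q : ℂ) : qPochInf 0 q = 1 := by simp [qPochInf]

theorem nu3NegTerm_eq (q : ℂ) (n : ℕ) :
    nu3NegTerm q n = baileyWeight q 0 n * (qPoch q (q ^ 2) (n + 1))⁻¹ := by
  rw [nu3NegTerm, baileyWeight_zero, div_eq_mul_inv]

theorem mortensonTerm_eq {q : ℂ} (hq0 : q ≠ 0) (n : ℕ) : mortensonTerm q n =
    baileyWeight q 0 n * ((-1) ^ n * (q ^ (n ^ 2 + n) * triSum q n)) := by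
  rw [mortensonTerm, baileyWeight_zero, triSum, mul_sum, mul_sum, mul_sum]
  refine sum_congr rfl fun j _ => ?_
  rw [sub_eq_add_neg, zpow_add₀ hq0,
    show (2 * (n : ℤ) ^ 2 + 2 * n) = ((n * (n + 1) + (n ^ 2 + n) : ℕ) : ℤ) by push_cast; ring,
    zpow_natCast, pow_add]
  ring

theorem norm_triSum_pair_le {q : ℂ} (hq0 : q ≠ 0) (hq : ‖q‖ < 1) (n : ℕ) :
    ‖(-1) ^ n * (q ^ (n ^ 2 + n) * triSum q n)‖ ≤ 1 * 3 ^ n := by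
  simpa using norm_pow_mul_triSum_le hq0 hq n 0

theorem summable_nu3NegTerm {q : ℂ} (hq : ‖q‖ < 1) : Summable (nu3NegTerm q) := by
  obtain ⟨C, hC⟩ := exists_norm_inv_qPoch_succ_le hq
  simp only [funext (nu3NegTerm_eq q)]
  exact (summable_norm_baileyWeight_mul hq 0 zero_le_one hC).of_norm

theorem summable_mortensonTerm {q : ℂ} (hq0 : q ≠ 0) (hq : ‖q‖ < 1) :
    Summable (mortensonTerm q) := by
  simp only [funext (mortensonTerm_eq hq0)]
  exact (summable_norm_baileyWeight_mul hq 0 (show (0 : ℝ) ≤ 3 by norm_num)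
    (norm_triSum_pair_le hq0 hq)).of_norm

/-- The Bailey lemma at `z = 0`, that is `ρ = ∞`. -/
theorem tsum_nu3NegTerm_eq {q : ℂ} (hq0 : q ≠ 0) (hq : ‖q‖ < 1) :
    ∑' n : ℕ, nu3NegTerm q n = mortensonHecke q := by
  obtain ⟨C, hC⟩ := exists_norm_inv_qPoch_succ_le hq
  have := (isBaileyPair_triSum hq0 hq).tsum_eq hq 0 (show (0 : ℝ) ≤ 3 by norm_num)
    (norm_triSum_pair_le hq0 hq) zero_le_one hC
  simp only [nu3NegTerm_eq, mortensonHecke, mortensonTerm_eq hq0]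
  rw [this]
  simp only [zero_mul, qPochInf_zero, mul_one]
  ring

theorem nu3_neg (q : ℂ) : nu3 (-q) = ∑' n : ℕ, nu3NegTerm q n := by
  rw [nu3]
  refine tsum_congr fun n => ?_
  rw [nu3Term, nu3NegTerm, neg_neg, neg_sq, (Nat.even_mul_succ_self n).neg_pow]

/-! ### Rearranging Hecke-type double series -/

theorem sum_antidiagonal_add_two {M : Type*} [AddCommMonoid M] (n : ℕ) (u : ℤ → M) :
    ∑ p ∈ antidiagonal (n + 2), u (p.1 - p.2) =
      ∑ p ∈ antidiagonal n, u (p.1 - p.2) + (u (n + 2 : ℕ) + u (-((n + 2 : ℕ) : ℤ))) := by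
  rw [Finset.Nat.sum_antidiagonal_succ, Finset.Nat.sum_antidiagonal_succ']
  simp only [Nat.cast_add, Nat.cast_one, add_sub_add_right_eq_sub, Nat.cast_zero, sub_zero,
    zero_sub]
  rw [show ((2 : ℕ) : ℤ) = 1 + 1 from rfl, ← add_assoc]
  abel_nf

/-- The integers in `[-n-1, n+1]` are the differences of the pairs of naturals with sum `n + 1`
(those of the parity of `n + 1`) and of the pairs with sum `n` (those of the parity of `n`). -/
theorem sum_Icc_eq_sum_antidiagonal {M : Type*} [AddCommMonoid M] (n : ℕ) (u : ℤ → M) :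
    ∑ j ∈ Icc (-((n + 1 : ℕ) : ℤ)) ((n + 1 : ℕ) : ℤ), u j =
      ∑ p ∈ antidiagonal (n + 1), u (p.1 - p.2) + ∑ p ∈ antidiagonal n, u (p.1 - p.2) := by
  induction n with
  | zero =>
    rw [sum_Icc_neg_succ]
    simp [Finset.Nat.sum_antidiagonal_succ]
    abel
  | succ n ih =>
    rw [sum_Icc_neg_succ, ih, sum_antidiagonal_add_two]
    abel

/-- The sum `∑_{r+s=n} q^{-(r-s)^2}`. -/
noncomputable def sqSum (q : ℂ) (n : ℕ) : ℂ :=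
  ∑ p ∈ antidiagonal n, q ^ (-((p.1 : ℤ) - p.2) ^ 2)

theorem neg_one_zpow_sub (a b : ℕ) : (-1 : ℂ) ^ ((a : ℤ) - b) = (-1) ^ (a + b) := by
  rw [zpow_sub₀ (by norm_num), zpow_natCast, zpow_natCast, pow_add, div_eq_mul_inv, ← inv_pow,
    inv_neg_one]

theorem altSqSum_succ_eq (q : ℂ) (n : ℕ) :
    altSqSum q (n + 1) = (-1) ^ (n + 1) * (sqSum q (n + 1) - sqSum q n) := by
  have h : ∀ m : ℕ, ∑ p ∈ antidiagonal m,
      (-1 : ℂ) ^ ((p.1 : ℤ) - p.2) * q ^ (-((p.1 : ℤ) - p.2) ^ 2) = (-1) ^ m * sqSum q m :=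
      fun m => by
    rw [sqSum, mul_sum]
    refine sum_congr rfl fun p hp => ?_
    rw [mem_antidiagonal_nat] at hp
    rw [neg_one_zpow_sub, hp]
  rw [altSqSum, sum_Icc_eq_sum_antidiagonal n fun j : ℤ => (-1 : ℂ) ^ j * q ^ (-j ^ 2), h, h]
  ring

theorem hasSum_antidiagonal {u : ℕ × ℕ → ℂ} {a : ℂ} (h : HasSum u a) :
    HasSum (fun n => ∑ p ∈ antidiagonal n, u p) a := by
  have h1 := Finset.HasAntidiagonal.sigmaAntidiagonalEquivProd.hasSum_iff.2 h
  refine h1.sigma fun n => ?_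
  rw [← Finset.sum_finset_coe]
  exact hasSum_fintype _

theorem sg_natCast (n : ℕ) : sg (n : ℤ) = 1 := by simp [sg]

theorem sg_neg (n : ℕ) : sg (-1 - n : ℤ) = -1 := by
  rw [sg, if_neg (by omega)]

/-- A double series over the pairs of integers of equal sign is the sum of two double series over
pairs of naturals. -/
theorem hasSum_of_sg_eq {F : ℤ × ℤ → ℂ} (hF : ∀ p, sg p.1 ≠ sg p.2 → F p = 0) {a b : ℂ}
    (ha : HasSum (fun p : ℕ × ℕ => F (p.1, p.2)) a)
    (hb : HasSum (fun p : ℕ × ℕ => F (-1 - p.1, -1 - p.2)) b) : HasSum F (a + b) := by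
  have hF' : F = fun p => (if 0 ≤ p.1 then F p else 0) + (if 0 ≤ p.1 then 0 else F p) := by
    funext p; split_ifs <;> simp
  rw [hF']
  refine HasSum.add ?_ ?_
  · have hi : Function.Injective fun p : ℕ × ℕ => ((p.1 : ℤ), (p.2 : ℤ)) := by
      rintro ⟨a, b⟩ ⟨c, d⟩ h
      simpa using h
    refine (hi.hasSum_iff ?_).1 (ha.congr_fun fun p => ?_)
    · rintro ⟨r, s⟩ hrs
      split_ifs with h
      · refine hF _ fun e => hrs ⟨(r.toNat, s.toNat), ?_⟩
        dsimp only at h e ⊢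
        simp only [sg, h, if_true] at e
        split_ifs at e with h2
        simp [Int.toNat_of_nonneg h, Int.toNat_of_nonneg h2]
      · rfl
    · simp
  · have hi : Function.Injective fun p : ℕ × ℕ => (-1 - (p.1 : ℤ), -1 - (p.2 : ℤ)) := by
      rintro ⟨a, b⟩ ⟨c, d⟩ h
      simpa using h
    refine (hi.hasSum_iff ?_).1 (hb.congr_fun fun p => ?_)
    · rintro ⟨r, s⟩ hrs
      split_ifs with h
      · rfl
      · refine hF _ fun e => hrs ⟨((-1 - r).toNat, (-1 - s).toNat), ?_⟩
        dsimp only at h e ⊢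
        simp only [sg, h, if_false] at e
        split_ifs at e with h2
        · rw [Int.toNat_of_nonneg (by omega), Int.toNat_of_nonneg (by omega)]
          simp
    · have : ¬ (0 : ℤ) ≤ -1 - p.1 := by omega
      exact if_neg this

theorem summable_norm_pow_add {ρ : ℝ} (h0 : 0 ≤ ρ) (h1 : ρ < 1) :
    Summable fun p : ℕ × ℕ => ρ ^ (p.1 + p.2) := by
  have h := summable_geometric_of_lt_one h0 h1
  simpa [pow_add] using h.mul_of_nonneg h (fun _ => by positivity) fun _ => by positivity

/-- The summand `ε^n q^{3n^2+kn+c-(r-s)^2}`, with `n = r + s`. -/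
noncomputable def quadTerm (q ε : ℂ) (k c : ℤ) (p : ℕ × ℕ) : ℂ :=
  ε ^ (p.1 + p.2) *
    q ^ (3 * ((p.1 : ℤ) + p.2) ^ 2 + k * (p.1 + p.2) + c - ((p.1 : ℤ) - p.2) ^ 2)

theorem summable_quadTerm {q ε : ℂ} (hq0 : q ≠ 0) (hq : ‖q‖ < 1) (hε : ‖ε‖ ≤ 1) {k : ℤ}
    (hk : 1 ≤ k) (c : ℤ) : Summable (quadTerm q ε k c) := by
  refine .of_norm_bounded ((summable_norm_pow_add (norm_nonneg q) hq).mul_right ‖q ^ c‖)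
    fun p => ?_
  rw [quadTerm, norm_mul, norm_pow,
    show 3 * ((p.1 : ℤ) + p.2) ^ 2 + k * (p.1 + p.2) + c - ((p.1 : ℤ) - p.2) ^ 2 =
      (3 * ((p.1 : ℤ) + p.2) ^ 2 + k * (p.1 + p.2) - ((p.1 : ℤ) - p.2) ^ 2) + c by ring,
    zpow_add₀ hq0, norm_mul, ← mul_assoc]
  refine mul_le_mul_of_nonneg_right ?_ (norm_nonneg _)
  refine (mul_le_of_le_one_left (norm_nonneg _) (pow_le_one₀ (norm_nonneg _) hε)).trans ?_
  refine norm_zpow_le hq0 hq ?_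
  have h1 : (0 : ℤ) ≤ p.1 := Int.natCast_nonneg _
  have h2 : (0 : ℤ) ≤ p.2 := Int.natCast_nonneg _
  push_cast
  nlinarith [mul_nonneg h1 h2, mul_nonneg (sub_nonneg.2 hk) (add_nonneg h1 h2)]

theorem hasSum_pow_mul_sqSum {q ε : ℂ} (hq0 : q ≠ 0) (hq : ‖q‖ < 1) (hε : ‖ε‖ ≤ 1) {k : ℕ}
    (hk : 1 ≤ k) (c : ℕ) :
    HasSum (fun n => ε ^ n * q ^ (3 * n ^ 2 + k * n + c) * sqSum q n)
      (∑' p, quadTerm q ε k c p) := by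
  have h := hasSum_antidiagonal
    (summable_quadTerm hq0 hq hε (k := k) (by exact_mod_cast hk) c).hasSum
  refine h.congr_fun fun n => ?_
  rw [sqSum, mul_sum]
  refine sum_congr rfl fun p hp => ?_
  rw [mem_antidiagonal_nat] at hp
  rw [quadTerm, hp, sub_eq_add_neg (3 * ((p.1 : ℤ) + p.2) ^ 2 + k * (p.1 + p.2) + c),
    zpow_add₀ hq0, ← Nat.cast_add, hp, ← zpow_natCast q, mul_assoc]
  push_cast
  rfl

/-- The common rearrangement behind the two-term formulas: a series over `n` whose inner sum runs
over all `|j| ≤ n`, split according to the parity of `n + j`. -/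
theorem hasSum_altSqSum {q ε : ℂ} (hq0 : q ≠ 0) (hq : ‖q‖ < 1) (hε : ‖ε‖ ≤ 1) :
    HasSum (fun n : ℕ => ε ^ n * ((-1) ^ n * (1 - q ^ (2 * n + 1)) *
        (q ^ (3 * n ^ 2 + 2 * n) * altSqSum q n)))
      (∑' p, quadTerm q ε 2 0 p - ∑' p, quadTerm q ε 4 1 p -
        (ε * ∑' p, quadTerm q ε 8 5 p - ε * ∑' p, quadTerm q ε 10 8 p)) := by
  have h1 := hasSum_pow_mul_sqSum hq0 hq hε (k := 2) (by norm_num) 0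
  have h2 := hasSum_pow_mul_sqSum hq0 hq hε (k := 4) (by norm_num) 1
  have h3 := (hasSum_pow_mul_sqSum hq0 hq hε (k := 8) (by norm_num) 5).mul_left ε
  have h4 := (hasSum_pow_mul_sqSum hq0 hq hε (k := 10) (by norm_num) 8).mul_left ε
  -- the pairs with sum `n - 1`; there are none for `n = 0`
  set g : ℕ → ℂ := fun n => n.casesOn 0 fun m => ε * (ε ^ m * q ^ (3 * m ^ 2 + 8 * m + 5) *
    sqSum q m) - ε * (ε ^ m * q ^ (3 * m ^ 2 + 10 * m + 8) * sqSum q m) with hg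
  have h5 : HasSum g (ε * ∑' p, quadTerm q ε 8 5 p - ε * ∑' p, quadTerm q ε 10 8 p) := by
    rw [← hasSum_nat_add_iff' 1]
    simpa [hg] using h3.sub h4
  refine ((h1.sub h2).sub h5).congr_fun fun n => ?_
  cases n with
  | zero => simp [hg, altSqSum, sqSum]
  | succ n =>
    rw [altSqSum_succ_eq]
    have e := neg_one_pow_mul_self (n + 1)
    simp only [hg]
    rw [show q ^ (3 * (n + 1) ^ 2 + 4 * (n + 1) + 1) =
        q ^ (3 * (n + 1) ^ 2 + 2 * (n + 1)) * q ^ (2 * (n + 1) + 1) by ring,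
      show q ^ (3 * n ^ 2 + 10 * n + 8) =
        q ^ (3 * (n + 1) ^ 2 + 2 * (n + 1)) * q ^ (2 * (n + 1) + 1) by ring,
      show q ^ (3 * n ^ 2 + 8 * n + 5) = q ^ (3 * (n + 1) ^ 2 + 2 * (n + 1)) by ring, add_zero,
      pow_succ ε]
    linear_combination ((ε ^ n * ε) * (1 - q ^ (2 * (n + 1) + 1)) *
      q ^ (3 * (n + 1) ^ 2 + 2 * (n + 1)) * (sqSum q (n + 1) - sqSum q n)) * e

theorem two_mul_binom2 (r : ℤ) : 2 * binom2 r = r * (r - 1) := by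
  rw [binom2]
  exact Int.mul_ediv_cancel' (Int.even_mul_pred_self r).two_dvd

theorem fBarTerm_of_sg_ne (a b c : ℤ) (x y q : ℂ) {p : ℤ × ℤ} (h : sg p.1 ≠ sg p.2) :
    fBarTerm a b c x y q p = 0 := if_neg h

theorem fTerm_eq (a b c : ℤ) (x y q : ℂ) (p : ℤ × ℤ) :
    fTerm a b c x y q p = sg p.1 * fBarTerm a b c x y q p := by
  rw [fTerm, fBarTerm]
  split_ifs <;> ring

/-- In the variables `r + s` and `r - s` the exponent is that of `quadTerm`; the signs of the
arguments cancel `(-1)^{r+s}`. -/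
theorem fBarTerm_neg_pow {q : ℂ} (hq0 : q ≠ 0) (k : ℕ) (p : ℤ × ℤ) (h : sg p.1 = sg p.2) :
    fBarTerm 1 2 1 (-q ^ k) (-q ^ k) (q ^ 4) p =
      q ^ (3 * (p.1 + p.2) ^ 2 + (k - 2) * (p.1 + p.2) - (p.1 - p.2) ^ 2) := by
  have h0 : (-1 : ℂ) ≠ 0 := by norm_num
  have e1 : ∀ r : ℤ, (-q ^ k) ^ r = (-1) ^ r * q ^ (k * r) := fun r => by
    rw [← neg_one_mul, mul_zpow, ← zpow_natCast q, ← zpow_mul]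
  rw [fBarTerm, if_pos h, e1, e1, zpow_add₀ h0, ← zpow_natCast q 4, ← zpow_mul]
  have e2 : ∀ r : ℤ, (-1 : ℂ) ^ r * (-1) ^ r = 1 := fun r => by rw [← mul_zpow]; simp
  have e3 : 3 * (p.1 + p.2) ^ 2 + ((k : ℤ) - 2) * (p.1 + p.2) - (p.1 - p.2) ^ 2 =
      k * p.1 + k * p.2 + (4 : ℕ) * (1 * binom2 p.1 + 2 * p.1 * p.2 + 1 * binom2 p.2) := by
    have := two_mul_binom2 p.1
    have := two_mul_binom2 p.2
    push_cast
    linear_combination -2 * two_mul_binom2 p.1 - 2 * two_mul_binom2 p.2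
  rw [e3, zpow_add₀ hq0, zpow_add₀ hq0]
  linear_combination (q ^ (k * p.1) * q ^ (k * p.2) *
    q ^ ((4 : ℕ) * (1 * binom2 p.1 + 2 * p.1 * p.2 + 1 * binom2 p.2))) *
    ((-1) ^ p.2 * (-1) ^ p.2 * e2 p.1 + e2 p.2)

theorem fTerm_pow {q : ℂ} (k : ℕ) (p : ℤ × ℤ) :
    fTerm 1 2 1 (q ^ k) (q ^ k) (q ^ 4) p =
      sg p.1 * (-1) ^ (p.1 + p.2) * fBarTerm 1 2 1 (-q ^ k) (-q ^ k) (q ^ 4) p := by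
  rw [fTerm_eq, fBarTerm, fBarTerm]
  have h0 : (-1 : ℂ) ≠ 0 := by norm_num
  have e2 : ∀ r : ℤ, (-1 : ℂ) ^ r * (-1) ^ r = 1 := fun r => by rw [← mul_zpow]; simp
  split_ifs
  · rw [← neg_one_mul (q ^ k), mul_zpow, mul_zpow, zpow_add₀ h0]
    linear_combination (-(sg p.1 : ℂ) * (-1) ^ p.1 * (-1) ^ p.2 * (q ^ k) ^ p.1 * (q ^ k) ^ p.2 *
      (q ^ 4) ^ (1 * binom2 p.1 + 2 * p.1 * p.2 + 1 * binom2 p.2)) *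
      ((-1) ^ p.2 * (-1) ^ p.2 * e2 p.1 + e2 p.2)
  · simp

/-- The bounds on `k` keep the linear coefficients positive for both signs of `(r, s)`: the
substitution `(r, s) ↦ (-1 - r, -1 - s)` changes `k - 2` to `14 - k`. -/
theorem hasSum_fBarTerm_neg_pow {q : ℂ} (hq0 : q ≠ 0) (hq : ‖q‖ < 1) {k : ℕ} (hk : 3 ≤ k)
    (hk' : k ≤ 13) :
    HasSum (fBarTerm 1 2 1 (-q ^ k) (-q ^ k) (q ^ 4))
      (∑' p, quadTerm q 1 (k - 2) 0 p + ∑' p, quadTerm q 1 (14 - k) (16 - 2 * k) p) := by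
  refine hasSum_of_sg_eq (fun p => fBarTerm_of_sg_ne _ _ _ _ _ _)
    ((summable_quadTerm hq0 hq (by simp) (by omega) _).hasSum.congr_fun fun p => ?_)
    ((summable_quadTerm hq0 hq (by simp) (by omega) _).hasSum.congr_fun fun p => ?_)
  · rw [fBarTerm_neg_pow hq0 _ _ (by simp [sg_natCast]), quadTerm, one_pow, one_mul, add_zero]
  · rw [fBarTerm_neg_pow hq0 _ _ (by simp [sg_neg]), quadTerm, one_pow, one_mul]
    congr 1
    ring

theorem hasSum_fTerm_pow {q : ℂ} (hq0 : q ≠ 0) (hq : ‖q‖ < 1) {k : ℕ} (hk : 3 ≤ k)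
    (hk' : k ≤ 13) :
    HasSum (fTerm 1 2 1 (q ^ k) (q ^ k) (q ^ 4))
      (∑' p, quadTerm q (-1) (k - 2) 0 p + -∑' p, quadTerm q (-1) (14 - k) (16 - 2 * k) p) := by
  refine hasSum_of_sg_eq (fun p h => by rw [fTerm_eq, fBarTerm_of_sg_ne _ _ _ _ _ _ h, mul_zero])
    ((summable_quadTerm hq0 hq (by simp) (by omega) _).hasSum.congr_fun fun p => ?_)
    ((summable_quadTerm hq0 hq (by simp) (by omega) _).hasSum.neg.congr_fun fun p => ?_)
  · rw [fTerm_pow, fBarTerm_neg_pow hq0 _ _ (by simp [sg_natCast]), quadTerm, add_zero,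
      sg_natCast, Int.cast_one, one_mul, ← Nat.cast_add, zpow_natCast]
  · rw [fTerm_pow, fBarTerm_neg_pow hq0 _ _ (by simp [sg_neg]), quadTerm, sg_neg,
      show (-1 - (p.1 : ℤ) + (-1 - p.2)) = -((p.1 + p.2 : ℕ) : ℤ) + -2 by push_cast; ring,
      zpow_add₀ (by norm_num), zpow_neg, zpow_natCast, ← inv_pow, inv_neg_one]
    norm_num
    congr 1
    ring

theorem tsum_quadTerm_shift {q : ℂ} (hq0 : q ≠ 0) (ε : ℂ) (k c : ℤ) (m : ℕ) :
    q ^ m * ∑' p, quadTerm q ε k c p = ∑' p, quadTerm q ε k (c + m) p := by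
  rw [← tsum_mul_left]
  refine tsum_congr fun p => ?_
  rw [quadTerm, quadTerm, ← zpow_natCast q m, mul_left_comm, ← zpow_add₀ hq0]
  congr 2
  ring

theorem tsum_sigmaHeckeTerm_eq_fBar {q : ℂ} (hq0 : q ≠ 0) (hq : ‖q‖ < 1) :
    ∑' n : ℕ, sigmaHeckeTerm q n =
      fBarHecke 1 2 1 (-q ^ 4) (-q ^ 4) (q ^ 4) -
        q ^ 5 * fBarHecke 1 2 1 (-q ^ 10) (-q ^ 10) (q ^ 4) := by
  have h := (hasSum_altSqSum hq0 hq (ε := 1) (by simp)).tsum_eq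
  simp only [one_pow, one_mul, ← sigmaHeckeTerm_eq hq0] at h
  rw [h, fBarHecke, fBarHecke, (hasSum_fBarTerm_neg_pow hq0 hq (by norm_num) (by norm_num)).tsum_eq,
    (hasSum_fBarTerm_neg_pow hq0 hq (by norm_num) (by norm_num)).tsum_eq, mul_add,
    tsum_quadTerm_shift hq0, tsum_quadTerm_shift hq0]
  norm_num
  ring

theorem tsum_nu3HeckeTerm_eq_f {q : ℂ} (hq0 : q ≠ 0) (hq : ‖q‖ < 1) :
    ∑' n : ℕ, nu3HeckeTerm q n =
      fHecke 1 2 1 (q ^ 4) (q ^ 4) (q ^ 4) +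
        q ^ 5 * fHecke 1 2 1 (q ^ 10) (q ^ 10) (q ^ 4) := by
  have h := (hasSum_altSqSum hq0 hq (ε := -1) (by simp)).tsum_eq
  have e : ∀ n : ℕ, (-1 : ℂ) ^ n * ((-1) ^ n * (1 - q ^ (2 * n + 1)) *
      (q ^ (3 * n ^ 2 + 2 * n) * altSqSum q n)) = nu3HeckeTerm q n := fun n => by
    rw [nu3HeckeTerm_eq]
    linear_combination ((1 - q ^ (2 * n + 1)) * (q ^ (3 * n ^ 2 + 2 * n) * altSqSum q n)) *
      neg_one_pow_mul_self n
  simp only [e] at h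
  rw [h, fHecke, fHecke, (hasSum_fTerm_pow hq0 hq (by norm_num) (by norm_num)).tsum_eq,
    (hasSum_fTerm_pow hq0 hq (by norm_num) (by norm_num)).tsum_eq, mul_add, mul_neg,
    tsum_quadTerm_shift hq0, tsum_quadTerm_shift hq0]
  norm_num
  ring

/-! ### The double series in a square root of the base -/

theorem sum_antidiagonal_two_mul {M : Type*} [AddCommMonoid M] (m : ℕ) (u : ℤ → M) :
    ∑ p ∈ antidiagonal (2 * m), u p.1 = ∑ j ∈ Icc (-(m : ℤ)) m, u (m + j) := by
  refine sum_bij' (fun p _ => (p.1 : ℤ) - m) (fun j _ => ((m + j).toNat, (m - j).toNat))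
    ?_ ?_ ?_ ?_ ?_
  · intro p hp
    rw [mem_antidiagonal_nat] at hp
    rw [mem_Icc]
    omega
  · intro j hj
    rw [mem_Icc] at hj
    rw [mem_antidiagonal_nat]
    dsimp only
    omega
  · rintro ⟨a, b⟩ hp
    rw [mem_antidiagonal_nat] at hp
    dsimp only at hp
    ext <;> dsimp only <;> omega
  · intro j hj
    rw [mem_Icc] at hj
    dsimp only
    omega
  · intro p _
    congr 1
    ring

/-- The summand `(-1)^r t^{r^2+4rs+s^2+k(r+s)+c}`. -/
noncomputable def rootTerm (t : ℂ) (k c : ℕ) (p : ℕ × ℕ) : ℂ :=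
  (-1) ^ p.1 * t ^ (p.1 ^ 2 + 4 * p.1 * p.2 + p.2 ^ 2 + k * (p.1 + p.2) + c)

theorem summable_rootTerm {t : ℂ} (ht : ‖t‖ < 1) {k : ℕ} (hk : 1 ≤ k) (c : ℕ) :
    Summable (rootTerm t k c) := by
  refine .of_norm_bounded (summable_norm_pow_add (norm_nonneg t) ht) fun p => ?_
  rw [rootTerm, norm_mul, norm_pow, norm_neg, norm_one, one_pow, one_mul, norm_pow]
  refine pow_le_pow_of_le_one (norm_nonneg _) ht.le ?_
  nlinarith [Nat.mul_le_mul_right (p.1 + p.2) hk, Nat.zero_le (p.1 * p.2)]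

/-- Pairs with `r + s` odd cancel under the exchange of `r` and `s`; only even powers of `t`
remain. -/
theorem hasSum_rootTerm {t : ℂ} (ht0 : t ≠ 0) (ht : ‖t‖ < 1) {k : ℕ} (hk : 1 ≤ k) (c : ℕ) :
    HasSum (fun m : ℕ => (-1) ^ m * ((t ^ 2) ^ (3 * m ^ 2 + k * m + c) * altSqSum (t ^ 2) m))
      (∑' p, rootTerm t k (2 * c) p) := by
  have h := hasSum_antidiagonal (summable_rootTerm ht hk (2 * c)).hasSum
  have hodd : ∀ m, ∑ p ∈ antidiagonal (2 * m + 1), rootTerm t k (2 * c) p = 0 := by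
    intro m
    have e : ∑ p ∈ antidiagonal (2 * m + 1), rootTerm t k (2 * c) p =
        -∑ p ∈ antidiagonal (2 * m + 1), rootTerm t k (2 * c) p := by
      conv_lhs => rw [← Finset.Nat.sum_antidiagonal_swap]
      rw [← sum_neg_distrib]
      refine sum_congr rfl fun p hp => ?_
      rw [mem_antidiagonal_nat] at hp
      have e1 : (-1 : ℂ) ^ p.1 * (-1) ^ p.2 = -1 := by
        rw [← pow_add, hp]
        exact Odd.neg_one_pow ⟨m, rfl⟩
      have e2 := neg_one_pow_mul_self p.1
      simp only [rootTerm, Prod.fst_swap, Prod.snd_swap]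
      rw [show p.2 ^ 2 + 4 * p.2 * p.1 + p.1 ^ 2 + k * (p.2 + p.1) + 2 * c =
        p.1 ^ 2 + 4 * p.1 * p.2 + p.2 ^ 2 + k * (p.1 + p.2) + 2 * c by ring]
      linear_combination (-(-1) ^ p.2 * t ^ (p.1 ^ 2 + 4 * p.1 * p.2 + p.2 ^ 2 +
        k * (p.1 + p.2) + 2 * c)) * e2 + ((-1) ^ p.1 * t ^ (p.1 ^ 2 + 4 * p.1 * p.2 + p.2 ^ 2 +
        k * (p.1 + p.2) + 2 * c)) * e1
    have h2 : (2 : ℂ) * ∑ p ∈ antidiagonal (2 * m + 1), rootTerm t k (2 * c) p = 0 := by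
      linear_combination e
    simpa using h2
  have heven : ∀ m, ∑ p ∈ antidiagonal (2 * m), rootTerm t k (2 * c) p =
      (-1) ^ m * ((t ^ 2) ^ (3 * m ^ 2 + k * m + c) * altSqSum (t ^ 2) m) := by
    intro m
    have e : ∀ p ∈ antidiagonal (2 * m), rootTerm t k (2 * c) p = (-1) ^ m *
        ((t ^ 2) ^ (3 * m ^ 2 + k * m + c) * ((-1) ^ ((p.1 : ℤ) - m) *
          (t ^ 2) ^ (-((p.1 : ℤ) - m) ^ 2))) := by
      intro p hp
      rw [mem_antidiagonal_nat] at hp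
      rw [rootTerm, neg_one_zpow_sub, pow_add (-1 : ℂ), ← zpow_natCast t 2, ← zpow_mul,
        ← zpow_natCast _ (3 * m ^ 2 + k * m + c), ← zpow_mul]
      have e1 : t ^ (p.1 ^ 2 + 4 * p.1 * p.2 + p.2 ^ 2 + k * (p.1 + p.2) + 2 * c) =
          t ^ (((2 : ℕ) : ℤ) * ((3 * m ^ 2 + k * m + c : ℕ) : ℤ)) *
            t ^ (((2 : ℕ) : ℤ) * -((p.1 : ℤ) - m) ^ 2) := by
        rw [← zpow_add₀ ht0, ← zpow_natCast]
        congr 1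
        have hp' : (p.2 : ℤ) = 2 * m - p.1 := by omega
        push_cast
        rw [hp']
        ring
      rw [e1]
      linear_combination (-(-1) ^ p.1 * (t ^ (((2 : ℕ) : ℤ) * ((3 * m ^ 2 + k * m + c : ℕ) : ℤ)) *
            t ^ (((2 : ℕ) : ℤ) * -((p.1 : ℤ) - m) ^ 2))) * neg_one_pow_mul_self m
    rw [sum_congr rfl e, ← mul_sum, ← mul_sum, sum_antidiagonal_two_mul m fun r : ℤ =>
      (-1) ^ (r - m) * (t ^ 2) ^ (-(r - m) ^ 2), altSqSum]
    simp
  have hi : Function.Injective fun m : ℕ => 2 * m := mul_right_injective₀ two_ne_zero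
  refine ((hi.hasSum_iff ?_).2 h).congr_fun fun m => (heven m).symm
  intro n hn
  rcases Nat.even_or_odd' n with ⟨m, rfl | rfl⟩
  · exact absurd ⟨m, rfl⟩ hn
  · exact hodd m

theorem fBarTerm_root {t : ℂ} (ht0 : t ≠ 0) (p : ℤ × ℤ) (h : sg p.1 = sg p.2) :
    fBarTerm 1 2 1 (t ^ 3) (-t ^ 3) (t ^ 2) p =
      (-1) ^ p.1 * t ^ (p.1 ^ 2 + 4 * p.1 * p.2 + p.2 ^ 2 + 2 * (p.1 + p.2)) := by
  have h0 : (-1 : ℂ) ≠ 0 := by norm_num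
  have e2 : ∀ r : ℤ, (-1 : ℂ) ^ r * (-1) ^ r = 1 := fun r => by rw [← mul_zpow]; simp
  have e3 : p.1 ^ 2 + 4 * p.1 * p.2 + p.2 ^ 2 + 2 * (p.1 + p.2) = (3 : ℕ) * p.1 + (3 : ℕ) * p.2 +
      (2 : ℕ) * (1 * binom2 p.1 + 2 * p.1 * p.2 + 1 * binom2 p.2) := by
    push_cast
    linear_combination -two_mul_binom2 p.1 - two_mul_binom2 p.2
  rw [fBarTerm, if_pos h, ← neg_one_mul (t ^ 3), mul_zpow, zpow_add₀ h0, e3, zpow_add₀ ht0,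
    zpow_add₀ ht0, zpow_mul, zpow_mul, zpow_mul, zpow_natCast, zpow_natCast]
  linear_combination ((-1) ^ p.1 * (t ^ 3) ^ p.1 * (t ^ 3) ^ p.2 *
      (t ^ 2) ^ (1 * binom2 p.1 + 2 * p.1 * p.2 + 1 * binom2 p.2)) * e2 p.2

theorem hasSum_fBarTerm_root {t : ℂ} (ht0 : t ≠ 0) (ht : ‖t‖ < 1) :
    HasSum (fBarTerm 1 2 1 (t ^ 3) (-t ^ 3) (t ^ 2)) (∑' n : ℕ, sigmaHeckeTerm (t ^ 2) n) := by
  have h1 := hasSum_rootTerm ht0 ht (k := 2) (by norm_num) 0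
  have h2 := hasSum_rootTerm ht0 ht (k := 4) (by norm_num) 1
  have e : ∑' n : ℕ, sigmaHeckeTerm (t ^ 2) n =
      ∑' p, rootTerm t 2 (2 * 0) p + -∑' p, rootTerm t 4 (2 * 1) p := by
    rw [← (h1.add h2.neg).tsum_eq]
    refine tsum_congr fun n => ?_
    rw [sigmaHeckeTerm_eq (pow_ne_zero 2 ht0)]
    ring
  rw [e]
  refine hasSum_of_sg_eq (fun p => fBarTerm_of_sg_ne _ _ _ _ _ _)
    ((summable_rootTerm ht (by norm_num) _).hasSum.congr_fun fun p => ?_)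
    ((summable_rootTerm ht (by norm_num) _).hasSum.neg.congr_fun fun p => ?_)
  · rw [fBarTerm_root ht0 _ (by simp [sg_natCast]), rootTerm, zpow_natCast, ← zpow_natCast t]
    push_cast
    congr 2
  · rw [fBarTerm_root ht0 _ (by simp [sg_neg]), rootTerm, zpow_sub₀ (by norm_num), zpow_natCast,
      ← zpow_natCast t, div_eq_mul_inv, ← inv_pow, inv_neg_one]
    norm_num
    congr 1
    ring

/-! ### A partial theta expansion of the third order function -/

theorem summable_of_norm_le_pow {Q : ℂ} (hQ : ‖Q‖ < 1) {f : ℕ → ℂ} {C : ℝ}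
    (h : ∀ n, ‖f n‖ ≤ C * ‖Q‖ ^ n) : Summable f :=
  .of_norm_bounded ((summable_geometric_of_lt_one (norm_nonneg Q) hQ).mul_left C) h

theorem norm_tsum_le_of_norm_le_pow {Q : ℂ} (hQ : ‖Q‖ < 1) {f : ℕ → ℂ} {C : ℝ}
    (h : ∀ n, ‖f n‖ ≤ C * ‖Q‖ ^ n) : ‖∑' n, f n‖ ≤ C * (1 - ‖Q‖)⁻¹ :=
  tsum_of_norm_bounded ((hasSum_geometric_of_lt_one (norm_nonneg Q) hQ).mul_left C) h

/-- A telescoping series. -/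
theorem tsum_sub_succ {f v : ℕ → ℂ} {a : ℂ} (hf : Summable f) (h : ∀ n, f n = v (n + 1) - v n)
    (hv : Tendsto v atTop (𝓝 a)) : ∑' n, f n = a - v 0 := by
  refine tendsto_nhds_unique hf.hasSum.tendsto_sum_nat ((hv.sub_const (v 0)).congr fun n => ?_)
  simp only [h, sum_range_sub]

theorem tendsto_qPochInf_mul_pow {x Q : ℂ} (hx : ‖x‖ < 1) (hQ : ‖Q‖ < 1) :
    Tendsto (fun n : ℕ => qPochInf (x * Q ^ n) Q) atTop (𝓝 1) := by
  have hne := one_sub_mul_pow_ne_zero hx hQ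
  have h0 := qPochInf_ne_zero hQ hne
  have h := (tendsto_const_nhds (x := qPochInf x Q)).div (tendsto_qPoch x hQ) h0
  rw [div_self h0] at h
  refine h.congr fun n => ?_
  rw [Pi.div_apply, div_eq_iff (qPoch_ne_zero hne n), mul_comm]
  exact qPochInf_eq_qPoch_mul x hQ n

theorem le_choose_two_succ (m : ℕ) : m ≤ (m + 1).choose 2 := by
  rw [choose_two_succ]; omega

theorem norm_pow_choose_two_le {Q : ℂ} (hQ : ‖Q‖ < 1) (m e : ℕ) :
    ‖Q ^ ((m + 1).choose 2 + e)‖ ≤ 1 * ‖Q‖ ^ m := by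
  rw [norm_pow, one_mul]
  exact pow_le_pow_of_le_one (norm_nonneg _) hQ.le
    ((le_choose_two_succ m).trans (Nat.le_add_right _ _))

/-- The identity that relates `ν` to `ω`. The difference of the two sides, multiplied by `(-b)_∞`
and regarded as the value at `k = 0` of
`E k = b ∑ Q^n (-b Q^{n+k+1})_∞ / (b)_{n+1} - (b)_∞⁻¹ ∑ Q^{m(m+1)/2+km} +
  ∑ Q^{m(m+1)/2+km} (-b Q^{m+k+1})_∞`,
satisfies `E k = Q^{k+1} E (k+1)`, and so vanishes. -/
theorem tsum_pow_div_qPoch_mul_qPoch {b Q : ℂ} (hb : ‖b‖ < 1) (hQ : ‖Q‖ < 1) :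
    b * ∑' n : ℕ, Q ^ n / (qPoch b Q (n + 1) * qPoch (-b) Q (n + 1)) =
      (∑' m : ℕ, Q ^ (m + 1).choose 2) / (qPochInf b Q * qPochInf (-b) Q) -
        ∑' m : ℕ, Q ^ (m + 1).choose 2 / qPoch (-b) Q (m + 1) := by
  have hb' : ‖-b‖ < 1 := by simpa
  have hbQ : ‖-b * Q‖ < 1 := by
    rw [norm_mul]; exact mul_lt_one_of_nonneg_of_lt_one_left (norm_nonneg _) hb' hQ.le
  have hne := one_sub_mul_pow_ne_zero hb hQ
  have hne' := one_sub_mul_pow_ne_zero hb' hQ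
  obtain ⟨CD, hCD, hD⟩ := exists_norm_inv_qPoch_le hQ hne
  set D : ℕ → ℂ := fun n => (qPoch b Q n)⁻¹ with hDdef
  set W : ℕ → ℂ := fun m => qPochInf (-b * Q * Q ^ m) Q with hWdef
  set CW : ℝ := Real.exp (1 / (1 - ‖Q‖))
  have hW : ∀ m, ‖W m‖ ≤ CW := fun m => by
    refine norm_qPochInf_le_of_le ?_ hQ
    rw [norm_mul, norm_pow]
    exact mul_le_one₀ hbQ.le (by positivity) (pow_le_one₀ (norm_nonneg _) hQ.le)
  have hCW : 0 < CW := Real.exp_pos _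
  have hWs : ∀ m, W m = (1 + b * Q * Q ^ m) * W (m + 1) := fun m => by
    simp only [hWdef]
    rw [qPochInf_eq_one_sub_mul _ hQ, pow_succ]
    ring_nf
  have hDs : ∀ n, D n = (1 - b * Q ^ n) * D (n + 1) := fun n => by
    simp only [hDdef]
    rw [qPoch_succ, mul_inv_rev, mul_inv_cancel_left₀ (hne n)]
  set y : ℕ → ℂ := fun k => ∑' n : ℕ, Q ^ n * (W (n + k) * D (n + 1)) with hy
  set th : ℕ → ℂ := fun k => ∑' m : ℕ, Q ^ ((m + 1).choose 2 + k * m) with hth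
  set R : ℕ → ℂ := fun k => ∑' m : ℕ, Q ^ ((m + 1).choose 2 + k * m) * W (m + k) with hR
  have by' : ∀ k n, ‖Q ^ n * (W (n + k) * D (n + 1))‖ ≤ CW * CD * ‖Q‖ ^ n := fun k n => by
    rw [norm_mul, norm_mul, norm_pow, mul_comm]
    gcongr
    · exact hW _
    · exact hD _
  have bth : ∀ k m, ‖Q ^ ((m + 1).choose 2 + k * m)‖ ≤ 1 * ‖Q‖ ^ m := fun k m =>
    norm_pow_choose_two_le hQ m _
  have bR : ∀ k m, ‖Q ^ ((m + 1).choose 2 + k * m) * W (m + k)‖ ≤ CW * ‖Q‖ ^ m := fun k m => by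
    rw [norm_mul, mul_comm]
    gcongr
    · exact hW _
    · simpa using bth k m
  have ry : ∀ k, b * y k - b * Q ^ (k + 1) * y (k + 1) = (qPochInf b Q)⁻¹ - W k := by
    intro k
    have hv : Tendsto (fun n => W (n + k) * D n) atTop (𝓝 (qPochInf b Q)⁻¹) := by
      have h1 := (tendsto_qPochInf_mul_pow hbQ hQ).comp (tendsto_add_atTop_nat k)
      have h2 := (tendsto_qPoch b hQ).inv₀ (qPochInf_ne_zero hQ hne)
      have h3 := h1.mul h2
      rw [one_mul] at h3
      exact h3
    have s1 := summable_of_norm_le_pow hQ (by' k)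
    have s2 := summable_of_norm_le_pow hQ (by' (k + 1))
    have h := tsum_sub_succ ((s1.mul_left b).sub (s2.mul_left (b * Q ^ (k + 1)))) (fun n => ?_) hv
    · rw [(s1.mul_left b).tsum_sub (s2.mul_left (b * Q ^ (k + 1))), tsum_mul_left,
        tsum_mul_left] at h
      simp only [hy]
      rw [h]
      simp [hDdef]
    -- the summand is the difference of consecutive values of `(-b Q^{n+k+1})_∞ / (b)_n`
    · have e1 := hWs (n + k)
      have e2 := hDs n
      rw [e2, show n + (k + 1) = n + k + 1 by ring, show n + 1 + k = n + k + 1 by ring]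
      linear_combination (D (n + 1)) * e1
  have rth : ∀ k, th k = 1 + Q ^ (k + 1) * th (k + 1) := by
    intro k
    simp only [hth]
    rw [(summable_of_norm_le_pow hQ (bth k)).tsum_eq_zero_add, ← tsum_mul_left]
    congr 1
    refine tsum_congr fun m => ?_
    rw [← pow_add, choose_two_succ (m + 1)]
    congr 1
    ring
  have rR : ∀ k, R k = W k + Q ^ (k + 1) * R (k + 1) := by
    intro k
    simp only [hR]
    rw [(summable_of_norm_le_pow hQ (bR k)).tsum_eq_zero_add, ← tsum_mul_left]
    congr 1
    · simp
    · refine tsum_congr fun m => ?_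
      rw [← mul_assoc, ← pow_add, choose_two_succ (m + 1), show m + 1 + k = m + (k + 1) by ring]
      congr 2
      ring
  set E : ℕ → ℂ := fun k => b * y k - th k * (qPochInf b Q)⁻¹ + R k with hE
  have rE : ∀ k, E k = Q ^ (k + 1) * E (k + 1) := fun k => by
    simp only [hE]
    linear_combination ry k - (qPochInf b Q)⁻¹ * rth k + rR k
  obtain ⟨B, hB⟩ : ∃ B : ℝ, ∀ k, ‖E k‖ ≤ B := by
    refine ⟨‖b‖ * (CW * CD * (1 - ‖Q‖)⁻¹) + 1 * (1 - ‖Q‖)⁻¹ * ‖(qPochInf b Q)⁻¹‖ +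
      CW * (1 - ‖Q‖)⁻¹, fun k => ?_⟩
    refine (norm_add_le _ _).trans (add_le_add ((norm_sub_le _ _).trans (add_le_add ?_ ?_)) ?_)
    · rw [norm_mul]
      exact mul_le_mul_of_nonneg_left (norm_tsum_le_of_norm_le_pow hQ (by' k)) (norm_nonneg _)
    · rw [norm_mul]
      exact mul_le_mul_of_nonneg_right (norm_tsum_le_of_norm_le_pow hQ (bth k)) (norm_nonneg _)
    · exact norm_tsum_le_of_norm_le_pow hQ (bR k)
  have hE0 : ∀ k, ‖E 0‖ ≤ ‖Q‖ ^ k * ‖E k‖ := by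
    intro k
    induction k with
    | zero => simp
    | succ k ih =>
      refine ih.trans ?_
      rw [rE k, norm_mul, norm_pow, ← mul_assoc, ← pow_add]
      refine mul_le_mul_of_nonneg_right ?_ (norm_nonneg _)
      exact pow_le_pow_of_le_one (norm_nonneg _) hQ.le (by omega)
  -- iteration gives `‖E 0‖ ≤ ‖Q‖ ^ k * ‖E k‖`, and `E` is bounded
  have hz : E 0 = 0 := by
    have h1 : Tendsto (fun k : ℕ => ‖Q‖ ^ k * B) atTop (𝓝 0) := by
      simpa using (tendsto_pow_atTop_nhds_zero_of_lt_one (norm_nonneg Q) hQ).mul_const B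
    have h2 := ge_of_tendsto' h1 fun k =>
      (hE0 k).trans (mul_le_mul_of_nonneg_left (hB k) (by positivity))
    exact norm_le_zero_iff.1 h2
  -- division by `(-b)_∞` turns `(-b Q^{n+1})_∞` into `1 / (-b)_{n+1}`
  have hWn : ∀ n, W n * (qPochInf (-b) Q)⁻¹ = (qPoch (-b) Q (n + 1))⁻¹ := fun n => by
    have h1 := qPochInf_eq_qPoch_mul (-b) hQ (n + 1)
    have h2 := qPochInf_ne_zero hQ hne'
    have h3 := qPoch_ne_zero hne' (n + 1)
    rw [mul_inv_eq_iff_eq_mul₀ h2, h1, inv_mul_cancel_left₀ h3]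
    simp only [hWdef]
    congr 1
    ring
  have e1 : y 0 * (qPochInf (-b) Q)⁻¹ =
      ∑' n : ℕ, Q ^ n / (qPoch b Q (n + 1) * qPoch (-b) Q (n + 1)) := by
    simp only [hy]
    rw [← tsum_mul_right]
    refine tsum_congr fun n => ?_
    rw [div_eq_mul_inv, mul_inv, ← hWn]
    simp only [hDdef, add_zero]
    ring
  have e2 : R 0 * (qPochInf (-b) Q)⁻¹ =
      ∑' m : ℕ, Q ^ (m + 1).choose 2 / qPoch (-b) Q (m + 1) := by
    simp only [hR]
    rw [← tsum_mul_right]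
    refine tsum_congr fun n => ?_
    rw [div_eq_mul_inv, ← hWn]
    simp only [add_zero, zero_mul]
    ring
  have e3 : th 0 = ∑' m : ℕ, Q ^ (m + 1).choose 2 := by simp [hth]
  rw [← e1, ← e2, ← e3, div_eq_mul_inv, mul_inv]
  simp only [hE] at hz
  linear_combination (qPochInf (-b) Q)⁻¹ * hz

/-! ### From a geometric to a theta-like series -/

/-- Summing `t^{n+1} / (cQ)_{n+1} = t · t^n / (cQ)_n + c t Q · (tQ)^n / (cQ)_{n+1}` over `n`. -/
theorem tsum_pow_div_qPoch_recurrence {c t Q : ℂ} (hc : ‖c‖ < 1) (ht : ‖t‖ < 1) (hQ : ‖Q‖ < 1) :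
    (1 - c) * (1 - t) * ∑' n : ℕ, t ^ n / qPoch c Q (n + 1) =
      1 + c * t * Q * ∑' n : ℕ, (t * Q) ^ n / qPoch (c * Q) Q (n + 1) := by
  have hcQ : ‖c * Q‖ < 1 := by
    rw [norm_mul]; exact mul_lt_one_of_nonneg_of_lt_one_left (norm_nonneg _) hc hQ.le
  have hne := one_sub_mul_pow_ne_zero hcQ hQ
  obtain ⟨C, hC, hD⟩ := exists_norm_inv_qPoch_le hQ hne
  have hc0 := one_sub_ne_zero_of_norm_lt_one hc
  have e1 : ∀ n : ℕ, t ^ n / qPoch c Q (n + 1) = (1 - c)⁻¹ * (t ^ n * (qPoch (c * Q) Q n)⁻¹) :=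
    fun n => by rw [qPoch_succ', div_eq_mul_inv, mul_inv]; ring
  have hs : Summable fun n : ℕ => t ^ n * (qPoch (c * Q) Q n)⁻¹ :=
    summable_of_norm_le_pow ht (C := C) fun n => by
      rw [norm_mul, norm_pow, mul_comm]
      gcongr
      exact hD n
  have e2 : ∀ n : ℕ, t ^ (n + 1) * (qPoch (c * Q) Q (n + 1))⁻¹ =
      t * (t ^ n * (qPoch (c * Q) Q n)⁻¹) +
        c * t * Q * ((t * Q) ^ n / qPoch (c * Q) Q (n + 1)) := fun n => by
    have h1 := qPoch_ne_zero hne n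
    have h2 := hne n
    rw [qPoch_succ]
    generalize qPoch (c * Q) Q n = u at *
    generalize h5 : 1 - c * Q * Q ^ n = w at *
    field_simp
    rw [← h5]
    ring
  have hs2 : Summable fun n : ℕ => c * t * Q * ((t * Q) ^ n / qPoch (c * Q) Q (n + 1)) := by
    have := ((summable_nat_add_iff 1).2 hs).sub (hs.mul_left t)
    refine this.congr fun n => ?_
    rw [e2]
    ring
  have h := hs.tsum_eq_zero_add
  simp only [e2] at h
  rw [(hs.mul_left t).tsum_add hs2, tsum_mul_left, tsum_mul_left] at h
  simp only [e1]
  rw [tsum_mul_left]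
  simp only [pow_zero, qPoch_zero, inv_one, mul_one] at h
  generalize (∑' n : ℕ, t ^ n * (qPoch (c * Q) Q n)⁻¹) = S at *
  linear_combination h + (1 - t) * S * mul_inv_cancel₀ hc0

/-- Iterating the recurrence turns `∑ t^n / (c)_{n+1}` into
`∑ (ct)^n Q^{n^2} / ((c)_{n+1} (t)_{n+1})`. -/
theorem tsum_pow_div_qPoch {c t Q : ℂ} (hc : ‖c‖ < 1) (ht : ‖t‖ < 1) (hQ : ‖Q‖ < 1) :
    ∑' n : ℕ, t ^ n / qPoch c Q (n + 1) =
      ∑' n : ℕ, (c * t) ^ n * Q ^ (n ^ 2) / (qPoch c Q (n + 1) * qPoch t Q (n + 1)) := by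
  have hcn := one_sub_mul_pow_ne_zero hc hQ
  have htn := one_sub_mul_pow_ne_zero ht hQ
  obtain ⟨C1, hC1, hD1⟩ := exists_norm_inv_qPoch_le hQ hcn
  obtain ⟨C2, hC2, hD2⟩ := exists_norm_inv_qPoch_le hQ htn
  have hlt : ∀ {x : ℂ}, ‖x‖ < 1 → ∀ k : ℕ, ‖x * Q ^ k‖ < 1 := fun {x} hx k => by
    rw [norm_mul, norm_pow]
    exact mul_lt_one_of_nonneg_of_lt_one_left (norm_nonneg _) hx
      (pow_le_one₀ (norm_nonneg _) hQ.le)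
  set D : ℕ → ℂ := fun k => ∑' n : ℕ, (t * Q ^ k) ^ n / qPoch (c * Q ^ k) Q (n + 1) with hD
  set M : ℕ → ℂ := fun k => (c * t) ^ k * Q ^ (k ^ 2) / (qPoch c Q k * qPoch t Q k) with hM
  set T : ℕ → ℂ := fun k => (c * t) ^ k * Q ^ (k ^ 2) / (qPoch c Q (k + 1) * qPoch t Q (k + 1))
    with hT
  have hstep : ∀ k, M k * D k = T k + M (k + 1) * D (k + 1) := by
    intro k
    have h := tsum_pow_div_qPoch_recurrence (hlt hc k) (hlt ht k) hQ
    have e1 : ∑' n : ℕ, (t * Q ^ k * Q) ^ n / qPoch (c * Q ^ k * Q) Q (n + 1) = D (k + 1) := by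
      simp only [hD, pow_succ, mul_assoc]
    rw [e1] at h
    change (1 - c * Q ^ k) * (1 - t * Q ^ k) * D k = _ at h
    have h1 := qPoch_ne_zero hcn k
    have h2 := qPoch_ne_zero htn k
    have h3 := hcn k
    have h4 := htn k
    simp only [hM, hT, qPoch_succ]
    generalize D k = d at *
    generalize D (k + 1) = d' at *
    generalize qPoch c Q k = u at *
    generalize qPoch t Q k = w at *
    rw [show Q ^ ((k + 1) ^ 2) = Q ^ (k ^ 2) * (Q ^ k * Q ^ k * Q) by ring, pow_succ (c * t)]
    generalize h5 : 1 - c * Q ^ k = a at *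
    generalize h6 : 1 - t * Q ^ k = a' at *
    field_simp
    linear_combination (c * t) ^ k * Q ^ (k ^ 2) * h
  have hfin : ∀ K, M 0 * D 0 = ∑ k ∈ range K, T k + M K * D K := by
    intro K
    induction K with
    | zero => simp
    | succ K ih => rw [ih, sum_range_succ, hstep]; ring
  have hct : ‖c * t‖ < 1 := by
    rw [norm_mul]; exact mul_lt_one_of_nonneg_of_lt_one_left (norm_nonneg _) hc ht.le
  have hnum : ∀ k : ℕ, ‖(c * t) ^ k * Q ^ (k ^ 2)‖ ≤ ‖c * t‖ ^ k := fun k => by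
    rw [norm_mul, norm_pow, norm_pow]
    exact mul_le_of_le_one_right (by positivity) (pow_le_one₀ (norm_nonneg _) hQ.le)
  have hTs : Summable T := by
    refine summable_of_norm_le_pow hct (C := C1 * C2) fun k => ?_
    simp only [hT]
    rw [div_eq_mul_inv, mul_inv, norm_mul, mul_comm]
    exact mul_le_mul ((norm_mul _ _).trans_le (mul_le_mul (hD1 _) (hD2 _) (norm_nonneg _) hC1.le))
      (hnum k) (norm_nonneg _) (by positivity)
  have hMt : Tendsto M atTop (𝓝 0) := by
    refine squeeze_zero_norm (a := fun k => C1 * C2 * ‖c * t‖ ^ k) (fun k => ?_) ?_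
    · simp only [hM]
      rw [div_eq_mul_inv, mul_inv, norm_mul, mul_comm]
      exact mul_le_mul ((norm_mul _ _).trans_le (mul_le_mul (hD1 _) (hD2 _) (norm_nonneg _) hC1.le))
        (hnum k) (norm_nonneg _) (by positivity)
    · simpa using (tendsto_pow_atTop_nhds_zero_of_lt_one (norm_nonneg _) hct).const_mul (C1 * C2)
  -- `(c Q^k)_{n+1}⁻¹ = (c)_k (c)_{k+n+1}⁻¹` is bounded uniformly in `k` and `n`
  obtain ⟨B, hB⟩ : ∃ B : ℝ, ∀ k, ‖D k‖ ≤ B := by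
    refine ⟨Real.exp (‖c‖ / (1 - ‖Q‖)) * C1 * (1 - ‖t‖)⁻¹, fun k => ?_⟩
    refine norm_tsum_le_of_norm_le_pow ht fun n => ?_
    have e : (qPoch (c * Q ^ k) Q (n + 1))⁻¹ = qPoch c Q k * (qPoch c Q (k + (n + 1)))⁻¹ := by
      rw [qPoch_add c Q k, mul_inv, mul_inv_cancel_left₀ (qPoch_ne_zero hcn k)]
    rw [div_eq_mul_inv, e, norm_mul, norm_mul, mul_comm, norm_pow, norm_mul]
    gcongr
    · exact norm_qPoch_le c hQ k
    · exact hD1 _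
    · rw [norm_pow]
      exact mul_le_of_le_one_right (norm_nonneg _) (pow_le_one₀ (norm_nonneg _) hQ.le)
  have hMD : Tendsto (fun k => M k * D k) atTop (𝓝 0) := by
    refine squeeze_zero_norm (a := fun k => ‖M k‖ * B) (fun k => ?_) ?_
    · rw [norm_mul]
      exact mul_le_mul_of_nonneg_left (hB k) (norm_nonneg _)
    · simpa using hMt.norm.mul_const B
  have hlim := hTs.hasSum.tendsto_sum_nat.add hMD
  rw [add_zero] at hlim
  have := tendsto_nhds_unique tendsto_const_nhds (hlim.congr fun K => (hfin K).symm)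
  rw [← this]
  simp [hM, hD]

/-! ### The third order function `ω` as a series with theta numerators -/

theorem exists_norm_inv_one_sub_pow_le {p : ℂ} (hp : ‖p‖ < 1) :
    ∃ C : ℝ, 0 < C ∧ ∀ n : ℕ, ‖(1 - p ^ (2 * n + 1))⁻¹‖ ≤ C := by
  have h : 0 < 1 - ‖p‖ := by linarith
  refine ⟨(1 - ‖p‖)⁻¹, inv_pos.2 h, fun n => ?_⟩
  rw [norm_inv]
  refine inv_anti₀ h ?_
  have h1 := norm_sub_norm_le (1 : ℂ) (p ^ (2 * n + 1))
  have h2 : ‖p ^ (2 * n + 1)‖ ≤ ‖p‖ := by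
    rw [norm_pow]
    exact pow_le_of_le_one (norm_nonneg _) hp.le (by omega)
  rw [norm_one] at h1
  linarith

/-- The Bailey pair for `b = c = p` in the base `p^2`. As `bc` is the base, the inverse has a single
term (`baileyInv_of_mul_eq`), and the free parameter is `z = 0`. -/
theorem tsum_omega {p : ℂ} (hp : ‖p‖ < 1) :
    ∑' n : ℕ, p ^ n / qPoch p (p ^ 2) (n + 1) =
      (∑' n : ℕ, (-1) ^ n * p ^ (3 * (n * (n + 1))) * (1 + p ^ (2 * n + 1)) /
        (1 - p ^ (2 * n + 1))) / qPochInf (p ^ 2) (p ^ 2) := by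
  have hp2 := norm_sq_lt_one hp
  have h1 := one_sub_mul_pow_ne_zero hp2 hp2
  have hpp : ‖p * p ^ 2‖ < 1 := by
    rw [norm_mul]; exact mul_lt_one_of_nonneg_of_lt_one_left (norm_nonneg _) hp hp2.le
  have hb := one_sub_mul_pow_ne_zero hpp hp2
  have hpk := one_sub_mul_pow_ne_zero hp hp2
  have hp1 := one_sub_ne_zero_of_norm_lt_one hp
  set β : ℕ → ℂ := fun j => (qPoch (p * p ^ 2) (p ^ 2) j * qPoch (p * p ^ 2) (p ^ 2) j)⁻¹ with hβ
  set A : ℕ → ℂ := fun n => (1 - (p ^ 2) ^ (2 * n + 1)) * baileyInv (p ^ 2) β n with hA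
  have hpair : IsBaileyPair (p ^ 2) A β := isBaileyPair_baileyInv h1 β
  have hL := fun n => baileyInv_of_mul_eq h1 hb hb (β := β) (fun _ => rfl) (sq p).symm n
  have hpn : ∀ n : ℕ, p * (p ^ 2) ^ n = p ^ (2 * n + 1) := fun n => by ring
  have hpk' : ∀ n : ℕ, 1 - p ^ (2 * n + 1) ≠ 0 := fun n => by rw [← hpn]; exact hpk n
  have hAe : ∀ n, A n = (1 - p) ^ 2 * ((-1) ^ n * (p ^ 2) ^ (n + 1).choose 2 *
      (1 + p ^ (2 * n + 1)) * (1 - p ^ (2 * n + 1))⁻¹) := fun n => by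
    have h2 := hpk' n
    have h3 := hL n
    rw [hpn] at h3
    simp only [hA]
    rw [show (p ^ 2) ^ (2 * n + 1) = p ^ (2 * n + 1) * p ^ (2 * n + 1) by ring]
    generalize p ^ (2 * n + 1) = y at *
    generalize baileyInv (p ^ 2) β n = L at *
    have h4 : L = (-1) ^ n * (p ^ 2) ^ (n + 1).choose 2 * (1 - p) * (1 - p) *
        ((1 - y)⁻¹ * (1 - y)⁻¹) := by
      rw [← h3]
      field_simp
    rw [h4]
    field_simp
    ring
  obtain ⟨C, hC, hD⟩ := exists_norm_inv_qPoch_le hp2 hb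
  have bβ : ∀ n, ‖β n‖ ≤ C * C * 1 ^ n := fun n => by
    simp only [hβ, mul_inv]
    rw [norm_mul, one_pow, mul_one]
    exact mul_le_mul (hD n) (hD n) (norm_nonneg _) hC.le
  obtain ⟨C', hC', hD'⟩ := exists_norm_inv_one_sub_pow_le hp
  have bA : ∀ n, ‖A n‖ ≤ ‖(1 - p) ^ 2‖ * (2 * C') * 1 ^ n := fun n => by
    rw [hAe, norm_mul, one_pow, mul_one]
    refine mul_le_mul_of_nonneg_left ?_ (norm_nonneg _)
    rw [norm_mul]
    refine mul_le_mul ?_ (hD' n) (norm_nonneg _) zero_le_two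
    rw [norm_mul, norm_mul, norm_pow, norm_neg, norm_one, one_pow, one_mul, norm_pow]
    have h2 : ‖1 + p ^ (2 * n + 1)‖ ≤ 2 := by
      refine (norm_add_le _ _).trans ?_
      rw [norm_one, norm_pow]
      linarith [pow_le_one₀ (n := 2 * n + 1) (norm_nonneg p) hp.le]
    exact (mul_le_of_le_one_left (norm_nonneg _) (pow_le_one₀ (norm_nonneg _) hp2.le)).trans h2
  have h := hpair.tsum_eq hp2 0 zero_le_one bA zero_le_one bβ
  rw [tsum_pow_div_qPoch hp hp hp2]
  have e1 : ∀ n : ℕ, (p * p) ^ n * (p ^ 2) ^ n ^ 2 /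
      (qPoch p (p ^ 2) (n + 1) * qPoch p (p ^ 2) (n + 1)) =
      ((1 - p) ^ 2)⁻¹ * (baileyWeight (p ^ 2) 0 n * β n) := fun n => by
    rw [baileyWeight_zero, qPoch_succ', div_eq_mul_inv]
    simp only [hβ, mul_inv, sq (1 - p)]
    ring
  have e2 : ∀ n : ℕ, baileyWeight (p ^ 2) 0 n * A n * qPochInf (0 * (p ^ 2) ^ n) (p ^ 2) =
      (1 - p) ^ 2 * ((-1) ^ n * p ^ (3 * (n * (n + 1))) * (1 + p ^ (2 * n + 1)) /
        (1 - p ^ (2 * n + 1))) := fun n => by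
    have h4 : p ^ (3 * (n * (n + 1))) = (p ^ 2) ^ (n * (n + 1)) * (p ^ 2) ^ (n + 1).choose 2 := by
      rw [← pow_add, ← pow_mul]
      congr 1
      have := Nat.mul_div_cancel' (Nat.even_mul_pred_self (n + 1)).two_dvd
      rw [Nat.choose_two_right]
      generalize (n + 1) * (n + 1 - 1) / 2 = d at *
      rw [Nat.add_sub_cancel] at this
      linarith
    rw [zero_mul, qPochInf_zero, mul_one, baileyWeight_zero, hAe, h4]
    ring
  simp only [e1, e2] at h ⊢
  rw [tsum_mul_left, h, tsum_mul_left, mul_div_assoc, inv_mul_cancel_left₀ (pow_ne_zero 2 hp1)]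

/-! ### Passing to the limit in symmetric bilateral sums -/

/-- Tannery's theorem for bilateral sums truncated to `|n| ≤ N`, the pair `(i, l)` with
`i + l = 2N` standing for `n = i - N`. -/
theorem tendsto_sum_antidiagonal_two_mul {F : ℤ → ℂ} (hF : Summable fun n => ‖F n‖) {U V : ℕ → ℂ}
    {U' V' : ℂ} (hU : Tendsto U atTop (𝓝 U')) (hV : Tendsto V atTop (𝓝 V')) :
    Tendsto (fun N : ℕ => ∑ p ∈ antidiagonal (2 * N), F ((p.1 : ℤ) - N) * (U p.1 * V p.2)) atTop
      (𝓝 ((∑' n, F n) * (U' * V'))) := by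
  obtain ⟨B, hB⟩ := (Metric.isBounded_range_of_tendsto _ hU).exists_norm_le
  obtain ⟨B', hB'⟩ := (Metric.isBounded_range_of_tendsto _ hV).exists_norm_le
  have hB0 : 0 ≤ B := (norm_nonneg _).trans (hB _ ⟨0, rfl⟩)
  set g : ℕ → ℤ → ℂ := fun N n => if n ∈ Icc (-(N : ℤ)) N then
    F n * (U (N + n).toNat * V (N - n).toNat) else 0 with hg
  have e : ∀ N : ℕ, ∑ p ∈ antidiagonal (2 * N), F ((p.1 : ℤ) - N) * (U p.1 * V p.2) =
      ∑' n, g N n := by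
    intro N
    rw [tsum_eq_sum (s := Icc (-(N : ℤ)) N) fun n hn => if_neg hn]
    have := sum_antidiagonal_two_mul N fun r : ℤ =>
      F (r - N) * (U r.toNat * V (2 * N - r).toNat)
    refine (sum_congr rfl fun p hp => ?_).trans (this.trans (sum_congr rfl fun n hn => ?_))
    · rw [mem_antidiagonal_nat] at hp
      rw [Int.toNat_natCast, show (2 * (N : ℤ) - p.1).toNat = p.2 by omega]
    · simp only [if_pos hn]
      rw [add_sub_cancel_left, show 2 * (N : ℤ) - (N + n) = N - n by ring]
  have hlim := tendsto_tsum_of_dominated_convergence (𝓕 := atTop) (f := g)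
    (g := fun n => F n * (U' * V')) (hF.mul_right (B * B')) (fun n => ?_)
    (Eventually.of_forall fun N n => ?_)
  · rw [tsum_mul_right] at hlim
    exact hlim.congr fun N => (e N).symm
  · have t1 : Tendsto (fun N : ℕ => ((N : ℤ) + n).toNat) atTop atTop :=
      tendsto_atTop.2 fun b => (eventually_ge_atTop (b + n.natAbs)).mono fun N hN => by omega
    have t2 : Tendsto (fun N : ℕ => ((N : ℤ) - n).toNat) atTop atTop :=
      tendsto_atTop.2 fun b => (eventually_ge_atTop (b + n.natAbs)).mono fun N hN => by omega
    refine (((hU.comp t1).mul (hV.comp t2)).const_mul (F n)).congr' ?_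
    filter_upwards [eventually_ge_atTop n.natAbs] with N hN
    have h : n ∈ Icc (-(N : ℤ)) N := by
      rw [mem_Icc]; omega
    simp only [hg, if_pos h, Function.comp]
  · simp only [hg]
    split_ifs with h
    · rw [norm_mul, norm_mul]
      refine mul_le_mul_of_nonneg_left ?_ (norm_nonneg _)
      exact mul_le_mul (hB _ ⟨_, rfl⟩) (hB' _ ⟨_, rfl⟩) (norm_nonneg _) hB0
    · rw [norm_zero]
      exact mul_nonneg (norm_nonneg _)
        (mul_nonneg hB0 ((norm_nonneg _).trans (hB' _ ⟨0, rfl⟩)))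

theorem binom2_natCast (n : ℕ) : binom2 n = (n.choose 2 : ℕ) := by
  have h := two_mul_binom2 n
  have h' : 2 * n.choose 2 = n * (n - 1) := by
    rw [Nat.choose_two_right, Nat.mul_div_cancel' (Nat.even_mul_pred_self n).two_dvd]
  cases n with
  | zero => simp [binom2]
  | succ n =>
    rw [Nat.add_sub_cancel] at h'
    zify at h'
    push_cast at h
    push_cast
    linarith

theorem binom2_add_one (r : ℤ) : binom2 (r + 1) = binom2 r + r := by
  have h1 := two_mul_binom2 (r + 1)
  have h2 := two_mul_binom2 r
  linarith

theorem binom2_one_sub (r : ℤ) : binom2 (1 - r) = binom2 r := by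
  have h1 := two_mul_binom2 (1 - r)
  have h2 := two_mul_binom2 r
  linarith

theorem summable_norm_pow_choose_two {Q : ℂ} (hQ : ‖Q‖ < 1) (z : ℂ) :
    Summable fun n : ℕ => ‖Q ^ n.choose 2 * z ^ n‖ := by
  refine (summable_pow_mul_pow_choose_two (norm_nonneg Q) hQ (norm_nonneg z)).congr fun n => ?_
  rw [norm_mul, norm_pow, norm_pow, mul_comm]

/-- The negative indices `n = -m - 1` give a series of the same shape, with `Q^2 / z` for `z`. -/
theorem summable_norm_thetaTerm {Q : ℂ} (hQ0 : Q ≠ 0) (hQ : ‖Q‖ < 1) {z : ℂ} (hz : z ≠ 0) :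
    Summable fun n : ℤ => ‖Q ^ binom2 n * z ^ n‖ := by
  refine Summable.of_nat_of_neg_add_one ?_ ?_
  · refine (summable_norm_pow_choose_two hQ z).congr fun n => ?_
    rw [binom2_natCast, zpow_natCast, zpow_natCast]
  · refine (((summable_norm_pow_choose_two hQ (Q ^ 2 / z)).mul_left ‖Q / z‖)).congr fun n => ?_
    rw [← norm_mul]
    congr 1
    have e : binom2 (-((n : ℤ) + 1)) = (n.choose 2 : ℕ) + n + (n + 1) := by
      rw [show -((n : ℤ) + 1) = 1 - (n + 1 + 1) by ring, binom2_one_sub, binom2_add_one,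
        binom2_add_one, binom2_natCast]
    rw [e, zpow_add₀ hQ0, zpow_add₀ hQ0, zpow_natCast, zpow_natCast, zpow_neg, zpow_add₀ hQ0,
      zpow_add₀ hz, zpow_one, zpow_one, zpow_natCast, zpow_natCast, div_pow]
    field_simp
    ring

/-! ### The Jacobi triple product -/

/-- A window of a bilateral product, `∏_{-k ≤ i < l} (1 - y q^i)`. -/
theorem qPoch_div_pow {q y : ℂ} (hq : q ≠ 0) (hy : y ≠ 0) (k l : ℕ) :
    qPoch (y / q ^ k) q (k + l) =
      (-y) ^ k / q ^ (k + 1).choose 2 * qPoch (q / y) q k * qPoch y q l := by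
  rw [qPoch_add, div_mul_cancel₀ _ (pow_ne_zero k hq)]
  congr 1
  induction k with
  | zero => simp
  | succ k ih =>
    rw [qPoch_succ', show y / q ^ (k + 1) * q = y / q ^ k by rw [pow_succ]; field_simp, ih,
      qPoch_succ, choose_two_succ (k + 1), pow_add q ((k + 1).choose 2), pow_succ (-y)]
    generalize qPoch (q / y) q k = u
    have h1 : q ^ (k + 1).choose 2 ≠ 0 := pow_ne_zero _ hq
    have h2 : q ^ k ≠ 0 := pow_ne_zero _ hq
    rw [pow_succ q k]
    field_simp
    ring

/-- The summand of the theta series `∑ (-1)^n q^{n(n-1)/2} x^n`. -/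
noncomputable def thetaTerm (x q : ℂ) (n : ℤ) : ℂ := (-1) ^ n * q ^ binom2 n * x ^ n

theorem norm_neg_one_zpow (n : ℤ) : ‖(-1 : ℂ) ^ n‖ = 1 := by
  rw [norm_zpow, norm_neg, norm_one, one_zpow]

theorem summable_norm_thetaTerm' {x q : ℂ} (hx : x ≠ 0) (hq0 : q ≠ 0) (hq : ‖q‖ < 1) :
    Summable fun n => ‖thetaTerm x q n‖ := by
  refine (summable_norm_thetaTerm hq0 hq hx).congr fun n => ?_
  rw [thetaTerm, mul_assoc, norm_mul (_ ^ n), norm_neg_one_zpow, one_mul]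

theorem neg_one_zpow_mul_self (r : ℤ) : (-1 : ℂ) ^ r * (-1) ^ r = 1 := by
  rw [← mul_zpow]; simp

/-- The Jacobi triple product. The `q`-Vandermonde sum with `M = 2N`, `C = 0` and `z = x q^{-N}`
is its finite form, symmetric about the middle index; then `N → ∞`. -/
theorem tsum_thetaTerm {x q : ℂ} (hx : x ≠ 0) (hq0 : q ≠ 0) (hq : ‖q‖ < 1) :
    ∑' n, thetaTerm x q n = jTheta x q := by
  have hne := one_sub_mul_pow_ne_zero hq hq
  have hJ := qPochInf_ne_zero hq hne
  have hU : Tendsto (fun n => (qPoch q q n)⁻¹) atTop (𝓝 (qPochInf q q)⁻¹) :=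
    (tendsto_qPoch q hq).inv₀ hJ
  have h1 := tendsto_sum_antidiagonal_two_mul (summable_norm_thetaTerm' hx hq0 hq) hU hU
  have h2 : Tendsto (fun N : ℕ => qPoch (q / x) q N * qPoch x q N * (qPoch q q (2 * N))⁻¹) atTop
      (𝓝 (qPochInf (q / x) q * qPochInf x q * (qPochInf q q)⁻¹)) :=
    ((tendsto_qPoch _ hq).mul (tendsto_qPoch _ hq)).mul
      (hU.comp (tendsto_id.const_mul_atTop' two_pos))
  have h3 : ∀ N : ℕ, qPoch (q / x) q N * qPoch x q N * (qPoch q q (2 * N))⁻¹ =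
      ∑ p ∈ antidiagonal (2 * N), thetaTerm x q ((p.1 : ℤ) - N) *
        ((qPoch q q p.1)⁻¹ * (qPoch q q p.2)⁻¹) := by
    intro N
    -- with `z = x / q^N` the product `(z; q)_{2N}` is the window `∏_{-N ≤ i < N} (1 - x q^i)`
    have h := sum_qVandermonde hne (2 * N) (x / q ^ N) 0
    rw [two_mul, qPoch_div_pow hq0 hx, ← two_mul] at h
    have hc : (-x) ^ N / q ^ (N + 1).choose 2 ≠ 0 :=
      div_ne_zero (pow_ne_zero _ (neg_ne_zero.2 hx)) (pow_ne_zero _ hq0)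
    refine mul_left_cancel₀ hc ?_
    rw [mul_sum]
    refine Eq.trans ?_ (h.symm.trans (sum_congr rfl fun p hp => ?_))
    · ring
    · rw [mem_antidiagonal_nat] at hp
      have e : binom2 ((p.1 : ℤ) - N) = (p.1.choose 2 : ℕ) + ((N + 1).choose 2 : ℕ) - N * p.1 := by
        rw [← binom2_natCast, ← binom2_natCast]
        have a1 := two_mul_binom2 ((p.1 : ℤ) - N)
        have a2 := two_mul_binom2 (p.1 : ℤ)
        have a3 := two_mul_binom2 ((N + 1 : ℕ) : ℤ)
        push_cast at *
        linarith
      have hqN : q ^ (N + 1).choose 2 ≠ 0 := pow_ne_zero _ hq0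
      have hqk : q ^ (N * p.1) ≠ 0 := pow_ne_zero _ hq0
      have hxN : x ^ N ≠ 0 := pow_ne_zero _ hx
      have e2 : thetaTerm x q ((p.1 : ℤ) - N) = (-1) ^ p.1 * (-1) ^ N *
          (q ^ p.1.choose 2 * q ^ (N + 1).choose 2 / q ^ (N * p.1)) * (x ^ p.1 / x ^ N) := by
        rw [thetaTerm, neg_one_zpow_sub, pow_add, e, zpow_sub₀ hq0, zpow_add₀ hq0, zpow_sub₀ hx,
          zpow_natCast, zpow_natCast, zpow_natCast, zpow_natCast, ← Nat.cast_mul, zpow_natCast]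
      have e3 := neg_one_pow_mul_self N
      simp only [zero_mul, sub_zero, prod_const, card_range]
      rw [e2, neg_pow x, div_pow x, ← pow_mul]
      simp only [qPoch, zero_mul, sub_zero, prod_const_one, mul_one]
      rw [div_eq_mul_inv _ (_ * _), mul_inv]
      generalize (∏ k ∈ range p.1, (1 - q * q ^ k))⁻¹ = u
      generalize (∏ k ∈ range p.2, (1 - q * q ^ k))⁻¹ = u'
      field_simp
      linear_combination (-u * u') * e3
  have h4 := tendsto_nhds_unique h1 (h2.congr h3)
  rw [jTheta]
  field_simp at h4
  linear_combination h4

/-! ### Partial fractions of a quotient of theta products -/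

open Polynomial in
/-- Lagrange interpolation at two families of nodes, in the form of a partial fraction
expansion. -/
theorem eval_eq_sum_two_families {M : ℕ} {u v : ℕ → ℂ} (hu : Set.InjOn u (range M))
    (hv : Set.InjOn v (range M)) (huv : ∀ i ∈ range M, ∀ j ∈ range M, u i ≠ v j) {f : ℂ[X]}
    (hf : f.degree < (2 * M : ℕ)) {x : ℂ} (hxu : ∀ i ∈ range M, x ≠ u i)
    (hxv : ∀ i ∈ range M, x ≠ v i) :
    f.eval x / ((∏ i ∈ range M, (x - u i)) * ∏ i ∈ range M, (x - v i)) =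
      ∑ i ∈ range M, f.eval (u i) / ((x - u i) * (∏ j ∈ (range M).erase i, (u i - u j)) *
        ∏ j ∈ range M, (u i - v j)) +
      ∑ i ∈ range M, f.eval (v i) / ((x - v i) * (∏ j ∈ (range M).erase i, (v i - v j)) *
        ∏ j ∈ range M, (v i - u j)) := by
  classical
  set s := (range M).disjSum (range M) with hs
  set w : ℕ ⊕ ℕ → ℂ := Sum.elim u v with hw
  have hinj : Set.InjOn w s := by
    rintro (i | i) hi (j | j) hj h
    · simp only [hs, mem_coe, inl_mem_disjSum] at hi hj
      rw [hu hi hj h]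
    · simp only [hs, mem_coe, inl_mem_disjSum, inr_mem_disjSum] at hi hj
      exact absurd h (huv i hi j hj)
    · simp only [hs, mem_coe, inl_mem_disjSum, inr_mem_disjSum] at hi hj
      exact absurd h.symm (huv j hj i hi)
    · simp only [hs, mem_coe, inr_mem_disjSum] at hi hj
      rw [hv hi hj h]
  have hcard : s.card = 2 * M := by rw [hs, card_disjSum, card_range, two_mul]
  have hx : ∀ i ∈ s, x ≠ w i := by
    rintro (i | i) hi
    · exact hxu i (inl_mem_disjSum.1 hi)
    · exact hxv i (inr_mem_disjSum.1 hi)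
  have e1 : ∀ i ∈ range M, s.erase (Sum.inl i) = ((range M).erase i).disjSum (range M) := by
    intro i _
    ext (j | j) <;> simp [hs]
  have e2 : ∀ i ∈ range M, s.erase (Sum.inr i) = (range M).disjSum ((range M).erase i) := by
    intro i _
    ext (j | j) <;> simp [hs]
  have h := congrArg (eval x) (Lagrange.eq_interpolate hinj (by rw [hcard]; exact hf))
  rw [Lagrange.eval_interpolate_not_at_node _ hx, Lagrange.eval_nodal] at h
  have hne1 : ∏ i ∈ range M, (x - u i) ≠ 0 :=
    prod_ne_zero_iff.2 fun i hi => sub_ne_zero.2 (hxu i hi)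
  have hne2 : ∏ i ∈ range M, (x - v i) ≠ 0 :=
    prod_ne_zero_iff.2 fun i hi => sub_ne_zero.2 (hxv i hi)
  rw [hs, prod_disjSum, sum_disjSum] at h
  simp only [hw, Sum.elim_inl, Sum.elim_inr] at h
  rw [h, mul_div_cancel_left₀ _ (mul_ne_zero hne1 hne2)]
  congr 1
  · refine sum_congr rfl fun i hi => ?_
    rw [Lagrange.nodalWeight, ← hs, e1 i hi, prod_disjSum]
    simp only [Sum.elim_inl, Sum.elim_inr, prod_inv_distrib, div_eq_mul_inv, mul_inv]
    ring
  · refine sum_congr rfl fun i hi => ?_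
    rw [Lagrange.nodalWeight, ← hs, e2 i hi, prod_disjSum]
    simp only [Sum.elim_inl, Sum.elim_inr, prod_inv_distrib, div_eq_mul_inv, mul_inv]
    ring

/-- The product over the nodes other than the `k`-th, for nodes in geometric progression. -/
theorem prod_erase_one_sub_div {q : ℂ} (hq : q ≠ 0) (k l : ℕ) :
    ∏ j ∈ (range (k + (l + 1))).erase k, (1 - q ^ j / q ^ k) =
      (-1) ^ k / q ^ (k + 1).choose 2 * qPoch q q k * qPoch q q l := by
  have hk : k ∈ range (k + (l + 1)) := by simp
  have e : ∏ j ∈ (range (k + (l + 1))).erase k, (1 - q ^ j / q ^ k) =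
      ∏ j ∈ range (k + (l + 1)), if j = k then 1 else (1 - q ^ j / q ^ k) := by
    rw [← mul_prod_erase _ _ hk, if_pos rfl, one_mul]
    exact prod_congr rfl fun j hj => (if_neg (ne_of_mem_erase hj)).symm
  have h := qPoch_div_pow hq one_ne_zero k 0
  rw [e, prod_range_add, prod_range_succ']
  rw [add_zero, div_one, qPoch_zero, mul_one] at h
  have h1 : ∏ j ∈ range k, (if j = k then (1 : ℂ) else (1 - q ^ j / q ^ k)) =
      (-1) ^ k / q ^ (k + 1).choose 2 * qPoch q q k := by
    rw [← h, qPoch]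
    refine prod_congr rfl fun j hj => ?_
    rw [if_neg (mem_range.1 hj).ne]
    ring
  rw [h1, add_zero, if_pos rfl, mul_one, qPoch.eq_1 q q l]
  congr 1
  refine prod_congr rfl fun j _ => ?_
  rw [if_neg (by omega), show q ^ (k + (j + 1)) = q * q ^ j * q ^ k by ring,
    mul_div_cancel_right₀ _ (pow_ne_zero k hq)]

/-- The summand of a level one Appell-Lerch series, `(-1)^n q^{n(n+1)/2} z^n / (1 - a q^n)`. -/
noncomputable def lerchTerm (q z a : ℂ) (n : ℤ) : ℂ :=
  (-1) ^ n * q ^ binom2 (n + 1) * z ^ n / (1 - a * q ^ n)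

/-- The weight of a pole in the finite partial fraction expansion; `i` and `l` count the nodes of
its family on either side, and `y = w / a`, `y' = b / a`. -/
noncomputable def poleWeight (q y y' : ℂ) (i l : ℕ) : ℂ :=
  qPoch (q / y) q i / (qPoch q q i * qPoch (q / y') q i) *
    (qPoch y q l / (qPoch q q l * qPoch y' q (l + 1)))

theorem pow_injective_of_norm_lt_one {q : ℂ} (hq0 : q ≠ 0) (hq : ‖q‖ < 1) :
    Function.Injective fun n : ℕ => q ^ n := fun m n h => by
  have := congrArg norm h
  simp only [norm_pow] at this
  exact (pow_right_strictAnti₀ (norm_pos_iff.2 hq0) hq).injective this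

/-- The residue term of the pole at `a q^{i-N}`: up to a factor independent of `i`, the term of
index `i - N` of the Appell-Lerch series times a weight that tends to a constant. -/
theorem poleTerm_eq {q a b w : ℂ} (hq0 : q ≠ 0) (ha : a ≠ 0) (hb : b ≠ 0) (hw : w ≠ 0)
    (N : ℕ) {i l : ℕ} (hil : i + l = 2 * N) :
    (a / q ^ N * q ^ i) ^ (N + 1) * (∏ j ∈ range (2 * N), (a / q ^ N * q ^ i - w / q ^ N * q ^ j)) /
      ((1 - a / q ^ N * q ^ i) *
        (∏ j ∈ (range (2 * N + 1)).erase i, (a / q ^ N * q ^ i - a / q ^ N * q ^ j)) *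
        ∏ j ∈ range (2 * N + 1), (a / q ^ N * q ^ i - b / q ^ N * q ^ j)) =
      (-(w / (a * b))) ^ N * q ^ (N + 1).choose 2 *
        (lerchTerm q (w / b) a ((i : ℤ) - N) * poleWeight q (w / a) (b / a) i l) := by
  have hqN : q ^ N ≠ 0 := pow_ne_zero _ hq0
  have hqi : q ^ i ≠ 0 := pow_ne_zero _ hq0
  set t : ℂ := a / q ^ N * q ^ i with ht
  have ht0 : t ≠ 0 := mul_ne_zero (div_ne_zero ha hqN) hqi
  have hf : ∀ (y : ℂ) (j : ℕ), t - y / q ^ N * q ^ j = t * (1 - y / a / q ^ i * q ^ j) :=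
    fun y j => by rw [ht]; field_simp
  have e1 : ∏ j ∈ range (2 * N), (t - w / q ^ N * q ^ j) =
      t ^ (2 * N) * ((-(w / a)) ^ i / q ^ (i + 1).choose 2 * qPoch (q / (w / a)) q i *
        qPoch (w / a) q l) := by
    rw [← qPoch_div_pow hq0 (div_ne_zero hw ha), hil, qPoch]
    simp only [hf, prod_mul_distrib, prod_const, card_range]
  have e2 : ∏ j ∈ (range (2 * N + 1)).erase i, (t - a / q ^ N * q ^ j) =
      t ^ (2 * N) * ((-1) ^ i / q ^ (i + 1).choose 2 * qPoch q q i * qPoch q q l) := by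
    have hi : i ∈ range (2 * N + 1) := mem_range.2 (by omega)
    rw [← prod_erase_one_sub_div hq0, ← add_assoc, hil]
    simp only [hf, prod_mul_distrib, prod_const, card_erase_of_mem hi, card_range, div_self ha,
      Nat.add_sub_cancel, one_div_mul_eq_div]
  have e3 : ∏ j ∈ range (2 * N + 1), (t - b / q ^ N * q ^ j) =
      t ^ (2 * N + 1) * ((-(b / a)) ^ i / q ^ (i + 1).choose 2 * qPoch (q / (b / a)) q i *
        qPoch (b / a) q (l + 1)) := by
    rw [← qPoch_div_pow hq0 (div_ne_zero hb ha), ← add_assoc, hil, qPoch]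
    simp only [hf, prod_mul_distrib, prod_const, card_range]
  have eb : binom2 ((i : ℤ) - N + 1) = ((i + 1).choose 2 : ℕ) + (N.choose 2 : ℕ) - (N * i : ℕ) := by
    rw [← binom2_natCast, ← binom2_natCast]
    have a1 := two_mul_binom2 ((i : ℤ) - N + 1)
    have a2 := two_mul_binom2 (N : ℤ)
    have a3 := two_mul_binom2 ((i + 1 : ℕ) : ℤ)
    push_cast at *
    linarith
  have et : a * q ^ ((i : ℤ) - N) = t := by
    rw [ht, zpow_sub₀ hq0, zpow_natCast, zpow_natCast]
    ring
  have e4 : lerchTerm q (w / b) a ((i : ℤ) - N) = (-1) ^ i * (-1) ^ N *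
      (q ^ (i + 1).choose 2 * q ^ N.choose 2 / (q ^ i) ^ N) * ((w / b) ^ i / (w / b) ^ N) /
        (1 - t) := by
    rw [lerchTerm, et, neg_one_zpow_sub, pow_add, eb, zpow_sub₀ hq0, zpow_add₀ hq0,
      zpow_sub₀ (div_ne_zero hw hb), zpow_natCast, zpow_natCast, zpow_natCast, zpow_natCast,
      zpow_natCast, ← pow_mul, mul_comm i]
  have e5 : q ^ (N + 1).choose 2 * q ^ N.choose 2 = (q ^ N) ^ N := by
    rw [← pow_add, ← pow_mul, choose_two_succ]
    have := two_mul_binom2 (N : ℤ)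
    rw [binom2_natCast] at this
    congr 1
    zify
    linarith
  have e6 : t ^ N * (q ^ N) ^ N = a ^ N * (q ^ i) ^ N := by
    rw [← mul_pow, ← mul_pow, ht]
    congr 1
    field_simp
  have e7 := neg_one_pow_mul_self i
  have e8 := neg_one_pow_mul_self N
  have e9 : (-1 : ℂ) ^ i ≠ 0 := pow_ne_zero _ (by norm_num)
  rw [e1, e2, e3, e4, poleWeight, neg_pow (w / a), neg_pow (b / a), neg_pow (w / (a * b))]
  have hc : q ^ (i + 1).choose 2 ≠ 0 := pow_ne_zero _ hq0
  have lhs : ∀ U V A B C D c : ℂ, t ^ (N + 1) * (t ^ (2 * N) * ((-1) ^ i * (w / a) ^ i /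
      q ^ (i + 1).choose 2 * U * V)) / (c * (t ^ (2 * N) * ((-1) ^ i / q ^ (i + 1).choose 2 *
        A * B)) * (t ^ (2 * N + 1) * ((-1) ^ i * (b / a) ^ i / q ^ (i + 1).choose 2 * C * D))) =
      (-1) ^ i * (w / b) ^ i * q ^ (i + 1).choose 2 / t ^ N / c *
        (U / (A * C) * (V / (B * D))) := by
    intro U V A B C D c
    have hK : t ^ (N + 1) * (t ^ (2 * N) * ((-1) ^ i * (w / a) ^ i / q ^ (i + 1).choose 2)) /
        ((t ^ (2 * N) * ((-1) ^ i / q ^ (i + 1).choose 2)) *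
          (t ^ (2 * N + 1) * ((-1) ^ i * (b / a) ^ i / q ^ (i + 1).choose 2))) =
        (-1) ^ i * (w / b) ^ i * q ^ (i + 1).choose 2 / t ^ N := by
      rw [pow_succ t N, pow_succ t (2 * N), two_mul, pow_add t N N]
      have h1 : (w / a) ^ i = (w / b) ^ i * (b / a) ^ i := by
        rw [← mul_pow]; congr 1; field_simp
      have h2 : (b / a) ^ i ≠ 0 := pow_ne_zero _ (div_ne_zero hb ha)
      have h3 : t ^ N ≠ 0 := pow_ne_zero _ ht0
      rw [h1]
      generalize (b / a) ^ i = r1 at *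
      generalize (w / b) ^ i = r2 at *
      generalize (-1 : ℂ) ^ i = s at *
      field_simp
      linear_combination (-r2) * e7
    rw [← hK]
    simp only [div_eq_mul_inv, mul_inv]
    ring
  have rhs : (-1) ^ N * (w / (a * b)) ^ N * q ^ (N + 1).choose 2 * ((-1) ^ i * (-1) ^ N *
      (q ^ (i + 1).choose 2 * q ^ N.choose 2 / (q ^ i) ^ N) * ((w / b) ^ i / (w / b) ^ N)) =
      (-1) ^ i * (w / b) ^ i * q ^ (i + 1).choose 2 / t ^ N := by
    have h1 : (w / (a * b)) ^ N * a ^ N = (w / b) ^ N := by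
      rw [← mul_pow]; congr 1; field_simp
    have h2 : (w / b) ^ N ≠ 0 := pow_ne_zero _ (div_ne_zero hw hb)
    have h3 : t ^ N ≠ 0 := pow_ne_zero _ ht0
    have h4 : (q ^ i) ^ N ≠ 0 := pow_ne_zero _ hqi
    rw [eq_div_iff h3, ← h1]
    rw [← h1] at h2
    have h5 := left_ne_zero_of_mul h2
    have h6 := right_ne_zero_of_mul h2
    generalize (w / (a * b)) ^ N = r1 at *
    generalize (w / b) ^ i = r2 at *
    generalize (-1 : ℂ) ^ N = s at *
    generalize (-1 : ℂ) ^ i = s' at *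
    generalize q ^ (i + 1).choose 2 = X at *
    generalize q ^ (N + 1).choose 2 = Y at *
    generalize q ^ N.choose 2 = Z at *
    generalize t ^ N = T at *
    generalize (q ^ i) ^ N = qi at *
    generalize a ^ N = aN at *
    field_simp
    linear_combination (Y * Z * r2 * T) * e8 + (r2 * T) * e5 + r2 * e6
  rw [lhs, ← rhs]
  ring

open Polynomial in
/-- The finite form of `jTheta_partialFraction`. Each theta function is truncated to a finite
window of its zeros. -/
theorem sum_poleTerms {q a b w : ℂ} (hq0 : q ≠ 0) (hq : ‖q‖ < 1) (ha0 : a ≠ 0) (hb0 : b ≠ 0)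
    (hw0 : w ≠ 0) (ha : ∀ n : ℤ, 1 - a * q ^ n ≠ 0) (hb : ∀ n : ℤ, 1 - b * q ^ n ≠ 0)
    (hab : ∀ n : ℤ, 1 - a / b * q ^ n ≠ 0) (N : ℕ) :
    qPoch (q / w) q N * qPoch w q N /
        (qPoch (q / a) q N * qPoch a q (N + 1) * (qPoch (q / b) q N * qPoch b q (N + 1))) =
      ∑ p ∈ antidiagonal (2 * N), lerchTerm q (w / b) a ((p.1 : ℤ) - N) *
        poleWeight q (w / a) (b / a) p.1 p.2 +
      ∑ p ∈ antidiagonal (2 * N), lerchTerm q (w / a) b ((p.1 : ℤ) - N) *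
        poleWeight q (w / b) (a / b) p.1 p.2 := by
  have hqN : q ^ N ≠ 0 := pow_ne_zero _ hq0
  have hinj : ∀ {y : ℂ}, y ≠ 0 → Set.InjOn (fun i => y / q ^ N * q ^ i) (range (2 * N + 1)) :=
    fun {y} hy i _ j _ h => pow_injective_of_norm_lt_one hq0 hq
      (mul_left_cancel₀ (div_ne_zero hy hqN) h)
  have hone : ∀ {y : ℂ}, (∀ n : ℤ, 1 - y * q ^ n ≠ 0) → ∀ i ∈ range (2 * N + 1),
      1 ≠ y / q ^ N * q ^ i := fun {y} hy i _ h => by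
    refine hy ((i : ℤ) - N) ?_
    rw [zpow_sub₀ hq0, zpow_natCast, zpow_natCast, sub_eq_zero, h]
    ring
  have huv : ∀ i ∈ range (2 * N + 1), ∀ j ∈ range (2 * N + 1),
      a / q ^ N * q ^ i ≠ b / q ^ N * q ^ j := fun i _ j _ h => by
    refine hab ((i : ℤ) - j) ?_
    have hqj : q ^ j ≠ 0 := pow_ne_zero _ hq0
    rw [zpow_sub₀ hq0, zpow_natCast, zpow_natCast, sub_eq_zero]
    field_simp at h ⊢
    exact h.symm
  -- at the node `t = a q^{i-N}` the factor `X ^ (N + 1)` leaves the power `t ^ (-N)` in the residue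
  -- term; its factor `q^{-iN}` turns the exponent of `q` into that of index `i - N` in `lerchTerm`
  set f : ℂ[X] := X ^ (N + 1) * Lagrange.nodal (range (2 * N)) fun j => w / q ^ N * q ^ j with hf
  have hdeg : f.degree < (2 * (2 * N + 1) : ℕ) := by
    refine degree_le_natDegree.trans_lt (WithBot.coe_lt_coe.2 ?_)
    refine natDegree_mul_le.trans_lt ?_
    rw [natDegree_X_pow, Lagrange.natDegree_nodal, card_range]
    simp only [Nat.cast_id]
    omega
  have hfe : ∀ x, f.eval x = x ^ (N + 1) * ∏ j ∈ range (2 * N), (x - w / q ^ N * q ^ j) :=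
    fun x => by rw [hf, eval_mul, eval_pow, eval_X, Lagrange.eval_nodal]
  have h := eval_eq_sum_two_families (hinj ha0) (hinj hb0) huv hdeg (hone ha) (hone hb)
  simp only [hfe] at h
  have hside : ∀ {a b : ℂ}, a ≠ 0 → b ≠ 0 → ∑ i ∈ range (2 * N + 1),
      (a / q ^ N * q ^ i) ^ (N + 1) *
        (∏ j ∈ range (2 * N), (a / q ^ N * q ^ i - w / q ^ N * q ^ j)) /
      ((1 - a / q ^ N * q ^ i) *
        (∏ j ∈ (range (2 * N + 1)).erase i, (a / q ^ N * q ^ i - a / q ^ N * q ^ j)) *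
        ∏ j ∈ range (2 * N + 1), (a / q ^ N * q ^ i - b / q ^ N * q ^ j)) =
      (-(w / (a * b))) ^ N * q ^ (N + 1).choose 2 * ∑ p ∈ antidiagonal (2 * N),
        lerchTerm q (w / b) a ((p.1 : ℤ) - N) * poleWeight q (w / a) (b / a) p.1 p.2 := by
    intro a b ha hb
    rw [Finset.Nat.sum_antidiagonal_eq_sum_range_succ_mk, mul_sum]
    refine sum_congr rfl fun i hi => poleTerm_eq hq0 ha hb hw0 N ?_
    have := mem_range.1 hi
    omega
  rw [hside ha0 hb0, hside hb0 ha0, mul_comm b a, ← mul_add] at h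
  have hden : ∀ {y : ℂ}, y ≠ 0 → ∏ i ∈ range (2 * N + 1), (1 - y / q ^ N * q ^ i) =
      (-y) ^ N / q ^ (N + 1).choose 2 * qPoch (q / y) q N * qPoch y q (N + 1) := fun {y} hy => by
    rw [← qPoch_div_pow hq0 hy, ← add_assoc, ← two_mul, qPoch]
  have hnum : ∏ i ∈ range (2 * N), (1 - w / q ^ N * q ^ i) =
      (-w) ^ N / q ^ (N + 1).choose 2 * qPoch (q / w) q N * qPoch w q N := by
    rw [← qPoch_div_pow hq0 hw0, ← two_mul, qPoch]
  rw [hden ha0, hden hb0, hnum, one_pow, one_mul] at h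
  have hc : q ^ (N + 1).choose 2 ≠ 0 := pow_ne_zero _ hq0
  have hp : (-(w / (a * b))) ^ N * q ^ (N + 1).choose 2 ≠ 0 :=
    mul_ne_zero (pow_ne_zero _ (neg_ne_zero.2 (div_ne_zero hw0 (mul_ne_zero ha0 hb0)))) hc
  refine mul_left_cancel₀ hp (Eq.trans ?_ h)
  have hpe : (-(w / (a * b))) ^ N * q ^ (N + 1).choose 2 =
      ((-w) ^ N / q ^ (N + 1).choose 2) / (((-a) ^ N / q ^ (N + 1).choose 2) *
        ((-b) ^ N / q ^ (N + 1).choose 2)) := by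
    rw [show -(w / (a * b)) = (-w) / ((-a) * (-b)) by field_simp, div_pow, mul_pow]
    have h1 : (-a) ^ N ≠ 0 := pow_ne_zero _ (neg_ne_zero.2 ha0)
    have h2 : (-b) ^ N ≠ 0 := pow_ne_zero _ (neg_ne_zero.2 hb0)
    field_simp
  rw [hpe]
  simp only [div_eq_mul_inv, mul_inv]
  ring

/-- The inverse tends to `1` as `n → ∞` and to `0` as `n → -∞`. -/
theorem exists_norm_inv_one_sub_mul_zpow_le {q a : ℂ} (hq0 : q ≠ 0) (hq : ‖q‖ < 1) (ha0 : a ≠ 0)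
    (ha : ∀ n : ℤ, 1 - a * q ^ n ≠ 0) : ∃ C : ℝ, ∀ n : ℤ, ‖(1 - a * q ^ n)⁻¹‖ ≤ C := by
  have ht : ∀ y : ℂ, Tendsto (fun n : ℕ => (1 - y * q ^ n)⁻¹) atTop (𝓝 1) := fun y => by
    have h := ((tendsto_pow_atTop_nhds_zero_of_norm_lt_one hq).const_mul y).const_sub 1
    rw [mul_zero, sub_zero] at h
    simpa using h.inv₀ one_ne_zero
  obtain ⟨C1, h1⟩ := (Metric.isBounded_range_of_tendsto _ (ht a)).exists_norm_le
  obtain ⟨C2, h2⟩ := (Metric.isBounded_range_of_tendsto _ (ht a⁻¹)).exists_norm_le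
  refine ⟨max C1 (‖a⁻¹‖ * C2), fun n => ?_⟩
  obtain ⟨m, rfl | rfl⟩ := n.eq_nat_or_neg
  · rw [zpow_natCast]
    exact (h1 _ ⟨m, rfl⟩).trans (le_max_left _ _)
  · refine le_trans ?_ (le_max_right _ _)
    have hm : q ^ m ≠ 0 := pow_ne_zero _ hq0
    have e : (1 - a * q ^ (-(m : ℤ)))⁻¹ = -(q ^ m) * (a⁻¹ * (1 - a⁻¹ * q ^ m)⁻¹) := by
      have h3 := ha (-(m : ℤ))
      have h4 : 1 - a⁻¹ * q ^ m ≠ 0 := by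
        intro h
        apply h3
        rw [zpow_neg, zpow_natCast]
        field_simp at h ⊢
        linear_combination -h
      rw [zpow_neg, zpow_natCast] at h3 ⊢
      rw [inv_eq_iff_eq_inv, mul_inv, mul_inv, inv_inv, inv_inv]
      field_simp
      ring
    rw [e, norm_mul, norm_neg, norm_pow]
    refine (mul_le_of_le_one_left (norm_nonneg _) (pow_le_one₀ (norm_nonneg _) hq.le)).trans ?_
    rw [norm_mul]
    exact mul_le_mul_of_nonneg_left (h2 _ ⟨m, rfl⟩) (norm_nonneg _)

theorem summable_norm_lerchTerm {q z a : ℂ} (hq0 : q ≠ 0) (hq : ‖q‖ < 1) (hz : z ≠ 0) (ha0 : a ≠ 0)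
    (ha : ∀ n : ℤ, 1 - a * q ^ n ≠ 0) : Summable fun n => ‖lerchTerm q z a n‖ := by
  obtain ⟨C, hC⟩ := exists_norm_inv_one_sub_mul_zpow_le hq0 hq ha0 ha
  refine .of_nonneg_of_le (fun _ => norm_nonneg _) (fun n => ?_)
    ((summable_norm_thetaTerm hq0 hq (mul_ne_zero hq0 hz)).mul_right C)
  rw [lerchTerm, div_eq_mul_inv, norm_mul, binom2_add_one, zpow_add₀ hq0, mul_assoc (_ ^ n),
    mul_assoc (q ^ binom2 n), ← mul_zpow, norm_mul ((-1) ^ n), norm_neg_one_zpow, one_mul]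
  exact mul_le_mul_of_nonneg_left (hC n) (norm_nonneg _)

theorem qPochInf_ne_zero_of_zpow {q y : ℂ} (hq : ‖q‖ < 1) (hy : ∀ n : ℤ, 1 - y * q ^ n ≠ 0) :
    qPochInf y q ≠ 0 :=
  qPochInf_ne_zero hq fun k => by simpa using hy k

theorem one_sub_div_mul_zpow_ne_zero {q y : ℂ} (hq0 : q ≠ 0) (hy0 : y ≠ 0)
    (hy : ∀ n : ℤ, 1 - y * q ^ n ≠ 0) (n : ℤ) : 1 - q / y * q ^ n ≠ 0 := by
  intro h
  refine hy (-(n + 1)) ?_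
  have hn : q ^ n ≠ 0 := zpow_ne_zero _ hq0
  rw [zpow_neg, zpow_add₀ hq0, zpow_one]
  field_simp at h ⊢
  linear_combination -h

theorem jTheta_ne_zero {q y : ℂ} (hq0 : q ≠ 0) (hq : ‖q‖ < 1) (hy0 : y ≠ 0)
    (hy : ∀ n : ℤ, 1 - y * q ^ n ≠ 0) : jTheta y q ≠ 0 :=
  mul_ne_zero (mul_ne_zero (qPochInf_ne_zero_of_zpow hq hy)
    (qPochInf_ne_zero_of_zpow hq (one_sub_div_mul_zpow_ne_zero hq0 hy0 hy)))
    (qPochInf_ne_zero_of_norm_lt_one hq hq)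

/-- The partial fraction expansion of `x ↦ j(x w; q) / (j(x a; q) j(x b; q))`, at `x = 1`. -/
theorem jTheta_partialFraction {q a b w : ℂ} (hq0 : q ≠ 0) (hq : ‖q‖ < 1) (ha0 : a ≠ 0)
    (hb0 : b ≠ 0) (hw0 : w ≠ 0) (ha : ∀ n : ℤ, 1 - a * q ^ n ≠ 0) (hb : ∀ n : ℤ, 1 - b * q ^ n ≠ 0)
    (hab : ∀ n : ℤ, 1 - a / b * q ^ n ≠ 0) :
    qPochInf q q ^ 3 * jTheta w q / (jTheta a q * jTheta b q) =
      jTheta (w / a) q / jTheta (b / a) q * ∑' n, lerchTerm q (w / b) a n +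
        jTheta (w / b) q / jTheta (a / b) q * ∑' n, lerchTerm q (w / a) b n := by
  have hJ := qPochInf_ne_zero_of_norm_lt_one hq hq
  have hba : ∀ n : ℤ, 1 - b / a * q ^ n ≠ 0 := fun n h => by
    refine hab (-n) ?_
    have hn : q ^ n ≠ 0 := zpow_ne_zero _ hq0
    rw [zpow_neg]
    field_simp at h ⊢
    linear_combination -h
  have hside : ∀ {a b : ℂ}, a ≠ 0 → b ≠ 0 → (∀ n : ℤ, 1 - a * q ^ n ≠ 0) →
      (∀ n : ℤ, 1 - b / a * q ^ n ≠ 0) →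
      Tendsto (fun N : ℕ => ∑ p ∈ antidiagonal (2 * N), lerchTerm q (w / b) a ((p.1 : ℤ) - N) *
        poleWeight q (w / a) (b / a) p.1 p.2) atTop (𝓝 ((∑' n, lerchTerm q (w / b) a n) *
          (qPochInf (q / (w / a)) q / (qPochInf q q * qPochInf (q / (b / a)) q) *
            (qPochInf (w / a) q / (qPochInf q q * qPochInf (b / a) q))))) := by
    intro a b ha0 hb0 ha hba
    have h1 := qPochInf_ne_zero_of_zpow hq hba
    have h2 := qPochInf_ne_zero_of_zpow hq
      (one_sub_div_mul_zpow_ne_zero hq0 (div_ne_zero hb0 ha0) hba)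
    have hU : Tendsto (fun i => qPoch (q / (w / a)) q i / (qPoch q q i * qPoch (q / (b / a)) q i))
        atTop (𝓝 (qPochInf (q / (w / a)) q / (qPochInf q q * qPochInf (q / (b / a)) q))) :=
      (tendsto_qPoch _ hq).div ((tendsto_qPoch _ hq).mul (tendsto_qPoch _ hq)) (mul_ne_zero hJ h2)
    have hV : Tendsto (fun l => qPoch (w / a) q l / (qPoch q q l * qPoch (b / a) q (l + 1)))
        atTop (𝓝 (qPochInf (w / a) q / (qPochInf q q * qPochInf (b / a) q))) :=
      (tendsto_qPoch _ hq).div ((tendsto_qPoch _ hq).mul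
        ((tendsto_qPoch _ hq).comp (tendsto_add_atTop_nat 1))) (mul_ne_zero hJ h1)
    have h3 := tendsto_sum_antidiagonal_two_mul
      (summable_norm_lerchTerm hq0 hq (div_ne_zero hw0 hb0) ha0 ha) hU hV
    simpa only [poleWeight] using h3
  have a1 := qPochInf_ne_zero_of_zpow hq ha
  have a2 := qPochInf_ne_zero_of_zpow hq (one_sub_div_mul_zpow_ne_zero hq0 ha0 ha)
  have b1 := qPochInf_ne_zero_of_zpow hq hb
  have b2 := qPochInf_ne_zero_of_zpow hq (one_sub_div_mul_zpow_ne_zero hq0 hb0 hb)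
  have hl : Tendsto (fun N : ℕ => qPoch (q / w) q N * qPoch w q N /
        (qPoch (q / a) q N * qPoch a q (N + 1) * (qPoch (q / b) q N * qPoch b q (N + 1)))) atTop
      (𝓝 (qPochInf (q / w) q * qPochInf w q / (qPochInf (q / a) q * qPochInf a q *
        (qPochInf (q / b) q * qPochInf b q)))) := by
    have hs : ∀ y, Tendsto (fun N => qPoch y q (N + 1)) atTop (𝓝 (qPochInf y q)) := fun y =>
      (tendsto_qPoch y hq).comp (tendsto_add_atTop_nat 1)
    exact ((tendsto_qPoch (q / w) hq).mul (tendsto_qPoch w hq)).div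
      (((tendsto_qPoch (q / a) hq).mul (hs a)).mul ((tendsto_qPoch (q / b) hq).mul (hs b)))
      (mul_ne_zero (mul_ne_zero a2 a1) (mul_ne_zero b2 b1))
  have h := tendsto_nhds_unique hl (((hside ha0 hb0 ha hba).add (hside hb0 ha0 hb hab)).congr
    fun N => (sum_poleTerms hq0 hq ha0 hb0 hw0 ha hb hab N).symm)
  have c1 := jTheta_ne_zero hq0 hq (div_ne_zero hb0 ha0) hba
  have c2 := jTheta_ne_zero hq0 hq (div_ne_zero ha0 hb0) hab
  have h' := congrArg (qPochInf q q ^ 2 * ·) h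
  simp only [jTheta] at c1 c2 ⊢
  have d1 := left_ne_zero_of_mul (left_ne_zero_of_mul c1)
  have d2 := right_ne_zero_of_mul (left_ne_zero_of_mul c1)
  have d3 := left_ne_zero_of_mul (left_ne_zero_of_mul c2)
  have d4 := right_ne_zero_of_mul (left_ne_zero_of_mul c2)
  refine Eq.trans ?_ (h'.trans ?_)
  · field_simp
  · generalize (∑' n, lerchTerm q (w / b) a n) = S at *
    generalize (∑' n, lerchTerm q (w / a) b n) = S' at *
    generalize qPochInf (q / (b / a)) q = g1 at *
    generalize qPochInf (q / (a / b)) q = g2 at *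
    generalize qPochInf (b / a) q = g3 at *
    generalize qPochInf (a / b) q = g4 at *
    generalize qPochInf (q / (w / a)) q = g5 at *
    generalize qPochInf (q / (w / b)) q = g6 at *
    generalize qPochInf (w / a) q = g7 at *
    generalize qPochInf (w / b) q = g8 at *
    generalize qPochInf q q = J at *
    clear h h' hl hside
    field_simp

/-! ### Theta products -/

theorem thetaTerm_neg (x q : ℂ) (n : ℤ) : thetaTerm (-x) q n = q ^ binom2 n * x ^ n := by
  rw [thetaTerm, ← neg_one_mul x, mul_zpow]
  linear_combination (q ^ binom2 n * x ^ n) * neg_one_zpow_mul_self n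

/-- The double series is indexed by all pairs of integers. -/
theorem hasSum_thetaTerm_mul {x y q : ℂ} (hx : x ≠ 0) (hy : y ≠ 0) (hq0 : q ≠ 0) (hq : ‖q‖ < 1) :
    HasSum (fun p : ℤ × ℤ => thetaTerm x q p.1 * thetaTerm y q p.2) (jTheta x q * jTheta y q) := by
  have h1 := summable_norm_thetaTerm' hx hq0 hq
  have h2 := summable_norm_thetaTerm' hy hq0 hq
  rw [← tsum_thetaTerm hx hq0 hq, ← tsum_thetaTerm hy hq0 hq, tsum_mul_tsum_of_summable_norm h1 h2]
  exact (summable_mul_of_summable_norm h1 h2).hasSum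

/-- A double series over the pairs of integers, split according to the parity of the sum. -/
theorem hasSum_of_parity {F : ℤ × ℤ → ℂ} {a b : ℂ}
    (ha : HasSum (fun p : ℤ × ℤ => F (p.1 + p.2, p.1 - p.2)) a)
    (hb : HasSum (fun p : ℤ × ℤ => F (p.1 + p.2, p.1 - p.2 + 1)) b) : HasSum F (a + b) := by
  classical
  have hF' : F = fun p => (if Even (p.1 + p.2) then F p else 0) +
      (if Even (p.1 + p.2) then 0 else F p) := by
    funext p; split_ifs <;> simp
  rw [hF']
  refine HasSum.add ?_ ?_
  · have hi : Function.Injective fun p : ℤ × ℤ => (p.1 + p.2, p.1 - p.2) := by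
      rintro ⟨a, b⟩ ⟨c, d⟩ h
      simp only [Prod.mk.injEq] at h ⊢
      omega
    refine (hi.hasSum_iff ?_).1 (ha.congr_fun fun p => ?_)
    · rintro ⟨m, n⟩ hmn
      refine if_neg fun ⟨k, hk⟩ => hmn ⟨(k, m - k), ?_⟩
      dsimp only at hk ⊢
      ext <;> dsimp only <;> omega
    · exact if_pos ⟨p.1, by dsimp only; ring⟩
  · have hi : Function.Injective fun p : ℤ × ℤ => (p.1 + p.2, p.1 - p.2 + 1) := by
      rintro ⟨a, b⟩ ⟨c, d⟩ h
      simp only [Prod.mk.injEq] at h ⊢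
      omega
    refine (hi.hasSum_iff ?_).1 (hb.congr_fun fun p => ?_)
    · rintro ⟨m, n⟩ hmn
      by_cases h : Even (m + n)
      · exact if_pos h
      · obtain ⟨k, hk⟩ := Int.not_even_iff_odd.1 h
        refine absurd ⟨(k, m - k), ?_⟩ hmn
        dsimp only
        ext <;> dsimp only <;> omega
    · have : ¬ Even (p.1 + p.2 + (p.1 - p.2 + 1)) :=
        Int.not_even_iff_odd.2 ⟨p.1, by ring⟩
      exact if_neg this

/-- The product of two theta functions in terms of theta functions of the doubled base. -/
theorem jTheta_mul {u v q : ℂ} (hu : u ≠ 0) (hv : v ≠ 0) (hq0 : q ≠ 0) (hq : ‖q‖ < 1) :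
    jTheta u q * jTheta v q =
      jTheta (-(u * v)) (q ^ 2) * jTheta (-(q * u / v)) (q ^ 2) -
        v * (jTheta (-(q * u * v)) (q ^ 2) * jTheta (-(u / v)) (q ^ 2)) := by
  have hq2 := norm_sq_lt_one hq
  have hq20 := pow_ne_zero 2 hq0
  have n1 : -(u * v) ≠ 0 := neg_ne_zero.2 (mul_ne_zero hu hv)
  have n2 : -(q * u / v) ≠ 0 := neg_ne_zero.2 (div_ne_zero (mul_ne_zero hq0 hu) hv)
  have n3 : -(q * u * v) ≠ 0 := neg_ne_zero.2 (mul_ne_zero (mul_ne_zero hq0 hu) hv)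
  have n4 : -(u / v) ≠ 0 := neg_ne_zero.2 (div_ne_zero hu hv)
  have h1 := hasSum_thetaTerm_mul n1 n2 hq20 hq2
  have h2 := (hasSum_thetaTerm_mul n3 n4 hq20 hq2).mul_left (-v)
  have hm : (-1 : ℂ) ≠ 0 := by norm_num
  have hsq : ∀ r : ℤ, (q ^ 2) ^ binom2 r = q ^ (r * (r - 1)) := fun r => by
    rw [← zpow_natCast q 2, ← zpow_mul, ← two_mul_binom2]
    norm_num
  have h := hasSum_of_parity (F := fun p => thetaTerm u q p.1 * thetaTerm v q p.2)
    (h1.congr_fun fun p => ?_) (h2.congr_fun fun p => ?_)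
  · rw [(hasSum_thetaTerm_mul hu hv hq0 hq).unique h]
    ring
  · obtain ⟨s, t⟩ := p
    dsimp only
    have e1 : (-1 : ℂ) ^ (s + t) * (-1) ^ (s - t) = 1 := by
      rw [← zpow_add₀ hm, show s + t + (s - t) = s + s by ring, zpow_add₀ hm,
        neg_one_zpow_mul_self]
    have e2 : q ^ binom2 (s + t) * q ^ binom2 (s - t) =
        q ^ (s * (s - 1)) * q ^ (t * (t - 1)) * q ^ t := by
      rw [← zpow_add₀ hq0, ← zpow_add₀ hq0, ← zpow_add₀ hq0]
      congr 1
      have a1 := two_mul_binom2 (s + t)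
      have a2 := two_mul_binom2 (s - t)
      linarith
    rw [thetaTerm_neg, thetaTerm_neg, hsq, hsq, thetaTerm, thetaTerm, mul_zpow, div_zpow, mul_zpow,
      zpow_add₀ hu, zpow_sub₀ hv]
    linear_combination (q ^ binom2 (s + t) * q ^ binom2 (s - t) * (u ^ s * u ^ t) *
      (v ^ s / v ^ t)) * e1 + ((u ^ s * u ^ t) * (v ^ s / v ^ t)) * e2
  · obtain ⟨s, t⟩ := p
    dsimp only
    have e1 : (-1 : ℂ) ^ (s + t) * (-1) ^ (s - t + 1) = -1 := by
      rw [← zpow_add₀ hm, show s + t + (s - t + 1) = s + s + 1 by ring, zpow_add₀ hm, zpow_add₀ hm,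
        neg_one_zpow_mul_self, zpow_one, one_mul]
    have e2 : q ^ binom2 (s + t) * q ^ binom2 (s - t + 1) =
        q ^ (s * (s - 1)) * q ^ (t * (t - 1)) * q ^ s := by
      rw [← zpow_add₀ hq0, ← zpow_add₀ hq0, ← zpow_add₀ hq0]
      congr 1
      have a1 := two_mul_binom2 (s + t)
      have a2 := two_mul_binom2 (s - t + 1)
      linarith
    rw [thetaTerm_neg, thetaTerm_neg, hsq, hsq, thetaTerm, thetaTerm, mul_zpow, div_zpow, mul_zpow,
      zpow_add₀ hu, zpow_add₀ hv, zpow_sub₀ hv, zpow_one]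
    linear_combination (q ^ binom2 (s + t) * q ^ binom2 (s - t + 1) * (u ^ s * u ^ t) *
      (v ^ s / v ^ t * v)) * e1 - ((u ^ s * u ^ t) * (v ^ s / v ^ t * v)) * e2

theorem jTheta_div (x q : ℂ) (hq : q ≠ 0) : jTheta (q / x) q = jTheta x q := by
  rw [jTheta, jTheta, div_div_cancel₀ hq, mul_comm (qPochInf x q)]

theorem jTheta_inv {x q : ℂ} (hx : x ≠ 0) (hq : ‖q‖ < 1) : jTheta x⁻¹ q = -(jTheta x q / x) := by
  rw [jTheta, jTheta, qPochInf_eq_one_sub_mul x⁻¹ hq, qPochInf_eq_one_sub_mul x hq, div_inv_eq_mul,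
    inv_mul_eq_div, mul_comm q x]
  field_simp
  ring

theorem qPochInf_eq_mul_sq (x : ℂ) {q : ℂ} (hq : ‖q‖ < 1) :
    qPochInf x q = qPochInf x (q ^ 2) * qPochInf (x * q) (q ^ 2) := by
  rw [qPochInf_eq_prod x hq (m := 2) two_pos]
  simp [prod_range_succ]

/-- From `(x; q)_∞ (-x; q)_∞ = (x^2; q^2)_∞`. -/
theorem jTheta_mul_neg {x q : ℂ} (hq : ‖q‖ < 1) :
    jTheta x q * jTheta (-x) q * qPochInf (q ^ 2) (q ^ 2) =
      jTheta (x ^ 2) (q ^ 2) * qPochInf q q ^ 2 := by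
  rw [jTheta, jTheta, jTheta, ← qPochInf_mul_neg x hq, ← div_pow, ← qPochInf_mul_neg (q / x) hq,
    div_neg]
  ring

/-- From the splitting of each infinite product by the parity of its index. -/
theorem jTheta_mul_shift {x q : ℂ} (hq0 : q ≠ 0) (hq : ‖q‖ < 1) :
    jTheta x (q ^ 2) * jTheta (x * q) (q ^ 2) * qPochInf q q =
      jTheta x q * qPochInf (q ^ 2) (q ^ 2) ^ 2 := by
  have e1 : q ^ 2 / (x * q) = q / x := by rw [sq, mul_comm x, mul_div_mul_left _ _ hq0]
  have e2 : q / x * q = q ^ 2 / x := by ring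
  rw [jTheta, jTheta, jTheta, qPochInf_eq_mul_sq x hq, qPochInf_eq_mul_sq (q / x) hq, e1, e2]
  ring

theorem jTheta_self_cube {q : ℂ} (hq0 : q ≠ 0) (hq : ‖q‖ < 1) :
    jTheta q (q ^ 3) = qPochInf q q := by
  rw [qPochInf_eq_prod q hq (m := 3) three_pos, jTheta, show q ^ 3 / q = q * q by field_simp]
  simp only [prod_range_succ, prod_range_zero, one_mul, pow_zero, mul_one, pow_one]
  rw [show q * q ^ 2 = q ^ 3 by ring]

theorem jTheta_self_sq {q : ℂ} (hq0 : q ≠ 0) (hq : ‖q‖ < 1) :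
    jTheta q (q ^ 2) * qPochInf (q ^ 2) (q ^ 2) = qPochInf q q ^ 2 := by
  rw [qPochInf_eq_mul_sq q hq, jTheta, show q ^ 2 / q = q by field_simp, ← sq q]
  ring

theorem qPochInf_mul_neg_self {q : ℂ} (hq : ‖q‖ < 1) :
    qPochInf q q * qPochInf (-q) q = qPochInf (q ^ 2) (q ^ 2) := qPochInf_mul_neg q hq

theorem jTheta_neg_one {q : ℂ} (hq : ‖q‖ < 1) :
    jTheta (-1) q * qPochInf q q = 2 * qPochInf (q ^ 2) (q ^ 2) ^ 2 := by
  rw [jTheta, qPochInf_eq_one_sub_mul (-1) hq, ← qPochInf_mul_neg_self hq, div_neg, div_one,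
    neg_one_mul]
  ring

/-- Gauss's evaluation of the series over the triangular numbers: the theta series of `-q` runs
through them twice. -/
theorem tsum_pow_choose_two {q : ℂ} (hq0 : q ≠ 0) (hq : ‖q‖ < 1) :
    (∑' m : ℕ, q ^ (m + 1).choose 2) * qPochInf q q = qPochInf (q ^ 2) (q ^ 2) ^ 2 := by
  have hs : Summable fun m : ℕ => q ^ (m + 1).choose 2 :=
    summable_of_norm_le_pow hq fun m => norm_pow_choose_two_le hq m 0
  have h1 : HasSum (fun n : ℕ => thetaTerm (-q) q n) (∑' m : ℕ, q ^ (m + 1).choose 2) :=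
    hs.hasSum.congr_fun fun n => by
      rw [thetaTerm_neg, ← zpow_add₀ hq0, ← binom2_add_one, ← zpow_natCast, ← binom2_natCast]
      push_cast
      rfl
  have h2 : HasSum (fun n : ℕ => thetaTerm (-q) q (-((n : ℤ) + 1)))
      (∑' m : ℕ, q ^ (m + 1).choose 2) :=
    hs.hasSum.congr_fun fun n => by
      rw [thetaTerm_neg, ← zpow_add₀ hq0, ← binom2_add_one, ← zpow_natCast, ← binom2_natCast,
        show -((n : ℤ) + 1) + 1 = 1 - (n + 1) by ring, binom2_one_sub]
      push_cast
      rfl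
  have h3 := (HasSum.of_nat_of_neg_add_one h1 h2).tsum_eq
  rw [tsum_thetaTerm (neg_ne_zero.2 hq0) hq0 hq] at h3
  have h4 := jTheta_neg_one hq
  have h5 := jTheta_div (-1) q hq0
  rw [div_neg, div_one] at h5
  rw [← h5, h3] at h4
  linear_combination h4 / 2

/-! ### Theta evaluations -/

theorem norm_pow_lt_one {q : ℂ} (hq : ‖q‖ < 1) {k : ℕ} (hk : k ≠ 0) : ‖q ^ k‖ < 1 := by
  rw [norm_pow]; exact pow_lt_one₀ (norm_nonneg _) hq hk

theorem bigJ_ne_zero {q : ℂ} (hq : ‖q‖ < 1) {k : ℕ} (hk : k ≠ 0) : bigJ k q ≠ 0 :=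
  qPochInf_ne_zero_of_norm_lt_one (norm_pow_lt_one hq hk) (norm_pow_lt_one hq hk)

theorem bigJ_pow (k m : ℕ) (q : ℂ) : bigJ k (q ^ m) = bigJ (m * k) q := by
  rw [bigJ, bigJ, pow_mul]

theorem bigJ_eq (k : ℕ) (q : ℂ) : bigJ k q = qPochInf (q ^ k) (q ^ k) := rfl

theorem jTheta_pow_three_mul {q : ℂ} (hq0 : q ≠ 0) (hq : ‖q‖ < 1) (k : ℕ) (hk : k ≠ 0) :
    jTheta (q ^ k) (q ^ (k * 3)) = bigJ k q := by
  rw [pow_mul, jTheta_self_cube (pow_ne_zero k hq0) (norm_pow_lt_one hq hk), bigJ]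

theorem jTheta_pow_four_twelve {q : ℂ} (hq0 : q ≠ 0) (hq : ‖q‖ < 1) :
    jTheta (q ^ 4) (q ^ 12) = bigJ 4 q :=
  jTheta_pow_three_mul hq0 hq 4 (by norm_num)

theorem jTheta_sq_six {q : ℂ} (hq0 : q ≠ 0) (hq : ‖q‖ < 1) :
    jTheta (q ^ 2) (q ^ 6) = bigJ 2 q :=
  jTheta_pow_three_mul hq0 hq 2 (by norm_num)

theorem jTheta_pow_three_six {q : ℂ} (hq0 : q ≠ 0) (hq : ‖q‖ < 1) :
    jTheta (q ^ 3) (q ^ 6) * bigJ 6 q = bigJ 3 q ^ 2 := by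
  have h := jTheta_self_sq (pow_ne_zero 3 hq0) (norm_pow_lt_one hq three_ne_zero)
  rwa [← pow_mul] at h

theorem jTheta_sq_twelve {q : ℂ} (hq0 : q ≠ 0) (hq : ‖q‖ < 1) :
    jTheta (q ^ 2) (q ^ 12) * bigJ 4 q * bigJ 6 q = bigJ 2 q * bigJ 12 q ^ 2 := by
  have h := jTheta_mul_shift (x := q ^ 2) (pow_ne_zero 6 hq0) (norm_pow_lt_one hq (by norm_num))
  rw [← pow_mul, ← pow_add, jTheta_sq_six hq0 hq] at h
  have h2 := jTheta_div (q ^ 8) (q ^ 12) (pow_ne_zero _ hq0)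
  rw [show q ^ 12 / q ^ 8 = q ^ 4 by field_simp, jTheta_pow_four_twelve hq0 hq] at h2
  rw [← h2] at h
  exact h

theorem jTheta_self_six {q : ℂ} (hq0 : q ≠ 0) (hq : ‖q‖ < 1) :
    jTheta q (q ^ 6) * bigJ 2 q * bigJ 3 q = bigJ 1 q * bigJ 6 q ^ 2 := by
  have h := jTheta_mul_shift (x := q) (pow_ne_zero 3 hq0) (norm_pow_lt_one hq three_ne_zero)
  have h1 := jTheta_pow_three_mul hq0 hq 1 one_ne_zero
  rw [pow_one, one_mul] at h1
  rw [← pow_mul, h1] at h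
  have h2 := jTheta_div (q * q ^ 3) (q ^ 6) (pow_ne_zero _ hq0)
  rw [show q ^ 6 / (q * q ^ 3) = q ^ 2 by field_simp, jTheta_sq_six hq0 hq] at h2
  rw [← h2] at h
  exact h

theorem jTheta_neg_sq_six {q : ℂ} (hq0 : q ≠ 0) (hq : ‖q‖ < 1) :
    jTheta (-q ^ 2) (q ^ 6) * bigJ 2 q * bigJ 12 q = bigJ 4 q * bigJ 6 q ^ 2 := by
  have h := jTheta_mul_neg (x := q ^ 2) (norm_pow_lt_one hq (k := 6) (by norm_num))
  rw [← pow_mul, ← pow_mul, jTheta_sq_six hq0 hq, jTheta_pow_four_twelve hq0 hq] at h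
  rw [bigJ_eq 6, bigJ_eq 12, ← h]
  ring

theorem jTheta_neg_pow_four_twelve {q : ℂ} (hq0 : q ≠ 0) (hq : ‖q‖ < 1) :
    jTheta (-q ^ 4) (q ^ 12) * bigJ 4 q * bigJ 24 q = bigJ 8 q * bigJ 12 q ^ 2 := by
  have h := jTheta_neg_sq_six (pow_ne_zero 2 hq0) (norm_pow_lt_one hq two_ne_zero)
  simpa only [bigJ_pow, ← pow_mul, Nat.reduceMul] using h

theorem jTheta_neg_sq_twelve {q : ℂ} (hq0 : q ≠ 0) (hq : ‖q‖ < 1) :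
    jTheta (-q ^ 2) (q ^ 12) * bigJ 2 q * bigJ 8 q * bigJ 12 q =
      bigJ 4 q ^ 2 * bigJ 6 q * bigJ 24 q := by
  have h := jTheta_mul_neg (x := q ^ 2) (norm_pow_lt_one hq (k := 12) (by norm_num))
  have h1 := jTheta_sq_twelve (pow_ne_zero 2 hq0) (norm_pow_lt_one hq two_ne_zero)
  simp only [bigJ_pow, ← pow_mul, Nat.reduceMul] at h1
  have h2 := jTheta_sq_twelve hq0 hq
  rw [← pow_mul, ← pow_mul] at h
  change _ * _ * bigJ 24 q = _ * bigJ 12 q ^ 2 at h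
  have n4 := bigJ_ne_zero hq (k := 4) (by norm_num)
  have n12 := bigJ_ne_zero hq (k := 12) (by norm_num)
  have n24 := bigJ_ne_zero hq (k := 24) (by norm_num)
  have e : (2 * 2 : ℕ) = 4 := rfl
  have e' : (12 * 2 : ℕ) = 24 := rfl
  rw [e, e'] at h
  generalize jTheta (q ^ 2) (q ^ 12) = a at *
  generalize jTheta (-q ^ 2) (q ^ 12) = b at *
  generalize jTheta (q ^ 4) (q ^ 24) = c at *
  have hm : bigJ 12 q ^ 2 * bigJ 24 q ≠ 0 := mul_ne_zero (pow_ne_zero 2 n12) n24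
  refine mul_left_cancel₀ hm ?_
  linear_combination (-b * bigJ 8 q * bigJ 12 q * bigJ 24 q) * h2 +
    bigJ 4 q * bigJ 6 q * bigJ 8 q * bigJ 12 q * h + bigJ 4 q * bigJ 6 q * bigJ 12 q ^ 2 * h1

theorem jTheta_pow_three_mul_jTheta_self {q : ℂ} (hq0 : q ≠ 0) (hq : ‖q‖ < 1) :
    jTheta (q ^ 3) (q ^ 6) * jTheta q (q ^ 6) =
      jTheta (-q ^ 4) (q ^ 12) ^ 2 - q * jTheta (-q ^ 2) (q ^ 12) ^ 2 := by
  have h := jTheta_mul (pow_ne_zero 3 hq0) hq0 (pow_ne_zero 6 hq0) (norm_pow_lt_one hq (k := 6)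
    (by norm_num))
  have h1 := jTheta_div (-q ^ 4) (q ^ 12) (pow_ne_zero _ hq0)
  have h2 := jTheta_div (-q ^ 2) (q ^ 12) (pow_ne_zero _ hq0)
  rw [show q ^ 12 / -q ^ 4 = -(q ^ 6 * q ^ 3 / q) by field_simp] at h1
  rw [show q ^ 12 / -q ^ 2 = -(q ^ 6 * q ^ 3 * q) by field_simp] at h2
  rw [← pow_mul, h1, h2, show q ^ 3 * q = q ^ 4 by ring, show q ^ 3 / q = q ^ 2 by field_simp] at h
  rw [h]
  ring

theorem jTheta_neg_pow_three_mul_jTheta_self {q : ℂ} (hq0 : q ≠ 0) (hq : ‖q‖ < 1) :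
    jTheta (-q ^ 3) (q ^ 6) * jTheta q (q ^ 6) =
      jTheta (q ^ 4) (q ^ 12) ^ 2 - q * jTheta (q ^ 2) (q ^ 12) ^ 2 := by
  have h := jTheta_mul (neg_ne_zero.2 (pow_ne_zero 3 hq0)) hq0 (pow_ne_zero 6 hq0)
    (norm_pow_lt_one hq (k := 6) (by norm_num))
  have h1 := jTheta_div (q ^ 4) (q ^ 12) (pow_ne_zero _ hq0)
  have h2 := jTheta_div (q ^ 2) (q ^ 12) (pow_ne_zero _ hq0)
  rw [show q ^ 12 / q ^ 4 = -(q ^ 6 * -q ^ 3 / q) by field_simp] at h1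
  rw [show q ^ 12 / q ^ 2 = -(q ^ 6 * -q ^ 3 * q) by field_simp] at h2
  rw [← pow_mul, h1, h2, show -(-q ^ 3 * q) = q ^ 4 by ring,
    show -(-q ^ 3 / q) = q ^ 2 by field_simp] at h
  rw [h]
  ring

/-- The theta quotients that arise from the partial fractions collapse to a single product. Here
`j(-q^3; q^6)` and `j(-q; q^6)` enter through their products with `j(q; q^6)`. -/
theorem theta_collapse {q : ℂ} (hq0 : q ≠ 0) (hq : ‖q‖ < 1) :
    bigJ 6 q ^ 3 * (q * jTheta (-1) (q ^ 6) * jTheta (-q) (q ^ 6) +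
        2 * jTheta (-q ^ 3) (q ^ 6) * jTheta (-q ^ 2) (q ^ 6)) /
      (jTheta (q ^ 3) (q ^ 6) * jTheta (-q) (q ^ 6) * jTheta (-1) (q ^ 6) * bigJ 2 q) =
      bigJ 4 q ^ 4 * bigJ 6 q ^ 6 / (bigJ 2 q ^ 3 * bigJ 3 q ^ 2 * bigJ 12 q ^ 4) := by
  have f1 := jTheta_mul_neg (x := q) (norm_pow_lt_one hq (k := 6) (by norm_num))
  rw [← pow_mul] at f1
  change _ * _ * bigJ 12 q = _ * bigJ 6 q ^ 2 at f1
  have f2 := jTheta_neg_pow_three_mul_jTheta_self hq0 hq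
  rw [jTheta_pow_four_twelve hq0 hq] at f2
  have f4 := jTheta_sq_twelve hq0 hq
  have f5 := jTheta_neg_sq_six hq0 hq
  have f6 := jTheta_neg_one (norm_pow_lt_one hq (k := 6) (by norm_num))
  rw [← pow_mul] at f6
  change _ * bigJ 6 q = 2 * bigJ 12 q ^ 2 at f6
  have f7 := jTheta_pow_three_six hq0 hq
  have e' : (6 * 2 : ℕ) = 12 := rfl
  rw [e'] at f1
  have n2 := bigJ_ne_zero hq (k := 2) (by norm_num)
  have n3 := bigJ_ne_zero hq (k := 3) (by norm_num)
  have n4 := bigJ_ne_zero hq (k := 4) (by norm_num)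
  have n6 := bigJ_ne_zero hq (k := 6) (by norm_num)
  have n12 := bigJ_ne_zero hq (k := 12) (by norm_num)
  generalize jTheta q (q ^ 6) = a at *
  generalize jTheta (-q) (q ^ 6) = b at *
  generalize jTheta (q ^ 2) (q ^ 12) = c at *
  generalize jTheta (-q ^ 2) (q ^ 6) = d at *
  generalize jTheta (-1) (q ^ 6) = e at *
  generalize jTheta (q ^ 3) (q ^ 6) = g at *
  generalize jTheta (-q ^ 3) (q ^ 6) = h at *
  generalize bigJ 2 q = J2 at *
  generalize bigJ 3 q = J3 at *
  generalize bigJ 4 q = J4 at *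
  generalize bigJ 6 q = J6 at *
  generalize bigJ 12 q = J12 at *
  have hc : c = J2 * J12 ^ 2 / (J4 * J6) := by field_simp; linear_combination f4
  have hd : d = J4 * J6 ^ 2 / (J2 * J12) := by field_simp; linear_combination f5
  have he : e = 2 * J12 ^ 2 / J6 := by field_simp; linear_combination f6
  have hg : g = J3 ^ 2 / J6 := by field_simp; linear_combination f7
  have hab : a * b = J2 * J12 * J6 / J4 := by
    rw [hc] at f1
    field_simp at f1 ⊢
    linear_combination f1
  -- `a` and `b` are nonzero as factors of a nonzero product
  have hb : b ≠ 0 := by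
    rintro rfl
    rw [mul_zero, eq_comm] at hab
    refine absurd hab (div_ne_zero (mul_ne_zero (mul_ne_zero n2 n12) n6) n4)
  have ha : a = J2 * J12 * J6 / J4 / b := by field_simp at hab ⊢; linear_combination hab
  have ha0 : a ≠ 0 := by
    rw [ha]
    exact div_ne_zero (div_ne_zero (mul_ne_zero (mul_ne_zero n2 n12) n6) n4) hb
  have hh : h = (J4 ^ 2 - q * c ^ 2) / a := by field_simp; exact f2
  rw [hh, ha, hc, hd, he, hg]
  clear f1 f2 f4 f5 f6 f7 hab ha hh hc hd he hg
  field_simp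
  ring

/-- With the theta functions evaluated as products, this is
`jTheta_pow_three_mul_jTheta_self` up to a common factor. -/
theorem theta_difference {q : ℂ} (hq0 : q ≠ 0) (hq : ‖q‖ < 1) :
    bigJ 8 q ^ 4 * bigJ 12 q ^ 6 / (bigJ 4 q ^ 3 * bigJ 6 q ^ 2 * bigJ 24 q ^ 4) -
        q * (bigJ 4 q ^ 3 / bigJ 2 q ^ 2) =
      bigJ 1 q * bigJ 3 q * bigJ 8 q ^ 2 * bigJ 12 q ^ 2 /
        (bigJ 2 q * bigJ 4 q * bigJ 6 q * bigJ 24 q ^ 2) := by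
  have f1 := jTheta_pow_three_mul_jTheta_self hq0 hq
  have f2 := jTheta_neg_pow_four_twelve hq0 hq
  have f3 := jTheta_neg_sq_twelve hq0 hq
  have f4 := jTheta_self_six hq0 hq
  have f5 := jTheta_pow_three_six hq0 hq
  have n2 := bigJ_ne_zero hq (k := 2) (by norm_num)
  have n3 := bigJ_ne_zero hq (k := 3) (by norm_num)
  have n4 := bigJ_ne_zero hq (k := 4) (by norm_num)
  have n6 := bigJ_ne_zero hq (k := 6) (by norm_num)
  have n8 := bigJ_ne_zero hq (k := 8) (by norm_num)
  have n12 := bigJ_ne_zero hq (k := 12) (by norm_num)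
  have n24 := bigJ_ne_zero hq (k := 24) (by norm_num)
  generalize jTheta q (q ^ 6) = a at *
  generalize jTheta (q ^ 3) (q ^ 6) = b at *
  generalize jTheta (-q ^ 4) (q ^ 12) = c at *
  generalize jTheta (-q ^ 2) (q ^ 12) = d at *
  generalize bigJ 1 q = J1 at *
  generalize bigJ 2 q = J2 at *
  generalize bigJ 3 q = J3 at *
  generalize bigJ 4 q = J4 at *
  generalize bigJ 6 q = J6 at *
  generalize bigJ 8 q = J8 at *
  generalize bigJ 12 q = J12 at *
  generalize bigJ 24 q = J24 at *
  have hc : c = J8 * J12 ^ 2 / (J4 * J24) := by field_simp; linear_combination f2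
  have hd : d = J4 ^ 2 * J6 * J24 / (J2 * J8 * J12) := by field_simp; linear_combination f3
  have ha : a = J1 * J6 ^ 2 / (J2 * J3) := by field_simp; linear_combination f4
  have hb : b = J3 ^ 2 / J6 := by field_simp; linear_combination f5
  have e1 : J8 ^ 4 * J12 ^ 6 / (J4 ^ 3 * J6 ^ 2 * J24 ^ 4) - q * (J4 ^ 3 / J2 ^ 2) =
      J8 ^ 2 * J12 ^ 2 / (J4 * J6 ^ 2 * J24 ^ 2) * (c ^ 2 - q * d ^ 2) := by
    rw [hc, hd]
    clear f1 f2 f3 f4 f5 ha hb hc hd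
    field_simp
  rw [e1, ← f1, ha, hb]
  clear f1 f2 f3 f4 f5 ha hb hc hd e1
  field_simp

/-! ### The third order function as an Appell-Lerch series -/

theorem one_sub_mul_zpow_ne_zero {s q : ℂ} (hs : ‖s‖ = 1) (hq : ‖q‖ < 1) {m : ℤ}
    (hm : m ≠ 0) : 1 - s * q ^ m ≠ 0 := by
  intro h
  have h1 : ‖q‖ ^ m = 1 := by
    rw [← norm_zpow, ← one_mul ‖q ^ m‖, ← hs, ← norm_mul, ← sub_eq_zero.1 h, norm_one, hs]
  exact hm ((zpow_eq_one_iff_right₀ (norm_nonneg q) hq.ne).1 h1)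

/-- The bilateral form of the numerator series of `ω`. With `y = p^{2n+1}`, the terms of index `n`
and `-1 - n` of the right side add up to that of the left side by
`(1 + 2y) / (1 - y^3) + (y^3 + 2y^2) / (1 - y^3) = (1 + y) / (1 - y)`. -/
theorem tsum_omega_bilateral {p : ℂ} (hp0 : p ≠ 0) (hp : ‖p‖ < 1) :
    ∑' n : ℕ, (-1) ^ n * p ^ (3 * (n * (n + 1))) * (1 + p ^ (2 * n + 1)) /
        (1 - p ^ (2 * n + 1)) =
      ∑' n, lerchTerm (p ^ 6) 1 (p ^ 3) n +
        2 * (p * ∑' n, lerchTerm (p ^ 6) (p ^ 2) (p ^ 3) n) := by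
  have hp6 := norm_pow_lt_one hp (k := 6) (by norm_num)
  have hp60 := pow_ne_zero 6 hp0
  have hpow : ∀ n : ℤ, p ^ 3 * (p ^ 6) ^ n = (p ^ (2 * n + 1)) ^ 3 := fun n => by
    rw [← zpow_natCast p 6, ← zpow_natCast p 3, ← zpow_mul, ← zpow_natCast (p ^ (2 * n + 1)),
      ← zpow_mul, ← zpow_add₀ hp0]
    congr 1
    push_cast
    ring
  have hne : ∀ n : ℤ, 1 - p ^ 3 * (p ^ 6) ^ n ≠ 0 := fun n => by
    rw [hpow, ← zpow_natCast, ← zpow_mul, ← one_mul (p ^ _)]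
    exact one_sub_mul_zpow_ne_zero norm_one hp (by push_cast; omega)
  have s1 := (summable_norm_lerchTerm hp60 hp6 one_ne_zero (pow_ne_zero 3 hp0) hne).of_norm
  have s2 := (summable_norm_lerchTerm hp60 hp6 (pow_ne_zero 2 hp0) (pow_ne_zero 3 hp0) hne).of_norm
  set F : ℤ → ℂ := fun n => lerchTerm (p ^ 6) 1 (p ^ 3) n +
    2 * (p * lerchTerm (p ^ 6) (p ^ 2) (p ^ 3) n) with hF
  have hFs : Summable F := s1.add ((s2.mul_left p).mul_left 2)
  have hFt : ∑' n, F n = ∑' n, lerchTerm (p ^ 6) 1 (p ^ 3) n +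
      2 * (p * ∑' n, lerchTerm (p ^ 6) (p ^ 2) (p ^ 3) n) := by
    rw [s1.tsum_add ((s2.mul_left p).mul_left 2), tsum_mul_left, tsum_mul_left]
  have hFe : ∀ n : ℤ, F n = (-1) ^ n * (p ^ 6) ^ binom2 (n + 1) * (1 + 2 * p ^ (2 * n + 1)) /
      (1 - (p ^ (2 * n + 1)) ^ 3) := fun n => by
    have e : (p ^ 2) ^ n * p = p ^ (2 * n + 1) := by
      rw [← zpow_natCast p 2, ← zpow_mul, zpow_add₀ hp0, zpow_one]
      norm_num
    simp only [hF, lerchTerm, hpow, one_zpow, ← e]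
    ring
  have f1 : Summable fun n : ℕ => F n := hFs.comp_injective Nat.cast_injective
  have f2 : Summable fun n : ℕ => F (-((n : ℤ) + 1)) :=
    hFs.comp_injective fun a b h => by simpa using h
  rw [← hFt, tsum_of_nat_of_neg_add_one f1 f2, ← f1.tsum_add f2]
  refine tsum_congr fun n => ?_
  have e1 : binom2 ((n : ℤ) + 1) = ((n + 1).choose 2 : ℕ) := by
    rw [← binom2_natCast]; push_cast; rfl
  have e2 : binom2 (-((n : ℤ) + 1) + 1) = ((n + 1).choose 2 : ℕ) := by
    rw [← e1, ← binom2_one_sub]; congr 1; ring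
  have e3 : (-1 : ℂ) ^ (-((n : ℤ) + 1)) = -(-1) ^ n := by
    rw [zpow_neg, zpow_add₀ (by norm_num), zpow_one, zpow_natCast, mul_inv, ← inv_pow, inv_neg_one]
    ring
  have e4 : p ^ (2 * -((n : ℤ) + 1) + 1) = (p ^ (2 * n + 1))⁻¹ := by
    rw [← zpow_natCast, ← zpow_neg]
    congr 1
  have e5 : p ^ (2 * (n : ℤ) + 1) = p ^ (2 * n + 1) := by
    rw [← zpow_natCast]
    push_cast
    rfl
  have e6 : p ^ (3 * (n * (n + 1))) = (p ^ 6) ^ (n + 1).choose 2 := by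
    rw [← pow_mul]
    congr 1
    have := two_mul_binom2 ((n : ℤ) + 1)
    rw [e1] at this
    zify
    linarith
  have h1 := hne n
  have h2 := one_sub_mul_zpow_ne_zero norm_one hp (s := 1) (m := 2 * (n : ℤ) + 1) (by omega)
  rw [hpow] at h1
  rw [one_mul] at h2
  rw [hFe, hFe, e1, e2, e3, e4, e5, zpow_natCast, zpow_natCast, e6]
  rw [e5] at h1 h2
  have h3 : p ^ (2 * n + 1) ≠ 0 := pow_ne_zero _ hp0
  generalize p ^ (2 * n + 1) = y at *
  generalize (p ^ 6) ^ (n + 1).choose 2 = W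
  generalize (-1 : ℂ) ^ n = s
  have h4 : 1 - (y⁻¹) ^ 3 ≠ 0 := by
    intro h
    field_simp at h
    exact h1 (by linear_combination -h)
  have e7 : (1 - (y⁻¹) ^ 3) = -(1 - y ^ 3) / y ^ 3 := by
    field_simp
    ring
  rw [e7]
  generalize h5 : 1 - y = a at *
  generalize h6 : 1 - y ^ 3 = b at *
  field_simp
  rw [← h5, ← h6]
  ring

/-- The summation index of `m(x, q, z)` is shifted by one against that of `lerchTerm`. -/
theorem mTerm_add_one {x q z : ℂ} (hz : z ≠ 0) (n : ℤ) :
    mTerm x q z (n + 1) = -z * lerchTerm q z (x * z) n := by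
  rw [mTerm, lerchTerm, zpow_add₀ hz, zpow_add₀ (by norm_num), zpow_one, zpow_one,
    add_sub_cancel_right]
  rw [show q ^ n * x * z = x * z * q ^ n by ring]
  ring

theorem hasSum_mTerm {x q z : ℂ} (hz : z ≠ 0) (h : Summable fun n => lerchTerm q z (x * z) n) :
    HasSum (mTerm x q z) (-z * ∑' n, lerchTerm q z (x * z) n) := by
  rw [← (Equiv.addRight (1 : ℤ)).hasSum_iff]
  exact (h.hasSum.mul_left (-z)).congr_fun fun n => mTerm_add_one hz n

/-- The series `ω` in terms of the Appell-Lerch series; the two partial fraction expansions replace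
the bilateral sums with poles at `p^{6n+3} = 1` by those with poles at `p^{6n+1} = -1`. -/
theorem tsum_omega_eq {p : ℂ} (hp0 : p ≠ 0) (hp : ‖p‖ < 1) :
    Summable (mTerm p (p ^ 6) (-1)) ∧
    p * ∑' n : ℕ, p ^ n / qPoch p (p ^ 2) (n + 1) =
      bigJ 4 p ^ 4 * bigJ 6 p ^ 6 / (bigJ 2 p ^ 3 * bigJ 3 p ^ 2 * bigJ 12 p ^ 4) -
        2 * mLerch p (p ^ 6) (-1) := by
  have hp6 := norm_pow_lt_one hp (k := 6) (by norm_num)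
  have hp60 := pow_ne_zero 6 hp0
  -- none of the theta products below vanishes, since no exponent is divisible by six
  have hne : ∀ {s : ℂ} (_ : ‖s‖ = 1) {k : ℕ} (_ : ¬ 6 ∣ k) (n : ℤ),
      1 - s * p ^ k * (p ^ 6) ^ n ≠ 0 := fun {s} hs {k} hk n => by
    rw [← zpow_natCast p 6, ← zpow_natCast p k, ← zpow_mul, mul_assoc, ← zpow_add₀ hp0]
    refine one_sub_mul_zpow_ne_zero hs hp ?_
    push_cast
    omega
  have h3 : ∀ n : ℤ, 1 - p ^ 3 * (p ^ 6) ^ n ≠ 0 := fun n => by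
    simpa using hne norm_one (show ¬ 6 ∣ 3 by norm_num) n
  have h1 : ∀ n : ℤ, 1 - -p * (p ^ 6) ^ n ≠ 0 := fun n => by
    simpa using hne (s := -1) (by simp) (show ¬ 6 ∣ 1 by norm_num) n
  have h2 : ∀ n : ℤ, 1 - -p ^ 2 * (p ^ 6) ^ n ≠ 0 := fun n => by
    simpa using hne (s := -1) (by simp) (show ¬ 6 ∣ 2 by norm_num) n
  have e31 : p ^ 3 / -p = -p ^ 2 := by field_simp
  have e13 : -p / p ^ 3 = (-p ^ 2)⁻¹ := by field_simp
  have n1 : -p ≠ 0 := neg_ne_zero.2 hp0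
  have n2 : -p ^ 2 ≠ 0 := neg_ne_zero.2 (pow_ne_zero 2 hp0)
  have n3 := pow_ne_zero 3 hp0
  have t1 := jTheta_ne_zero hp60 hp6 n1 h1
  have t2 := jTheta_ne_zero hp60 hp6 n2 h2
  have t3 := jTheta_ne_zero hp60 hp6 n3 h3
  have tm : jTheta (-1) (p ^ 6) ≠ 0 := by
    have h := jTheta_neg_one hp6
    intro h0
    rw [h0, zero_mul, eq_comm, ← pow_mul] at h
    exact mul_ne_zero two_ne_zero (pow_ne_zero 2 (bigJ_ne_zero hp (k := 12) (by norm_num))) h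
  have j2 := bigJ_ne_zero hp (k := 2) (by norm_num)
  have h31 : ∀ n : ℤ, 1 - p ^ 3 / -p * (p ^ 6) ^ n ≠ 0 := by rw [e31]; exact h2
  have jone : jTheta 1 (p ^ 6) = 0 := by
    rw [jTheta, qPochInf_eq_one_sub_mul 1 hp6, sub_self]
    ring
  -- for `w = b` the factor `j(w / b) = j(1) = 0` removes the second family of poles
  have A1 := jTheta_partialFraction hp60 hp6 n3 n1 n1 h3 h1 h31
  -- `w = -p ^ 3` makes `w / b = p ^ 2` and `w / a = -1`: the second series at the poles of `ω`, and
  -- the series of `m(p, p ^ 6, -1)`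
  have A2 := jTheta_partialFraction (w := -p ^ 3) hp60 hp6 n3 n1 (neg_ne_zero.2 n3) h3 h1 h31
  rw [e31, e13, div_self n1, jone, zero_div, zero_mul, add_zero, div_self (by
    rw [jTheta_inv n2 hp6]; exact neg_ne_zero.2 (div_ne_zero t2 n2)), one_mul] at A1
  rw [e31, e13, neg_div, div_self n3, neg_div_neg_eq, show p ^ 3 / p = p ^ 2 by field_simp,
    jTheta_inv n2 hp6, jTheta_sq_six hp0 hp] at A2
  have hs := (summable_norm_lerchTerm hp60 hp6 (z := -1) (by norm_num) n1 h1).of_norm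
  have hm := hasSum_mTerm (x := p) (q := p ^ 6) (z := -1) (by norm_num) (by simpa using hs)
  rw [mul_neg_one, neg_neg, one_mul] at hm
  refine ⟨hm.summable, ?_⟩
  rw [mLerch, hm.tsum_eq, tsum_omega hp, tsum_omega_bilateral hp0 hp, ← theta_collapse hp0 hp]
  change bigJ 6 p ^ 3 * _ / _ = _ at A1
  change bigJ 6 p ^ 3 * _ / _ = _ at A2
  rw [← bigJ_eq 2]
  generalize (∑' n, lerchTerm (p ^ 6) 1 (p ^ 3) n) = A at *
  generalize (∑' n, lerchTerm (p ^ 6) (p ^ 2) (p ^ 3) n) = B at *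
  generalize (∑' n, lerchTerm (p ^ 6) (-1) (-p) n) = L at *
  generalize jTheta (-1) (p ^ 6) = e at *
  generalize jTheta (-p) (p ^ 6) = b at *
  generalize jTheta (-p ^ 2) (p ^ 6) = d at *
  generalize jTheta (p ^ 3) (p ^ 6) = g at *
  generalize jTheta (-p ^ 3) (p ^ 6) = h at *
  generalize bigJ 2 p = J2 at *
  generalize bigJ 6 p = J6 at *
  clear hne h3 h1 h2 h31 hs hm
  rw [mul_div_mul_right _ _ t1] at A1
  have hB : B = (J6 ^ 3 * h / (g * b) - J2 / d * L) * d / (p ^ 2 * e) := by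
    field_simp at A2 ⊢
    linear_combination -A2
  rw [hB, ← A1]
  clear A1 A2 hB
  field_simp
  ring

theorem bigJ_four_eq {q : ℂ} (hq : ‖q‖ < 1) :
    bigJ 4 q = qPochInf (q ^ 2) (q ^ 2) * qPochInf (-q ^ 2) (q ^ 2) := by
  rw [qPochInf_mul_neg_self (norm_sq_lt_one hq), ← pow_mul, bigJ]

/-- The third order function `ν` in terms of `ω`: `tsum_pow_div_qPoch_mul_qPoch` for `b = q` in the
base `q^2`. -/
theorem nu3_eq_sub {q : ℂ} (hq0 : q ≠ 0) (hq : ‖q‖ < 1) :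
    nu3 q = bigJ 4 q ^ 3 / bigJ 2 q ^ 2 -
      q * ∑' n : ℕ, (q ^ 2) ^ n / qPoch (q ^ 2) ((q ^ 2) ^ 2) (n + 1) := by
  have hq2 := norm_sq_lt_one hq
  have h := tsum_pow_div_qPoch_mul_qPoch hq hq2
  have e1 : ∑' m : ℕ, (q ^ 2) ^ (m + 1).choose 2 / qPoch (-q) (q ^ 2) (m + 1) = nu3 q := by
    rw [nu3]
    refine tsum_congr fun n => ?_
    rw [nu3Term, ← pow_mul, Nat.choose_two_right,
      Nat.mul_div_cancel' (Nat.even_mul_pred_self _).two_dvd, Nat.add_sub_cancel, mul_comm (n + 1)]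
  have e2 := tsum_pow_choose_two (pow_ne_zero 2 hq0) hq2
  have e3 := qPochInf_eq_mul_sq (q ^ 2) hq2
  have e4 := bigJ_ne_zero hq (k := 2) two_ne_zero
  have e5 := bigJ_ne_zero hq (k := 4) (by norm_num)
  rw [e1, qPochInf_mul_neg q hq2] at h
  simp only [qPoch_mul_neg] at h
  rw [← sq (q ^ 2), ← pow_mul] at e3
  rw [← pow_mul] at e2 h ⊢
  change bigJ 2 q = _ * bigJ 4 q at e3
  change _ * bigJ 2 q = bigJ 4 q ^ 2 at e2
  have n1 : qPochInf (q ^ 2) (q ^ (2 * 2)) ≠ 0 := fun h0 => e4 (by rw [e3, h0, zero_mul])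
  have e6 : (∑' m : ℕ, (q ^ 2) ^ (m + 1).choose 2) / qPochInf (q ^ 2) (q ^ (2 * 2)) =
      bigJ 4 q ^ 3 / bigJ 2 q ^ 2 := by
    rw [div_eq_div_iff n1 (pow_ne_zero 2 e4)]
    linear_combination bigJ 2 q * e2 + bigJ 4 q ^ 2 * e3
  rw [← e6]
  linear_combination h

/-- The expression of `ω(q^2)` through `m(q^2, q^12, -1)` leaves a difference of two products,
which `theta_difference` evaluates. -/
theorem nu3_eq_mLerch {q : ℂ} (hq0 : q ≠ 0) (hq : ‖q‖ < 1) :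
    Summable (mTerm (q ^ 2) (q ^ 12) (-1)) ∧
    nu3 q = 2 * q⁻¹ * mLerch (q ^ 2) (q ^ 12) (-1) -
      q⁻¹ * (bigJ 1 q * bigJ 3 q * bigJ 8 q ^ 2 * bigJ 12 q ^ 2 /
        (bigJ 2 q * bigJ 4 q * bigJ 6 q * bigJ 24 q ^ 2)) := by
  obtain ⟨h1, h2⟩ := tsum_omega_eq (pow_ne_zero 2 hq0) (norm_sq_lt_one hq)
  have h3 := theta_difference hq0 hq
  have h4 := nu3_eq_sub hq0 hq
  simp only [bigJ_pow, Nat.reduceMul] at h2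
  rw [show q ^ 12 = (q ^ 2) ^ 6 by ring]
  refine ⟨h1, ?_⟩
  rw [h4, ← h3]
  generalize mLerch (q ^ 2) ((q ^ 2) ^ 6) (-1) = m at *
  generalize (∑' n : ℕ, (q ^ 2) ^ n / qPoch (q ^ 2) ((q ^ 2) ^ 2) (n + 1)) = S at *
  have e : S = q⁻¹ ^ 2 * (q ^ 2 * S) := by field_simp
  rw [e, h2]
  generalize bigJ 4 q ^ 3 / bigJ 2 q ^ 2 = U
  generalize bigJ 8 q ^ 4 * bigJ 12 q ^ 6 / (bigJ 4 q ^ 3 * bigJ 6 q ^ 2 * bigJ 24 q ^ 4) = V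
  field_simp
  ring

theorem nu3_eq_fHecke {q : ℂ} (hq0 : q ≠ 0) (hq : ‖q‖ < 1) :
    nu3 q = bigJ 4 q / bigJ 2 q ^ 2 * (fHecke 1 2 1 (q ^ 4) (q ^ 4) (q ^ 4) +
      q ^ 5 * fHecke 1 2 1 (q ^ 10) (q ^ 10) (q ^ 4)) := by
  have e4 : qPochInf (q ^ 2) (q ^ 2) ≠ 0 := bigJ_ne_zero hq (k := 2) two_ne_zero
  rw [nu3_eq_hecke hq0 hq, nu3Hecke, tsum_nu3HeckeTerm_eq_f hq0 hq, bigJ_four_eq hq, bigJ_eq]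
  congr 1
  field_simp

end MockTheta

theorem mainTheorem8 (q : ℂ) (hq0 : q ≠ 0) (hq1 : ‖q‖ < 1) :
    -- the Hecke-type representation of the sixth order function
    (Summable (MockTheta.psi6Term q) ∧ Summable (MockTheta.psi6HeckeTerm q) ∧
      MockTheta.psi6 q =
        q * (MockTheta.qPochInf q (q ^ 2) / MockTheta.qPochInf (q ^ 2) (q ^ 2)) *
          ∑' n : ℕ, MockTheta.psi6HeckeTerm q n) ∧
    -- the false analogue
    (Summable (MockTheta.sigmaTerm q) ∧ Summable (MockTheta.sigmaHeckeTerm q) ∧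
      ∑' n : ℕ, MockTheta.sigmaTerm q n = ∑' n : ℕ, MockTheta.sigmaHeckeTerm q n) ∧
    (Summable (MockTheta.fBarTerm 1 2 1 (-q ^ 4) (-q ^ 4) (q ^ 4)) ∧
      Summable (MockTheta.fBarTerm 1 2 1 (-q ^ 10) (-q ^ 10) (q ^ 4)) ∧
      ∑' n : ℕ, MockTheta.sigmaTerm q n =
        MockTheta.fBarHecke 1 2 1 (-q ^ 4) (-q ^ 4) (q ^ 4) -
          q ^ 5 * MockTheta.fBarHecke 1 2 1 (-q ^ 10) (-q ^ 10) (q ^ 4)) ∧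
    -- here `t` is any value of `q^{1/2}`
    (∀ t : ℂ, t ^ 2 = q →
      Summable (MockTheta.fBarTerm 1 2 1 (t ^ 3) (-t ^ 3) q) ∧
      ∑' n : ℕ, MockTheta.sigmaTerm q n = MockTheta.fBarHecke 1 2 1 (t ^ 3) (-t ^ 3) q) ∧
    -- the Hecke-type representation of the third order function, and its other two forms
    (Summable (MockTheta.nu3Term q) ∧ Summable (MockTheta.nu3HeckeTerm q) ∧
      MockTheta.nu3 q = MockTheta.nu3Hecke q) ∧
    (Summable (MockTheta.fTerm 1 2 1 (q ^ 4) (q ^ 4) (q ^ 4)) ∧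
      Summable (MockTheta.fTerm 1 2 1 (q ^ 10) (q ^ 10) (q ^ 4)) ∧
      MockTheta.nu3 q =
        MockTheta.bigJ 4 q / MockTheta.bigJ 2 q ^ 2 *
          (MockTheta.fHecke 1 2 1 (q ^ 4) (q ^ 4) (q ^ 4) +
            q ^ 5 * MockTheta.fHecke 1 2 1 (q ^ 10) (q ^ 10) (q ^ 4))) ∧
    (Summable (MockTheta.mTerm (q ^ 2) (q ^ 12) (-1)) ∧
      MockTheta.nu3 q =
        2 * q⁻¹ * MockTheta.mLerch (q ^ 2) (q ^ 12) (-1) -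
          q⁻¹ * (MockTheta.bigJ 1 q * MockTheta.bigJ 3 q * MockTheta.bigJ 8 q ^ 2 *
              MockTheta.bigJ 12 q ^ 2 /
            (MockTheta.bigJ 2 q * MockTheta.bigJ 4 q * MockTheta.bigJ 6 q *
              MockTheta.bigJ 24 q ^ 2))) ∧
    -- the equivalence with Mortenson's representation: under `q ↦ -q` the two sides of one
    -- identity become the respective sides of the other, and both representations hold
    (Summable (MockTheta.nu3NegTerm q) ∧ Summable (MockTheta.mortensonTerm q) ∧
      MockTheta.nu3 (-q) = ∑' n : ℕ, MockTheta.nu3NegTerm q n ∧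
      MockTheta.nu3Hecke (-q) = MockTheta.mortensonHecke q ∧
      ∑' n : ℕ, MockTheta.nu3NegTerm q n = MockTheta.mortensonHecke q ∧
      (MockTheta.nu3 (-q) = MockTheta.nu3Hecke (-q) ↔
        ∑' n : ℕ, MockTheta.nu3NegTerm q n = MockTheta.mortensonHecke q)) := by
  have hneg : ‖-q‖ < 1 := by rwa [norm_neg]
  have hS := MockTheta.tsum_sigmaTerm_eq hq0 hq1
  have hN := MockTheta.tsum_nu3NegTerm_eq hq0 hq1
  have hneg_eq := MockTheta.nu3_neg q
  have hnu := MockTheta.nu3_eq_hecke (neg_ne_zero.2 hq0) hneg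
  refine ⟨⟨MockTheta.summable_psi6Term hq0 hq1, MockTheta.summable_psi6HeckeTerm hq0 hq1,
    MockTheta.psi6_eq_hecke hq0 hq1⟩,
    ⟨MockTheta.summable_sigmaTerm hq0 hq1, MockTheta.summable_sigmaHeckeTerm hq0 hq1, hS⟩,
    ⟨(MockTheta.hasSum_fBarTerm_neg_pow hq0 hq1 (by norm_num) (by norm_num)).summable,
      (MockTheta.hasSum_fBarTerm_neg_pow hq0 hq1 (by norm_num) (by norm_num)).summable,
      hS.trans (MockTheta.tsum_sigmaHeckeTerm_eq_fBar hq0 hq1)⟩,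
    fun t ht => ?_,
    ⟨MockTheta.summable_nu3Term hq0 hq1, MockTheta.summable_nu3HeckeTerm hq0 hq1,
      MockTheta.nu3_eq_hecke hq0 hq1⟩,
    ⟨(MockTheta.hasSum_fTerm_pow hq0 hq1 (by norm_num) (by norm_num)).summable,
      (MockTheta.hasSum_fTerm_pow hq0 hq1 (by norm_num) (by norm_num)).summable,
      MockTheta.nu3_eq_fHecke hq0 hq1⟩,
    MockTheta.nu3_eq_mLerch hq0 hq1,
    MockTheta.summable_nu3NegTerm hq1, MockTheta.summable_mortensonTerm hq0 hq1, hneg_eq,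
    by rw [← hnu, hneg_eq, hN], hN, fun _ => hN, fun _ => hnu⟩
  subst ht
  have ht0 : t ≠ 0 := fun h => hq0 (by rw [h]; ring)
  have ht1 : ‖t‖ < 1 := by
    rw [norm_pow] at hq1
    exact (sq_lt_one_iff₀ (norm_nonneg _)).1 hq1
  have h := MockTheta.hasSum_fBarTerm_root ht0 ht1
  exact ⟨h.summable, hS.trans h.tsum_eq.symm⟩
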